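/- **Setting.** Let $G$ be a countable group with identity $e$ and let $\mu$ be a probability measure on $G$ with finite entropy, $H(\mu)=-\sum_g\mu(g)\log\mu(g)<\infty$. For a measure $\theta$ on $G$ let $\mathbf P_\theta$ be the law on the path space $G^{\mathbb Z_+}$ of the walk $x_n=x_0h_1\cdots h_n$, where $x_0$ has distribution $\theta$ and the increments $h_i$ are independent of $x_0$ and of each other and $\mu$-distributed; put $\mathbf P=\mathbf P_{\delta_e}$, and $\mathbf P_m$ for $\theta=m$ the counting measure. Let $T$ be the time shift $(Tx)_n=x_{n+1}$. The *Poisson boundary* of $(G,\mu)$ is the space of ergodic components of $T$ on $(G^{\mathbb Z_+},\mathbf P_m)$: a standard Borel $G$-space $\Gamma$ with a measurable map $\mathrm{bnd}:G^{\mathbb Z_+}\to\Gamma$ such that the $\sigma$-algebra of $\mathrm{bnd}$-preimages of measurable sets coincides modulo $\mathbf P_m$-null sets with the $\sigma$-algebra of $T$-invariant measurable sets, and $\mathrm{bnd}(gx)=g\,\mathrm{bnd}(x)$ for every $g\in G$ and $\mathbf P_m$-a.e. path $x$. It is endowed with the harmonic measure $\nu=\mathrm{bnd}_*\mathbf P$.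 A *$\mu$-boundary* $(\Gamma_\xi,\nu_\xi)$ is a quotient of $(\Gamma,\nu)$ by a $G$-invariant measurable partition $\xi$, i.e. a standard Borel $G$-space $\Gamma_\xi$ with a measurable map $\pi:\Gamma\to\Gamma_\xi$ such that $\nu_\xi=\pi_*\nu$ and, for every $g\in G$, $\pi(g\gamma)=g\pi(\gamma)$ for $\nu$-a.e. $\gamma$. It *is the Poisson boundary* if $\pi$ is an isomorphism modulo null sets of $(\Gamma,\nu)$ onto $(\Gamma_\xi,\nu_\xi)$. Let $\mathbf P^{\gamma_\xi}$, $\gamma_\xi\in\Gamma_\xi$, be the conditional measures of $\mathbf P$ with respect to the map $\pi\circ\mathrm{bnd}:G^{\mathbb Z_+}\to\Gamma_\xi$. A probability measure $\Lambda$ on $G^{\mathbb Z_+}$ *has asymptotic entropy* $\mathbf h(\Lambda)=h$ if $-\frac1n\log\Lambda\{x':x'_n=x_n\}\to h$ for $\Lambda$-a.e. $x$ and in $L^1(\Lambda)$. **Theorem.** Let $(\Gamma_\xi,\nu_\xi)$ be a $\mu$-boundary. 0. For $\nu_\xi$-a.e. $\gamma_\xi$, the measure $\mathbf P^{\gamma_\xi}$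 is the Doob transform of $\mathbf P$ determined by $\varphi(x)=\frac{d\,x\nu_\xi}{d\nu_\xi}(\gamma_\xi)$, i.e. the law of the Markov chain started at $e$ with transition probabilities $\mu(x^{-1}y)\,\varphi(y)/\varphi(x)$. 1. $(\Gamma_\xi,\nu_\xi)$ is the Poisson boundary if and only if for $\nu_\xi$-a.e. $\gamma_\xi$ the measure $\mathbf P^{\gamma_\xi}$ has asymptotic entropy $\mathbf h(\mathbf P^{\gamma_\xi})=0$. 2. $(\Gamma_\xi,\nu_\xi)$ is the Poisson boundary if and only if for $\nu_\xi$-a.e. $\gamma_\xi$ there are $\varepsilon>0$ and finite sets $A_n\subset G$ such that $\log|A_n|=o(n)$ and $\mathbf P^{\gamma_\xi}\{x:x_n\in A_n\}>\varepsilon$ for all sufficiently large $n$. -/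

import Mathlib

open MeasureTheory ProbabilityTheory Filter Topology
open scoped ENNReal

noncomputable section

namespace RandomWalk

universe u

variable {G : Type*} [Group G]

/-- The sample path `x₀, x₀h₀, x₀h₀h₁, …` with starting point `x₀` and right increments `hₙ`. -/
def samplePath (x₀ : G) (h : ℕ → G) : ℕ → G
  | 0 => x₀
  | n + 1 => samplePath x₀ h n * h n

/-- The time shift in the path space. -/
def timeShift (ω : ℕ → G) : ℕ → G := fun n => ω (n + 1)

/-- The coordinate-wise left action of `G` on the path space. -/
def translate (g : G) (ω : ℕ → G) : ℕ → G := fun n => g * ω n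

variable [MeasurableSpace G]

/-- The `σ`-algebra of shift-invariant measurable sets of paths. -/
@[reducible]
def invariantAlgebra (G : Type*) [MeasurableSpace G] : MeasurableSpace (ℕ → G) :=
  MeasurableSpace.invariants timeShift

/-- The Markov measure `P_θ` in the path space with initial distribution `θ`: the image of
`θ ⊗ μ ⊗ μ ⊗ ⋯` under the map that sends a starting point and increments to the sample path. -/
def markovMeasure (μ θ : Measure G) : Measure (ℕ → G) :=
  (θ.prod (Measure.infinitePi fun _ : ℕ => μ)).map fun p => samplePath p.1 p.2

/-- The measure `P`: the random walk started at the identity. -/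
def pathMeasure (μ : Measure G) : Measure (ℕ → G) := markovMeasure μ (Measure.dirac 1)

/-- The measure `P_m`: the random walk started from the counting measure. -/
def pathMeasureCount (μ : Measure G) : Measure (ℕ → G) := markovMeasure μ Measure.count

instance (μ : Measure G) [IsProbabilityMeasure μ] : IsFiniteMeasure (pathMeasure μ) := by
  unfold pathMeasure markovMeasure; infer_instance

/-- Finite entropy, `-∑ μ(g) log μ(g) < ∞` (all terms are nonnegative). -/
def HasFiniteEntropy (μ : Measure G) : Prop :=
  Summable fun g : G => Real.negMulLog (μ.real {g})

section PoissonBoundary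

variable {Γ : Type*} [MeasurableSpace Γ] [MulAction G Γ]

/-- `bnd` realizes the `G`-space `Γ` as the space of ergodic components of the time shift in
`(G^ℕ, P_m)`: the `σ`-algebra of `bnd`-preimages of measurable sets coincides modulo `P_m`-null
sets with the `σ`-algebra of shift-invariant measurable sets, and the action of `G` on `Γ` is
the projection of the coordinate-wise action on paths. -/
structure IsPoissonBoundary (μ : Measure G) (bnd : (ℕ → G) → Γ) : Prop where
  measurable : Measurable bnd
  invariant_of_preimage : ∀ S : Set Γ, MeasurableSet S → ∃ A : Set (ℕ → G),
    MeasurableSet[invariantAlgebra G] A ∧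
      bnd ⁻¹' S =ᵐ[pathMeasureCount μ] A
  preimage_of_invariant : ∀ A : Set (ℕ → G),
    MeasurableSet[invariantAlgebra G] A →
      ∃ S : Set Γ, MeasurableSet S ∧ bnd ⁻¹' S =ᵐ[pathMeasureCount μ] A
  equivariant : ∀ g : G, ∀ᵐ ω ∂pathMeasureCount μ, bnd (translate g ω) = g • bnd ω

/-- The harmonic measure `ν = bnd(P)`. -/
def harmonicMeasure (μ : Measure G) (bnd : (ℕ → G) → Γ) : Measure Γ := (pathMeasure μ).map bnd

variable {B : Type*} [MeasurableSpace B] [MulAction G B]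

/-- `(B, lam)` is the quotient, by the map `π`, of the Poisson boundary `(Γ, ν)` with respect to
a `G`-invariant measurable partition (the partition into the fibres of `π`; everything is
understood modulo `ν`-null sets). -/
structure IsMuBoundary (μ : Measure G) (bnd : (ℕ → G) → Γ) (π : Γ → B) (lam : Measure B) :
    Prop where
  measurable : Measurable π
  map_eq : (harmonicMeasure μ bnd).map π = lam
  equivariant : ∀ g : G, ∀ᵐ γ ∂harmonicMeasure μ bnd, π (g • γ) = g • π γ

end PoissonBoundary

/-- `π` is an isomorphism modulo null sets from `(X, ν)` to `(Y, lam)`, where `lam` is the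
image of `ν`. -/
def IsIsoModNull {X Y : Type*} [MeasurableSpace X] [MeasurableSpace Y] (ν : Measure X)
    (lam : Measure Y) (π : X → Y) : Prop :=
  ∃ ψ : Y → X, Measurable ψ ∧ (∀ᵐ x ∂ν, ψ (π x) = x) ∧ ∀ᵐ y ∂lam, π (ψ y) = y

/-- The conditional measures (Rokhlin's disintegration) of `P` with respect to a map `Φ` from
the path space to `B`. -/
def conditionalWalk [Countable G] [MeasurableSingletonClass G] (μ : Measure G)
    [IsProbabilityMeasure μ] {B : Type*} [MeasurableSpace B] (Φ : (ℕ → G) → B) (b : B) :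
    Measure (ℕ → G) :=
  condDistrib id Φ (pathMeasure μ) b

/-- The function `φ_b(x) = (d xλ / dλ)(b)`. -/
def boundaryDensity {B : Type*} [MeasurableSpace B] [MulAction G B] (lam : Measure B) (b : B)
    (x : G) : ℝ≥0∞ :=
  (lam.map (x • ·)).rnDeriv lam b

/-- The transition probabilities `p^f(x, y) = μ(x⁻¹y) f(y) / f(x)`. -/
def doobTransition (μ : Measure G) (f : G → ℝ≥0∞) (x y : G) : ℝ≥0∞ :=
  μ {x⁻¹ * y} * (f y / f x)

open Classical in
/-- `Λ` is the Doob transform `P^f`: the law of the Markov chain started at the identity with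
transition probabilities `p^f` (such a law is determined by its values on cylinders). -/
def IsDoobTransform (μ : Measure G) (f : G → ℝ≥0∞) (Λ : Measure (ℕ → G)) : Prop :=
  IsProbabilityMeasure Λ ∧ ∀ (n : ℕ) (g : ℕ → G), Λ {ω | ∀ i ≤ n, ω i = g i} =
    if g 0 = 1 then ∏ i ∈ Finset.range n, doobTransition μ f (g i) (g (i + 1)) else 0

/-- The normalized information `-(1/n) log Λ(C^n_{xₙ})` of the position at time `n`. -/
def information (Λ : Measure (ℕ → G)) (n : ℕ) (ω : ℕ → G) : ℝ :=
  -(1 / (n : ℝ)) * Real.log (Λ.real {ω' | ω' n = ω n})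

/-- `Λ` has asymptotic entropy `h`: the normalized informations converge to `h` almost
everywhere and in `L¹`. -/
structure HasAsymptoticEntropy (Λ : Measure (ℕ → G)) (h : ℝ) : Prop where
  ae_tendsto : ∀ᵐ ω ∂Λ, Tendsto (fun n => information Λ n ω) atTop (𝓝 h)
  integrable : ∀ n, Integrable (information Λ n) Λ
  tendsto_L1 : Tendsto (fun n => eLpNorm (fun ω => information Λ n ω - h) 1 Λ) atTop (𝓝 0)

/-- With probability bounded away from zero, the one-dimensional distributions of `Λ` are
concentrated on sets of subexponential size. -/
def IsSubexponentiallyConcentrated (Λ : Measure (ℕ → G)) : Prop :=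
  ∃ ε : ℝ, 0 < ε ∧ ∃ A : ℕ → Finset G,
    (fun n => Real.log (A n).card) =o[atTop] (fun n : ℕ => (n : ℝ)) ∧
      ∀ᶠ n in atTop, ε < Λ.real {ω | ω n ∈ A n}

/-- The Poisson boundary exists as a standard Borel `G`-space. -/
theorem exists_isPoissonBoundary {G : Type u} [Group G] [Countable G] [MeasurableSpace G]
    [MeasurableSingletonClass G] (μ : Measure G) [IsProbabilityMeasure μ] :
    ∃ (Γ : Type u) (_ : MeasurableSpace Γ) (_ : StandardBorelSpace Γ) (_ : MulAction G Γ)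
      (_ : MeasurableConstSMul G Γ) (bnd : (ℕ → G) → Γ), IsPoissonBoundary μ bnd := by
  classical
  have hsf : SFinite (pathMeasureCount μ) := by
    unfold pathMeasureCount markovMeasure; infer_instance
  set Q := (pathMeasureCount μ).toFinite with hQ
  have hT : Measurable (timeShift : (ℕ → G) → ℕ → G) := by
    unfold timeShift; fun_prop
  have htr : ∀ g : G, Measurable (translate g : (ℕ → G) → ℕ → G) := by
    intro g
    exact measurable_pi_iff.2 fun n => (measurable_of_countable _).comp (measurable_pi_apply n)
  have hle : invariantAlgebra G ≤ MeasurableSpace.pi := MeasurableSpace.invariants_le _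
  obtain ⟨b, hbc, hbg⟩ :=
    (inferInstance : MeasurableSpace.CountablyGenerated (ℕ → G)).isCountablyGenerated
  have hCc := countable_generateSetAlgebra hbc
  set 𝒞 := generateSetAlgebra b
  have hCg : (MeasurableSpace.pi : MeasurableSpace (ℕ → G)) = MeasurableSpace.generateFrom 𝒞 := by
    rw [generateFrom_generateSetAlgebra_eq]; exact hbg
  have hCpi : IsPiSystem 𝒞 := (isSetAlgebra_generateSetAlgebra.isSetRing).isSetSemiring.isPiSystem
  have : Countable 𝒞 := hCc
  let κ := condExpKernel Q (invariantAlgebra G)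
  have hκp : ∀ ω, IsProbabilityMeasure (κ ω) := fun ω =>
    (inferInstance : IsMarkovKernel (condExpKernel Q (invariantAlgebra G))).isProbabilityMeasure ω
  have hκm : ∀ s, MeasurableSet s → Measurable[invariantAlgebra G] fun ω => κ ω s :=
    fun s hs => measurable_condExpKernel hs
  let Γ := (𝒞 × G) → ℝ≥0∞
  let act : MulAction G Γ :=
    { smul := fun h γ p => γ (p.1, p.2 * h)
      one_smul := fun γ => by funext p; change γ (p.1, p.2 * 1) = _; simp
      mul_smul := fun h k γ => by
        funext p; change γ (p.1, p.2 * (h * k)) = γ (p.1, p.2 * h * k); rw [mul_assoc] }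
  let bnd : (ℕ → G) → Γ := fun ω p => κ (translate p.2 ω) p.1
  have hCmeas : ∀ s ∈ 𝒞, MeasurableSet s := fun s hs => by
    rw [hCg]; exact MeasurableSpace.measurableSet_generateFrom hs
  have hbm : Measurable bnd := measurable_pi_iff.2 fun p =>
    ((hκm _ (hCmeas _ p.1.2)).mono hle le_rfl).comp (htr p.2)
  have hinv : ∀ ω, bnd (timeShift ω) = bnd ω := fun ω => by
    funext p
    exact congrFun (MeasurableSpace.comp_eq_of_measurable_invariants (hκm _ (hCmeas _ p.1.2)))
      (translate p.2 ω)
  refine ⟨Γ, inferInstance, inferInstance, act, ⟨fun h => ?_⟩, bnd, ⟨hbm, ?_, ?_, ?_⟩⟩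
  · exact measurable_pi_iff.2 fun p => measurable_pi_apply (p.1, p.2 * h)
  · intro S hS
    refine ⟨bnd ⁻¹' S, ⟨hbm hS, ?_⟩, Filter.EventuallyEq.rfl⟩
    ext ω
    simp [hinv]
  · intro A hA
    have hone : ∀ ω : ℕ → G, translate 1 ω = ω := fun ω => by funext n; simp [translate]
    have hκc : Measurable[MeasurableSpace.comap bnd inferInstance] (fun ω => κ ω) := by
      refine Measurable.measure_of_isPiSystem_of_isProbabilityMeasure hCg hCpi fun s hs => ?_
      have h1 : (fun ω => κ ω s) = (fun γ : Γ => γ (⟨s, hs⟩, 1)) ∘ bnd := by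
        funext ω; simp [bnd, hone]
      rw [h1]
      exact (measurable_pi_apply _).comp (comap_measurable bnd)
    have hset : MeasurableSet[MeasurableSpace.comap bnd inferInstance] {ω | κ ω A = 1} :=
      ((Measure.measurable_coe hA.1).comp hκc) (measurableSet_singleton 1)
    obtain ⟨S, hS, hSA⟩ := hset
    refine ⟨S, hS, ?_⟩
    rw [hSA]
    have hac : pathMeasureCount μ ≪ Q := absolutelyContinuous_toFinite _
    refine hac.ae_eq ?_
    have h1 := condExpKernel_ae_eq_condExp (μ := Q) hle hA.1
    have h2 : Q⟦A | invariantAlgebra G⟧ = A.indicator fun _ => (1 : ℝ) :=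
      condExp_of_stronglyMeasurable hle (stronglyMeasurable_const.indicator hA)
        ((integrable_const _).indicator hA.1)
    rw [h2] at h1
    filter_upwards [h1] with ω hω
    refine propext ?_
    change κ ω A = 1 ↔ ω ∈ A
    have h3 : (κ ω).real A = 1 ↔ κ ω A = 1 := by
      rw [Measure.real, ENNReal.toReal_eq_one_iff]
    rw [← h3]
    change (κ ω).real A = _ at hω
    rw [hω]
    by_cases h : ω ∈ A <;> simp [h]
  · intro g
    refine Filter.Eventually.of_forall fun ω => ?_
    funext p
    change κ (translate p.2 (translate g ω)) p.1 = κ (translate (p.2 * g) ω) p.1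
    congr 2
    funext n
    simp [translate, mul_assoc]

end RandomWalk

end

open RandomWalk

noncomputable section

set_option linter.unusedSectionVars false

namespace RandomWalk

/-! ### Path space and the Markov property -/

section PathSpace

variable {G : Type*} [Group G]

/-! Write `λ` for the harmonic measure of a quotient `Φ = π ∘ bnd` of the Poisson boundary map. By
the Markov property and equivariance, an event `A` of the first `n` steps ending at `x` satisfies
the Bayes formula `P^b(A) = P(A) · (d xλ/dλ)(b)` (`ae_conditionalWalk_apply`). This gives the Doob
transform. It also shows that the information of the position `xₙ` under `P^b` is `condInfo`, the
unconditional information minus the log-density. The density is a multiplicative cocycle over the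
measure-preserving shift of increments, so the log-density at time `n` has mean `n E(Φ)`, where the
differential entropy `E(Φ)` is its mean at time 1. If `h` is the asymptotic entropy of the walk, the
mean of `condInfo` divided by `n` tends to `h - E(Φ) ≥ 0`.

The three properties are linked in a cycle.

Isomorphism implies zero entropy. A maximal boundary satisfies `h = E(Φ)`
(`IsBoundaryMap.entropy_le`). The proof passes to the lazy walk with step law `ρ = (δ₁ + μ)/2`,
whose laws at consecutive times merge in total variation. The probability that the first step was
`g`, given the position at a late time, is a reverse martingale and approaches a bounded harmonic
function in mean square; maximality identifies the boundary values of that function as `ρ(g) (d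
gλ/dλ)(b)`. Inserting this limit in the chain rule for entropy and averaging over time gives `h/2 ≤
E(Φ)/2`. Hence the mean of `condInfo` is sublinear. A subadditive ergodic theorem for Markov kernels
(`ae_tendsto_div_of_subadditive`), applied once to the path space and once to the boundary, converts
this into convergence almost everywhere and in `L¹` for almost every `P^b`.

Zero entropy implies concentration: by Markov's inequality most of the mass of `P^b` at time `n`
sits on atoms of mass at least `exp(-o(n))`, and there are at most `exp(o(n))` of those.

Concentration implies isomorphism. If `E(Φ) < E(bnd)`, the mean ergodic theorem makes the atoms of
`P^b` exponentially small along a subsequence, which excludes concentration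
(`ae_not_isSubexponentiallyConcentrated`). So `E(bnd) ≤ E(Φ)`, and the equality case of Jensen's
inequality forces the densities of the two boundaries to agree. A function on the boundary and its
conditional expectation given `π` then define the same harmonic function on the reachable elements,
hence coincide, and `π` is invertible modulo null sets (`isIsoModNull_of_logDensity_le`). -/

/-- The path of increments after time `m`: `(ωₘ⁻¹ ωₘ₊ₙ)ₙ`. -/
def incrShift (m : ℕ) (ω : ℕ → G) : ℕ → G := fun n => (ω m)⁻¹ * ω (m + n)

/-- The path stopped at time `m`. -/
def stopAt (m : ℕ) (ω : ℕ → G) : ℕ → G := fun n => ω (min n m)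

/-- The path `1, g ω₀, g ω₁, …`. -/
def prependStep (g : G) (ω : ℕ → G) : ℕ → G
  | 0 => 1
  | n + 1 => g * ω n

/-- The increments `h₀, h₁, …` with a new first increment `g`. -/
def consSeq (g : G) (h : ℕ → G) : ℕ → G
  | 0 => g
  | n + 1 => h n

theorem samplePath_eq_mul (x : G) (h : ℕ → G) (n : ℕ) :
    samplePath x h n = x * samplePath 1 h n := by
  induction n with
  | zero => simp [samplePath]
  | succ n ih => simp only [samplePath]; rw [ih, mul_assoc]

theorem samplePath_consSeq (x g : G) (h : ℕ → G) (n : ℕ) :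
    samplePath x (consSeq g h) (n + 1) = samplePath (x * g) h n := by
  induction n with
  | zero => simp [samplePath, consSeq]
  | succ n ih => rw [samplePath, ih]; simp [samplePath, consSeq]

theorem samplePath_one_consSeq (g : G) (h : ℕ → G) :
    samplePath 1 (consSeq g h) = prependStep g (samplePath 1 h) := by
  funext n
  cases n with
  | zero => rfl
  | succ n =>
    rw [samplePath_consSeq, samplePath_eq_mul, one_mul]; rfl

theorem incrShift_succ_prependStep (m : ℕ) (g : G) (ω : ℕ → G) :
    incrShift (m + 1) (prependStep g ω) = incrShift m ω := by
  funext n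
  have : m + 1 + n = (m + n) + 1 := by omega
  simp [incrShift, this, prependStep, mul_assoc]

theorem stopAt_succ_prependStep (m : ℕ) (g : G) (ω : ℕ → G) :
    stopAt (m + 1) (prependStep g ω) = prependStep g (stopAt m ω) := by
  funext n
  cases n with
  | zero => simp [stopAt, prependStep]
  | succ n =>
    have : min (n + 1) (m + 1) = min n m + 1 := by omega
    simp [stopAt, this, prependStep]

theorem incrShift_incrShift (m k : ℕ) (ω : ℕ → G) :
    incrShift k (incrShift m ω) = incrShift (m + k) ω := by
  funext n
  simp [incrShift, mul_assoc, add_assoc]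

theorem timeShift_eq_translate (ω : ℕ → G) :
    timeShift ω = translate (ω 1) (incrShift 1 ω) := by
  funext n
  simp [timeShift, translate, incrShift, add_comm]

theorem mul_incrShift (m n : ℕ) (ω : ℕ → G) : ω m * incrShift m ω n = ω (m + n) := by
  simp [incrShift]

variable [Countable G] [MeasurableSpace G] [MeasurableSingletonClass G]

@[fun_prop]
theorem measurable_incrShift (m : ℕ) : Measurable (incrShift m : (ℕ → G) → ℕ → G) := by
  unfold incrShift; fun_prop

@[fun_prop]
theorem measurable_stopAt (m : ℕ) : Measurable (stopAt m : (ℕ → G) → ℕ → G) := by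
  unfold stopAt; fun_prop

@[fun_prop]
theorem measurable_timeShift : Measurable (timeShift : (ℕ → G) → ℕ → G) := by
  unfold timeShift; fun_prop

@[fun_prop]
theorem measurable_prependStep :
    Measurable (fun p : G × (ℕ → G) => prependStep p.1 p.2) := by
  refine measurable_pi_iff.2 fun n => ?_
  cases n with
  | zero => exact measurable_const
  | succ n => simp only [prependStep]; fun_prop

@[fun_prop]
theorem measurable_consSeq :
    Measurable (fun p : G × (ℕ → G) => consSeq p.1 p.2) := by
  refine measurable_pi_iff.2 fun n => ?_
  cases n with
  | zero => simp only [consSeq]; fun_prop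
  | succ n => simp only [consSeq]; fun_prop

@[fun_prop]
theorem measurable_samplePath :
    Measurable (fun p : G × (ℕ → G) => samplePath p.1 p.2) := by
  refine measurable_pi_iff.2 fun n => ?_
  induction n with
  | zero => simp only [samplePath]; fun_prop
  | succ n ih => simp only [samplePath]; fun_prop

@[fun_prop]
theorem measurable_samplePath_one : Measurable (fun h : ℕ → G => samplePath 1 h) :=
  measurable_samplePath.comp (measurable_const.prodMk measurable_id)

variable (μ : Measure G) [IsProbabilityMeasure μ]

/-- This stationarity of the increment sequence is what permits first-step analysis on the path
space. -/
theorem map_consSeq_infinitePi :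
    (μ.prod (Measure.infinitePi fun _ : ℕ => μ)).map (fun p => consSeq p.1 p.2) =
      Measure.infinitePi fun _ : ℕ => μ := by
  classical
  refine Measure.eq_infinitePi _ fun s t ht => ?_
  obtain ⟨N, hN⟩ : ∃ N, s ⊆ Finset.range (N + 1) :=
    ⟨s.sup id, fun i hi => Finset.mem_range_succ_iff.2 (Finset.le_sup (f := id) hi)⟩
  -- Padding with the whole space turns the box into one over an initial segment of coordinates,
  -- from which coordinate 0 splits off.
  let t' : ℕ → Set G := fun i => if i ∈ s then t i else Set.univ
  have ht' : ∀ i, MeasurableSet (t' i) := fun i => by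
    by_cases h : i ∈ s <;> simp [t', h, ht]
  have h1 : Set.pi (s : Set ℕ) t = Set.pi (Finset.range (N + 1) : Set ℕ) t' := by
    ext ω
    simp only [Set.mem_pi, Finset.mem_coe]
    refine ⟨fun h i _ => ?_, fun h i hi => ?_⟩
    · by_cases hs : i ∈ s
      · simpa [t', hs] using h i hs
      · simp [t', hs]
    · simpa [t', hi] using h i (hN hi)
  have h2 : ∏ i ∈ s, μ (t i) = ∏ i ∈ Finset.range (N + 1), μ (t' i) := by
    rw [← Finset.prod_subset hN]
    · exact Finset.prod_congr rfl fun i hi => by simp [t', hi]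
    · intro i _ hi; simp [t', hi]
  have h3 : (fun p : G × (ℕ → G) => consSeq p.1 p.2) ⁻¹' Set.pi (Finset.range (N + 1) : Set ℕ) t' =
      t' 0 ×ˢ Set.pi (Finset.range N : Set ℕ) (fun i => t' (i + 1)) := by
    ext ⟨g, h⟩
    simp only [Set.mem_preimage, Set.mem_pi, Finset.mem_coe, Finset.mem_range, Set.mem_prod]
    refine ⟨fun H => ⟨H 0 (by omega), fun i hi => H (i + 1) (by omega)⟩, fun H i hi => ?_⟩
    cases i with
    | zero => exact H.1
    | succ i => exact H.2 i (by omega)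
  rw [h1, h2, Measure.map_apply measurable_consSeq
    (MeasurableSet.pi (Finset.countable_toSet _) fun i _ => ht' i), h3, Measure.prod_prod,
    Measure.infinitePi_pi _ (fun i _ => ht' (i + 1)), Finset.prod_range_succ', mul_comm]

theorem pathMeasure_eq_map :
    pathMeasure μ = (Measure.infinitePi fun _ : ℕ => μ).map (fun h => samplePath 1 h) := by
  rw [pathMeasure, markovMeasure, Measure.dirac_prod, Measure.map_map (by fun_prop) (by fun_prop)]
  rfl

instance isProbabilityMeasure_pathMeasure : IsProbabilityMeasure (pathMeasure μ) := by
  rw [pathMeasure_eq_map]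
  exact Measure.isProbabilityMeasure_map (by fun_prop)

/-- First-step decomposition: take one step and continue with an independent walk translated by it.
Induction on time rests on this. -/
theorem map_prependStep_pathMeasure :
    (μ.prod (pathMeasure μ)).map (fun p => prependStep p.1 p.2) = pathMeasure μ := by
  have h : μ.prod (pathMeasure μ) = (μ.prod (Measure.infinitePi fun _ : ℕ => μ)).map
      (Prod.map id (fun h => samplePath 1 h)) := by
    rw [pathMeasure_eq_map, ← Measure.map_prod_map _ _ measurable_id (by fun_prop), Measure.map_id]
  rw [h, Measure.map_map (by fun_prop) (by fun_prop)]
  conv_rhs => rw [pathMeasure_eq_map, ← map_consSeq_infinitePi μ,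
    Measure.map_map (by fun_prop) (by fun_prop)]
  congr 1
  funext p
  exact (samplePath_one_consSeq p.1 p.2).symm

theorem lintegral_pathMeasure_prependStep {f : (ℕ → G) → ℝ≥0∞} (hf : Measurable f) :
    ∫⁻ ω, f ω ∂pathMeasure μ = ∫⁻ g, ∫⁻ ω, f (prependStep g ω) ∂pathMeasure μ ∂μ := by
  conv_lhs => rw [← map_prependStep_pathMeasure μ]
  rw [lintegral_map hf (by fun_prop), lintegral_prod _ (by fun_prop)]

theorem ae_zero_eq_one : ∀ᵐ ω ∂pathMeasure μ, ω 0 = 1 := by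
  rw [← map_prependStep_pathMeasure μ]
  refine (ae_map_iff (by fun_prop) ?_).2 (Eventually.of_forall fun p => rfl)
  exact (measurable_pi_apply 0) (measurableSet_singleton 1)

/-- The Markov property at time `m`: the future increments are independent of the past. -/
theorem lintegral_stopAt_incrShift (m : ℕ) {F : (ℕ → G) × (ℕ → G) → ℝ≥0∞} (hF : Measurable F) :
    ∫⁻ ω, F (stopAt m ω, incrShift m ω) ∂pathMeasure μ =
      ∫⁻ ω, ∫⁻ ω', F (stopAt m ω, ω') ∂pathMeasure μ ∂pathMeasure μ := by
  induction m generalizing F with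
  | zero =>
    have h1 : ∀ᵐ ω ∂pathMeasure μ, F (stopAt 0 ω, incrShift 0 ω) = F (1, ω) := by
      filter_upwards [ae_zero_eq_one μ] with ω hω
      congr 2
      · funext n; simp [stopAt, hω]
      · funext n; simp [incrShift, hω]
    have h2 : ∀ᵐ ω ∂pathMeasure μ, ∫⁻ ω', F (stopAt 0 ω, ω') ∂pathMeasure μ =
        ∫⁻ ω', F (1, ω') ∂pathMeasure μ := by
      filter_upwards [ae_zero_eq_one μ] with ω hω
      have : stopAt 0 ω = 1 := by funext n; simp [stopAt, hω]
      rw [this]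
    rw [lintegral_congr_ae h1, lintegral_congr_ae h2, lintegral_const, measure_univ, mul_one]
  -- Condition on the first step. Prepending it reduces both the stopped path and the later
  -- increments to time `m`, and the step itself is absorbed into `F`.
  | succ m ih =>
    rw [lintegral_pathMeasure_prependStep μ (by fun_prop),
      lintegral_pathMeasure_prependStep μ (f := fun ω =>
        ∫⁻ ω', F (stopAt (m + 1) ω, ω') ∂pathMeasure μ)]
    · refine lintegral_congr fun g => ?_
      simp only [incrShift_succ_prependStep, stopAt_succ_prependStep]
      refine ih (F := fun p => F (prependStep g p.1, p.2)) ?_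
      have : Measurable (fun ω : ℕ → G => prependStep g ω) :=
        measurable_prependStep.comp (measurable_const.prodMk measurable_id)
      fun_prop
    · exact Measurable.lintegral_prod_right' (f := fun p : (ℕ → G) × (ℕ → G) =>
        F (stopAt (m + 1) p.1, p.2)) (by fun_prop)

theorem measurePreserving_incrShift (m : ℕ) :
    MeasurePreserving (incrShift m) (pathMeasure μ) (pathMeasure μ) := by
  refine ⟨by fun_prop, Measure.ext_of_lintegral _ fun f hf => ?_⟩
  rw [lintegral_map hf (by fun_prop)]
  have := lintegral_stopAt_incrShift μ m (F := fun p => f p.2) (by fun_prop)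
  simpa using this

theorem map_stopAt_prodMk_incrShift (m : ℕ) :
    (pathMeasure μ).map (fun ω => (stopAt m ω, incrShift m ω)) =
      ((pathMeasure μ).map (stopAt m)).prod (pathMeasure μ) := by
  have : IsProbabilityMeasure ((pathMeasure μ).map (stopAt m)) :=
    Measure.isProbabilityMeasure_map (by fun_prop)
  refine Measure.ext_of_lintegral _ fun f hf => ?_
  rw [lintegral_map hf (by fun_prop), lintegral_stopAt_incrShift μ m hf,
    lintegral_prod _ hf.aemeasurable, lintegral_map hf.lintegral_prod_right' (by fun_prop)]

/-- The distribution of the random walk at time `n`. -/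
def walkLaw (n : ℕ) : Measure G := (pathMeasure μ).map (fun ω => ω n)

instance isProbabilityMeasure_walkLaw (n : ℕ) : IsProbabilityMeasure (walkLaw μ n) :=
  Measure.isProbabilityMeasure_map (measurable_pi_apply n).aemeasurable

theorem lintegral_walkLaw (n : ℕ) (f : G → ℝ≥0∞) :
    ∫⁻ x, f x ∂walkLaw μ n = ∫⁻ ω, f (ω n) ∂pathMeasure μ :=
  lintegral_map (measurable_of_countable f) (by fun_prop)

theorem lintegral_apply_incrShift (m : ℕ) {F : G × (ℕ → G) → ℝ≥0∞} (hF : Measurable F) :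
    ∫⁻ ω, F (ω m, incrShift m ω) ∂pathMeasure μ =
      ∫⁻ x, ∫⁻ ω, F (x, ω) ∂pathMeasure μ ∂walkLaw μ m := by
  have := lintegral_stopAt_incrShift μ m (F := fun p => F (p.1 m, p.2)) (by fun_prop)
  simp only [stopAt, min_self] at this
  rw [this, lintegral_walkLaw μ m]

theorem lintegral_walkLaw_add (m n : ℕ) (f : G → ℝ≥0∞) :
    ∫⁻ x, f x ∂walkLaw μ (m + n) = ∫⁻ x, ∫⁻ y, f (x * y) ∂walkLaw μ n ∂walkLaw μ m := by
  have := lintegral_apply_incrShift μ m (F := fun p => f (p.1 * p.2 n))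
    ((measurable_of_countable f).comp (by fun_prop))
  simp only [mul_incrShift] at this
  rw [lintegral_walkLaw, this]
  exact lintegral_congr fun x => (lintegral_walkLaw μ n fun y => f (x * y)).symm

theorem ae_incrShift_of_ae {p : (ℕ → G) → Prop} (m : ℕ) (h : ∀ᵐ ω ∂pathMeasure μ, p ω) :
    ∀ᵐ ω ∂pathMeasure μ, p (incrShift m ω) :=
  (measurePreserving_incrShift μ m).quasiMeasurePreserving.ae h

theorem ae_forall_incrShift_of_ae {p : G → (ℕ → G) → Prop}
    (h : ∀ g, ∀ᵐ ω ∂pathMeasure μ, p g ω) (m : ℕ) :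
    ∀ᵐ ω ∂pathMeasure μ, p (ω m) (incrShift m ω) := by
  filter_upwards [ae_incrShift_of_ae μ m (ae_all_iff.2 h)] with ω hω using hω _

theorem walkLaw_zero : walkLaw μ 0 = Measure.dirac 1 := by
  have h : (fun ω : ℕ → G => ω 0) =ᵐ[pathMeasure μ] fun _ => 1 := ae_zero_eq_one μ
  rw [walkLaw, Measure.map_congr h, Measure.map_const, measure_univ, one_smul]

theorem walkLaw_one : walkLaw μ 1 = μ := by
  refine Measure.ext_of_lintegral _ fun f _ => ?_
  rw [lintegral_walkLaw, lintegral_pathMeasure_prependStep μ (f := fun ω => f (ω 1))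
    ((measurable_of_countable f).comp (measurable_pi_apply 1))]
  refine lintegral_congr fun g => ?_
  have : ∀ᵐ ω ∂pathMeasure μ, f (prependStep g ω 1) = f g := by
    filter_upwards [ae_zero_eq_one μ] with ω hω
    simp [prependStep, hω]
  rw [lintegral_congr_ae this]; simp

theorem ae_singleton_ne_zero (ρ : Measure G) : ∀ᵐ x ∂ρ, ρ {x} ≠ 0 := by
  rw [ae_iff, ← Set.biUnion_of_singleton {a | ¬ ρ {a} ≠ 0}]
  refine (measure_biUnion_null_iff (Set.to_countable _)).2 fun x hx => ?_
  simpa using hx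

theorem ae_walkLaw_singleton_ne_zero (n : ℕ) :
    ∀ᵐ ω ∂pathMeasure μ, walkLaw μ n {ω n} ≠ 0 :=
  ae_of_ae_map (measurable_pi_apply n).aemeasurable (ae_singleton_ne_zero (walkLaw μ n))

theorem measurableSet_apply_eq (n : ℕ) (x : G) : MeasurableSet {ω : ℕ → G | ω n = x} :=
  measurableSet_eq_fun (measurable_pi_apply n) measurable_const

theorem walkLaw_singleton (n : ℕ) (x : G) :
    walkLaw μ n {x} = pathMeasure μ {ω | ω n = x} :=
  Measure.map_apply (measurable_pi_apply n) (measurableSet_singleton x)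

/-- Passing through `x` at time `m` is one way of reaching `x * y` at time `m + n`. All
subadditivity of information comes from this. -/
theorem mul_walkLaw_le (m n : ℕ) (x y : G) :
    walkLaw μ m {x} * walkLaw μ n {y} ≤ walkLaw μ (m + n) {x * y} := by
  classical
  have h := lintegral_walkLaw_add μ m n (({x * y} : Set G).indicator 1)
  rw [lintegral_indicator_one (measurableSet_singleton _)] at h
  rw [h]
  calc walkLaw μ m {x} * walkLaw μ n {y}
      = ∫⁻ x', ({x} : Set G).indicator (fun _ => walkLaw μ n {y}) x' ∂walkLaw μ m := by
        rw [lintegral_indicator_const (measurableSet_singleton _), mul_comm]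
    _ ≤ _ := by
        refine lintegral_mono fun x' => ?_
        by_cases hx : x' = x
        · subst hx
          simp only [Set.mem_singleton_iff, Set.indicator_of_mem]
          rw [← lintegral_indicator_one (measurableSet_singleton y)]
          refine lintegral_mono fun y' => ?_
          by_cases hy : y' = y <;> simp [hy]
        · simp [hx]

/-! ### Absolute continuity with respect to the walk started from the counting measure -/

theorem pathMeasure_absolutelyContinuous : pathMeasure μ ≪ pathMeasureCount μ := by
  have h : (Measure.dirac 1 : Measure G) ≪ Measure.count := fun s hs => by
    rw [Measure.count_eq_zero_iff.1 hs]; simp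
  exact (h.prod Measure.AbsolutelyContinuous.rfl).map (by fun_prop)

/-- The shifted path is the walk started from `μ`, so an identity modulo null sets of the counting
walk survives the shift. -/
theorem map_timeShift_absolutelyContinuous :
    (pathMeasure μ).map timeShift ≪ pathMeasureCount μ := by
  have h : μ ≪ Measure.count := fun s hs => by
    rw [Measure.count_eq_zero_iff.1 hs]; simp
  have e : (pathMeasure μ).map timeShift = markovMeasure μ μ := by
    rw [pathMeasure_eq_map, ← map_consSeq_infinitePi μ, Measure.map_map (by fun_prop) (by fun_prop),
      Measure.map_map (by fun_prop) (by fun_prop), markovMeasure]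
    congr 1
    funext p n
    simp only [Function.comp, timeShift]
    rw [samplePath_consSeq, one_mul]
  rw [e]
  exact (h.prod Measure.AbsolutelyContinuous.rfl).map (by fun_prop)

end PathSpace

/-! ### A maximal inequality and a subadditive ergodic theorem for Markov kernels -/

section Subadditive

variable {X : Type*} [MeasurableSpace X] {ρ : Measure X} [IsProbabilityMeasure ρ]

theorem lintegral_lintegral_of_invariant {κ : Kernel X X} (hκ : κ.Invariant ρ)
    {f : X → ℝ≥0∞} (hf : Measurable f) : ∫⁻ x, ∫⁻ y, f y ∂κ x ∂ρ = ∫⁻ x, f x ∂ρ := by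
  conv_rhs => rw [← hκ.def, Measure.lintegral_bind κ.aemeasurable hf.aemeasurable]

/-- Maximal ergodic inequality for a Markov kernel with an invariant probability measure. -/
theorem mul_measure_exists_lt_le {κ : Kernel X X} [IsMarkovKernel κ] (hκ : κ.Invariant ρ)
    {d : X → ℝ≥0∞} (hd : Measurable d) (hdfin : ∫⁻ x, d x ∂ρ ≠ ∞) {s : ℕ → X → ℝ≥0∞}
    (hs : ∀ q, Measurable (s q)) (hs0 : ∀ x, s 0 x = 0)
    (hstep : ∀ q, ∀ᵐ x ∂ρ, s (q + 1) x ≤ d x + ∫⁻ y, s q y ∂κ x)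
    {a : ℝ≥0∞} (ha : a ≠ ∞) :
    a * ρ {x | ∃ q : ℕ, q * a < s q x} ≤ ∫⁻ x, d x ∂ρ := by
  have hsfin : ∀ q, ∫⁻ x, s q x ∂ρ ≠ ∞ := by
    intro q
    induction q with
    | zero => simp [hs0]
    | succ q ih =>
      refine ne_top_of_le_ne_top ?_ (lintegral_mono_ae (hstep q))
      rw [lintegral_add_left hd, lintegral_lintegral_of_invariant hκ (hs q)]
      exact ENNReal.add_ne_top.2 ⟨hdfin, ih⟩
  -- Garsia's argument with the running maximum of `s q - q a`. Truncated subtraction plays the role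
  -- of the positive part.
  let M : ℕ → X → ℝ≥0∞ := fun n x => ⨆ q : Fin (n + 1), (s q x - q * a)
  have hM : ∀ n, Measurable (M n) := fun n => .iSup fun q => (hs q).sub_const _
  have hMfin : ∀ n, ∫⁻ x, M n x ∂ρ ≠ ∞ := by
    intro n
    refine ne_top_of_le_ne_top (b := ∑ q : Fin (n + 1), ∫⁻ x, s q x ∂ρ)
      (ENNReal.sum_ne_top.2 fun q _ => hsfin q) ?_
    rw [← lintegral_finsetSum (Finset.univ : Finset (Fin (n + 1))) (f := fun q x => s q x)
      fun q _ => hs q]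
    refine lintegral_mono fun x => iSup_le fun q => tsub_le_self.trans ?_
    exact Finset.single_le_sum (f := fun q : Fin (n + 1) => s q x) (fun _ _ => zero_le)
      (Finset.mem_univ q)
  have hset : ∀ n, MeasurableSet {x | 0 < M n x} := fun n =>
    measurableSet_lt measurable_const (hM n)
  -- Where `M n` is positive the maximum is attained at some `q = p + 1`, because `s 0 = 0`. The
  -- step inequality then bounds it by `d` plus the transfer of `s p`, which is at most the transfer
  -- of `M n` plus `p a`; exactly one `a` is gained.
  have key : ∀ n, ∀ᵐ x ∂ρ, M n x + {x | 0 < M n x}.indicator (fun _ => a) x ≤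
      d x + ∫⁻ y, M n y ∂κ x := by
    intro n
    filter_upwards [ae_all_iff.2 hstep] with x hx
    by_cases h0 : 0 < M n x
    · rw [Set.indicator_of_mem (by exact h0)]
      obtain ⟨⟨q, hq⟩, hqM⟩ := exists_eq_ciSup_of_finite
        (f := fun q : Fin (n + 1) => s q x - q * a)
      replace hqM : s q x - q * a = M n x := hqM
      rw [← hqM] at h0 ⊢
      cases q with
      | zero => simp [hs0] at h0
      | succ p =>
        have hlt : ((p + 1 : ℕ) : ℝ≥0∞) * a < s (p + 1) x := tsub_pos_iff_lt.1 h0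
        have hpfin : (p : ℝ≥0∞) * a ≠ ∞ := ENNReal.mul_ne_top (by simp) ha
        have h1 : ∫⁻ y, s p y ∂κ x ≤ ∫⁻ y, M n y ∂κ x + p * a := by
          calc ∫⁻ y, s p y ∂κ x ≤ ∫⁻ y, (M n y + p * a) ∂κ x := by
                refine lintegral_mono fun y => ?_
                refine le_tsub_add.trans (add_le_add_left ?_ _)
                exact le_iSup (fun q : Fin (n + 1) => s q y - q * a) ⟨p, by omega⟩
            _ = _ := by simp [lintegral_add_right _ measurable_const]
        refine (ENNReal.add_le_add_iff_right hpfin).1 ?_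
        have h2 : s (p + 1) x - ((p + 1 : ℕ) : ℝ≥0∞) * a + a + p * a = s (p + 1) x := by
          rw [add_assoc]
          have : a + (p : ℝ≥0∞) * a = ((p + 1 : ℕ) : ℝ≥0∞) * a := by push_cast; ring
          rw [this, tsub_add_cancel_of_le hlt.le]
        rw [h2, add_assoc]
        exact (hx p).trans (by gcongr)
    · have h0' : M n x = 0 := by simpa using h0
      simp [h0', Set.indicator]
  -- After integration the two integrals of `M n` agree by invariance and cancel, being finite.
  have hn : ∀ n, a * ρ {x | 0 < M n x} ≤ ∫⁻ x, d x ∂ρ := by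
    intro n
    have h := lintegral_mono_ae (key n)
    rw [lintegral_add_left (hM n), lintegral_indicator_const (hset n), lintegral_add_left hd,
      lintegral_lintegral_of_invariant hκ (hM n), add_comm (∫⁻ x, d x ∂ρ)] at h
    exact (ENNReal.add_le_add_iff_left (hMfin n)).1 h
  have hmono : Monotone fun n => {x | 0 < M n x} := by
    intro n n' hnn' x hx
    refine lt_of_lt_of_le (show 0 < M n x from hx) (iSup_le fun q => ?_)
    exact le_iSup (fun q : Fin (n' + 1) => s q x - q * a) ⟨q, by omega⟩
  have hU : {x | ∃ q : ℕ, q * a < s q x} ⊆ ⋃ n, {x | 0 < M n x} := by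
    rintro x ⟨q, hq⟩
    refine Set.mem_iUnion.2 ⟨q, lt_of_lt_of_le (tsub_pos_iff_lt.2 hq) ?_⟩
    exact le_iSup (fun q' : Fin (q + 1) => s q' x - q' * a) ⟨q, by omega⟩
  calc a * ρ {x | ∃ q : ℕ, q * a < s q x} ≤ a * ρ (⋃ n, {x | 0 < M n x}) := by gcongr
    _ = ⨆ n, a * ρ {x | 0 < M n x} := by rw [hmono.measure_iUnion, ENNReal.mul_iSup]
    _ ≤ _ := iSup_le hn

/-- A nonnegative subadditive process over Markov kernels whose means grow sublinearly grows
sublinearly almost everywhere. -/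
theorem ae_tendsto_div_of_subadditive (κ : ℕ → Kernel X X) [∀ m, IsMarkovKernel (κ m)]
    (hκ : ∀ m, (κ m).Invariant ρ) {c : ℕ → X → ℝ≥0∞} (hc : ∀ n, Measurable (c n))
    (hfin : ∀ n, ∫⁻ x, c n x ∂ρ ≠ ∞)
    (hsub : ∀ m n, ∀ᵐ x ∂ρ, c (m + n) x ≤ c m x + ∫⁻ y, c n y ∂κ m x)
    (hlim : Tendsto (fun n : ℕ => (∫⁻ x, c n x ∂ρ) / n) atTop (𝓝 0)) :
    ∀ᵐ x ∂ρ, Tendsto (fun n : ℕ => c n x / n) atTop (𝓝 0) := by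
  -- The threshold is `2b` per unit of time: one `b` comes from the maximal inequality and the other
  -- absorbs bounded remainders.
  have hbad : ∀ b : ℝ≥0∞, b ≠ 0 → b ≠ ∞ → ∀ m : ℕ, m ≠ 0 →
      b * ρ {x | ∃ᶠ n : ℕ in atTop, n * (b + b) < c n x} ≤ (∫⁻ x, c m x ∂ρ) / m := by
    intro b hb hb' m hm
    have hm0 : (m : ℝ≥0∞) ≠ 0 := by exact_mod_cast hm
    have : NeZero m := ⟨hm⟩
    -- Cut time into blocks of length `m` and take the maximum over the residues, which leaves a
    -- process driven by the single kernel `κ m`.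
    let s : ℕ → X → ℝ≥0∞ := fun q x => ⨆ r : Fin m, c (q * m + r) x
    have hs : ∀ q, Measurable (s q) := fun q => .iSup fun r => hc _
    have hsfin : ∫⁻ x, s 0 x ∂ρ ≠ ∞ := by
      refine ne_top_of_le_ne_top (b := ∑ r : Fin m, ∫⁻ x, c (0 * m + r) x ∂ρ)
        (ENNReal.sum_ne_top.2 fun q _ => hfin _) ?_
      rw [← lintegral_finsetSum (Finset.univ : Finset (Fin m)) (f := fun q x => c (0 * m + q) x)
        fun q _ => hc _]
      refine lintegral_mono fun x => iSup_le fun q => ?_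
      exact Finset.single_le_sum (f := fun q : Fin m => c (0 * m + q) x) (fun _ _ => zero_le)
        (Finset.mem_univ q)
    have hstep : ∀ q, ∀ᵐ x ∂ρ, s (q + 1) x ≤ c m x + ∫⁻ y, s q y ∂κ m x := by
      intro q
      filter_upwards [ae_all_iff.2 fun n => hsub m n] with x hx
      refine iSup_le fun r => ?_
      have e : (q + 1) * m + (r : ℕ) = m + (q * m + r) := by ring
      rw [e]
      refine (hx _).trans (add_le_add_right (lintegral_mono fun y => ?_) _)
      exact le_iSup (fun r : Fin m => c (q * m + r) y) r
    have hM : ∀ M : ℕ, m * b * ρ {x | ∃ᶠ n : ℕ in atTop, n * (b + b) < c n x} ≤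
        ∫⁻ x, c m x ∂ρ + ∫⁻ x, (s 0 x - M) ∂ρ := by
      intro M
      -- The initial block `s 0` is integrable but possibly unbounded. The index is shifted to get
      -- `σ 0 = 0`, a constant `M` is removed, and the excess `s 0 - M` is charged to the drift; its
      -- integral vanishes as `M` grows.
      let σ : ℕ → X → ℝ≥0∞ := fun q => match q with
        | 0 => fun _ => 0
        | q + 1 => fun x => s q x - M
      have hσ : ∀ q, Measurable (σ q) := by
        intro q
        cases q with
        | zero => exact measurable_const
        | succ q => exact (hs q).sub_const _
      have hd : Measurable fun x => c m x + (s 0 x - M) := (hc m).add ((hs 0).sub_const _)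
      have hinteg : ∫⁻ x, (c m x + (s 0 x - M)) ∂ρ = ∫⁻ x, c m x ∂ρ + ∫⁻ x, (s 0 x - M) ∂ρ :=
        lintegral_add_left (hc m) _
      have hmax := mul_measure_exists_lt_le (hκ m) hd (s := σ) (a := m * b)
        (by
          rw [hinteg]
          refine ENNReal.add_ne_top.2 ⟨hfin m, ne_top_of_le_ne_top hsfin ?_⟩
          exact lintegral_mono fun x => tsub_le_self) hσ (fun _ => rfl)
        (by
          intro q
          cases q with
          | zero => exact Eventually.of_forall fun x => by simp [σ]
          | succ q =>
            filter_upwards [hstep q] with x hx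
            change s (q + 1) x - M ≤ c m x + (s 0 x - M) + ∫⁻ y, (s q y - M) ∂κ m x
            have h1 : ∫⁻ y, s q y ∂κ m x ≤ ∫⁻ y, (s q y - M) ∂κ m x + M := by
              calc ∫⁻ y, s q y ∂κ m x ≤ ∫⁻ y, (s q y - M + M) ∂κ m x :=
                    lintegral_mono fun y => le_tsub_add
                _ = _ := by simp [lintegral_add_right _ measurable_const]
            refine tsub_le_iff_right.2 (hx.trans ?_)
            calc c m x + ∫⁻ y, s q y ∂κ m x ≤ c m x + (∫⁻ y, (s q y - M) ∂κ m x + M) := by gcongr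
              _ ≤ c m x + (s 0 x - M) + ∫⁻ y, (s q y - M) ∂κ m x + M := by
                rw [← add_assoc]; gcongr; exact le_self_add)
        (ENNReal.mul_ne_top (by simp) hb')
      rw [hinteg] at hmax
      refine le_trans ?_ hmax
      refine mul_le_mul_right (measure_mono fun x hx => ?_) _
      by_contra hcon
      simp only [Set.mem_ofPred_eq, not_exists, not_lt] at hcon
      refine hx ?_
      -- From time `N` on, the second `b` per unit of time dominates the constant `M + m * b`.
      obtain ⟨N, hN⟩ := ENNReal.exists_nat_mul_gt hb
        (b := M + m * b) (ENNReal.add_ne_top.2 ⟨by simp, ENNReal.mul_ne_top (by simp) hb'⟩)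
      filter_upwards [eventually_ge_atTop N] with n hn
      rw [not_lt]
      have h1 : c n x ≤ s (n / m) x := by
        have e : n = n / m * m + n % m := by rw [mul_comm]; exact (Nat.div_add_mod n m).symm
        conv_lhs => rw [e]
        exact le_iSup (fun r : Fin m => c (n / m * m + r) x)
          ⟨n % m, Nat.mod_lt _ (Nat.pos_of_ne_zero hm)⟩
      have h2 : s (n / m) x ≤ ((n / m + 1 : ℕ) : ℝ≥0∞) * (m * b) + M :=
        tsub_le_iff_right.1 (hcon (n / m + 1))
      have h3 : ((n / m : ℕ) : ℝ≥0∞) * m ≤ n := by exact_mod_cast Nat.div_mul_le_self n m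
      calc c n x ≤ ((n / m + 1 : ℕ) : ℝ≥0∞) * (m * b) + M := h1.trans h2
        _ = ((n / m : ℕ) : ℝ≥0∞) * m * b + (M + m * b) := by push_cast; ring
        _ ≤ n * b + N * b := by gcongr
        _ ≤ n * b + n * b := by gcongr
        _ = n * (b + b) := by ring
    have hlimM : Tendsto (fun M : ℕ => ∫⁻ x, (s 0 x - M) ∂ρ) atTop (𝓝 0) := by
      have := tendsto_lintegral_of_dominated_convergence (μ := ρ)
        (F := fun (M : ℕ) x => s 0 x - M) (f := fun _ => 0) (s 0) (fun M => (hs 0).sub_const _)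
        (fun M => Eventually.of_forall fun x => tsub_le_self) hsfin ?_
      · simpa using this
      · filter_upwards [ae_lt_top (hs 0) hsfin] with x hx
        obtain ⟨N, hN⟩ := ENNReal.exists_nat_gt hx.ne
        refine tendsto_const_nhds.congr' ?_
        filter_upwards [eventually_ge_atTop N] with n hn
        exact (tsub_eq_zero_of_le (hN.le.trans (by exact_mod_cast hn))).symm
    have h4 : m * b * ρ {x | ∃ᶠ n : ℕ in atTop, n * (b + b) < c n x} ≤ ∫⁻ x, c m x ∂ρ := by
      have := ge_of_tendsto' (tendsto_const_nhds.add hlimM) hM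
      simpa using this
    rw [ENNReal.le_div_iff_mul_le (Or.inl hm0) (Or.inl (by simp))]
    calc _ = m * b * ρ {x | ∃ᶠ n : ℕ in atTop, n * (b + b) < c n x} := by ring
      _ ≤ _ := h4
  -- The bad set in `hbad` does not depend on `m`, so `m` may tend to infinity.
  have hzero : ∀ b : ℝ≥0∞, b ≠ 0 → b ≠ ∞ → ∀ᵐ x ∂ρ, ∀ᶠ n : ℕ in atTop, c n x ≤ n * (b + b) := by
    intro b hb hb'
    have h : b * ρ {x | ∃ᶠ n : ℕ in atTop, n * (b + b) < c n x} ≤ 0 := by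
      refine ge_of_tendsto hlim ?_
      filter_upwards [eventually_ne_atTop 0] with m hm using hbad b hb hb' m hm
    have h0 : ρ {x | ∃ᶠ n : ℕ in atTop, n * (b + b) < c n x} = 0 := by
      simpa [hb] using h
    rw [measure_eq_zero_iff_ae_notMem] at h0
    filter_upwards [h0] with x hx
    simpa [Filter.Frequently] using hx
  have hall : ∀ᵐ x ∂ρ, ∀ k : ℕ, ∀ᶠ n : ℕ in atTop,
      c n x ≤ n * (((k : ℝ≥0∞) + 1)⁻¹ + ((k : ℝ≥0∞) + 1)⁻¹) :=
    ae_all_iff.2 fun k => hzero _ (ENNReal.inv_ne_zero.2 (by simp)) (ENNReal.inv_ne_top.2 (by simp))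
  filter_upwards [hall] with x hx
  refine ENNReal.tendsto_nhds_zero.2 fun ε hε => ?_
  obtain ⟨k, hk⟩ := ENNReal.exists_inv_nat_lt (a := ε / 2) (by simpa using hε.ne')
  filter_upwards [hx k, eventually_ne_atTop 0] with n hn hn0
  refine ENNReal.div_le_of_le_mul (hn.trans ?_)
  rw [mul_comm]
  gcongr
  have h5 : ((k : ℝ≥0∞) + 1)⁻¹ ≤ ε / 2 := by
    refine le_trans (ENNReal.inv_le_inv.2 ?_) hk.le
    exact le_self_add
  calc _ ≤ ε / 2 + ε / 2 := add_le_add h5 h5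
    _ = ε := ENNReal.add_halves ε

end Subadditive

/-! ### Boundary maps and their densities -/

section Boundary

variable {G : Type*} [Group G] [Countable G] [MeasurableSpace G] [MeasurableSingletonClass G]
  {B : Type*} [MeasurableSpace B] [MulAction G B] [MeasurableConstSMul G B]

/-- A measurable map from the path space to a `G`-space that is almost surely determined by the
future increments in an equivariant way. -/
structure IsBoundaryMap (μ : Measure G) (Φ : (ℕ → G) → B) : Prop where
  measurable : Measurable Φ
  ae_eq_smul_one : ∀ᵐ ω ∂pathMeasure μ, Φ ω = ω 1 • Φ (incrShift 1 ω)

theorem measurable_smul_of_countable : Measurable fun p : G × B => p.1 • p.2 :=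
  measurable_from_prod_countable_right fun g => measurable_const_smul g

variable (μ : Measure G) [IsProbabilityMeasure μ] {Φ : (ℕ → G) → B}

theorem isProbabilityMeasure_harmonicMeasure (hΦ : Measurable Φ) :
    IsProbabilityMeasure (harmonicMeasure μ Φ) :=
  Measure.isProbabilityMeasure_map hΦ.aemeasurable

/-- A convenient measurability criterion for functions of a group element and a point. -/
theorem measurable_uncurry_of_countable {C D : Type*} [MeasurableSpace C] [MeasurableSpace D]
    {f : G → C → D} (hf : ∀ x, Measurable (f x)) : Measurable fun p : G × C => f p.1 p.2 :=
  measurable_from_prod_countable_right hf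

namespace IsBoundaryMap

variable {μ} (hΦ : IsBoundaryMap μ Φ)

include hΦ

theorem ae_eq_smul (m : ℕ) :
    ∀ᵐ ω ∂pathMeasure μ, Φ ω = ω m • Φ (incrShift m ω) := by
  induction m with
  | zero =>
    filter_upwards [ae_zero_eq_one μ] with ω hω
    have : incrShift 0 ω = ω := by funext n; simp [incrShift, hω]
    rw [this, hω, one_smul]
  | succ m ih =>
    filter_upwards [ih, ae_incrShift_of_ae μ m hΦ.ae_eq_smul_one] with ω h1 h2
    rw [h1, h2, smul_smul, mul_incrShift, incrShift_incrShift]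

/-- Given the path up to time `m`, the boundary point is `ω m` applied to an independent copy of
itself. -/
theorem lintegral_stopAt (m : ℕ) {F : (ℕ → G) × B → ℝ≥0∞} (hF : Measurable F) :
    ∫⁻ ω, F (stopAt m ω, Φ ω) ∂pathMeasure μ =
      ∫⁻ ω, ∫⁻ b, F (stopAt m ω, ω m • b) ∂harmonicMeasure μ Φ ∂pathMeasure μ := by
  have h1 : ∀ᵐ ω ∂pathMeasure μ, F (stopAt m ω, Φ ω) =
      F (stopAt m ω, stopAt m ω m • Φ (incrShift m ω)) := by
    filter_upwards [hΦ.ae_eq_smul m] with ω hω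
    rw [hω]; simp [stopAt]
  have hsm : Measurable fun p : (ℕ → G) × (ℕ → G) => p.1 m • Φ p.2 :=
    measurable_smul_of_countable.comp
      (((measurable_pi_apply m).comp measurable_fst).prodMk (hΦ.measurable.comp measurable_snd))
  rw [lintegral_congr_ae h1, lintegral_stopAt_incrShift μ m
    (F := fun p => F (p.1, p.1 m • Φ p.2)) (hF.comp (measurable_fst.prodMk hsm))]
  refine lintegral_congr fun ω => ?_
  rw [harmonicMeasure, lintegral_map _ hΦ.measurable]
  · simp [stopAt]
  · exact hF.comp (measurable_const.prodMk (measurable_const_smul _))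

theorem lintegral_apply (n : ℕ) {F : G × B → ℝ≥0∞} (hF : Measurable F) :
    ∫⁻ ω, F (ω n, Φ ω) ∂pathMeasure μ =
      ∫⁻ x, ∫⁻ b, F (x, x • b) ∂harmonicMeasure μ Φ ∂walkLaw μ n := by
  have h := hΦ.lintegral_stopAt n (F := fun p => F (p.1 n, p.2))
    (hF.comp (((measurable_pi_apply n).comp measurable_fst).prodMk measurable_snd))
  simp only [stopAt, min_self] at h
  rw [h, lintegral_walkLaw]

/-- Hypothesis `hAn` expresses that `A` is an event of the first `n` steps. Once such a path has
arrived at `x`, its boundary point has the translated harmonic law. -/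
theorem measure_inter_preimage {n : ℕ} {x : G} {A : Set (ℕ → G)} (hA : MeasurableSet A)
    (hAn : ∀ ω, ω ∈ A ↔ stopAt n ω ∈ A) (hAx : ∀ ω ∈ A, ω n = x) {S : Set B}
    (hS : MeasurableSet S) :
    pathMeasure μ (A ∩ Φ ⁻¹' S) =
      pathMeasure μ A * (harmonicMeasure μ Φ).map (x • ·) S := by
  classical
  have h := hΦ.lintegral_stopAt n (F := (A ×ˢ S).indicator 1)
    (measurable_one.indicator (hA.prod hS))
  have e1 : ∀ ω, (A ×ˢ S).indicator (1 : (ℕ → G) × B → ℝ≥0∞) (stopAt n ω, Φ ω) =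
      (A ∩ Φ ⁻¹' S).indicator 1 ω := by
    intro ω
    have h3 := hAn ω
    by_cases h1 : ω ∈ A
    · by_cases h2 : Φ ω ∈ S <;> simp [h1, h2, h3.1 h1]
    · have h4 : stopAt n ω ∉ A := fun h => h1 (h3.2 h)
      simp [h1, h4]
  have e2 : ∀ ω, ∫⁻ b, (A ×ˢ S).indicator (1 : (ℕ → G) × B → ℝ≥0∞) (stopAt n ω, ω n • b)
      ∂harmonicMeasure μ Φ =
      A.indicator (fun _ => (harmonicMeasure μ Φ).map (x • ·) S) ω := by
    intro ω
    by_cases h1 : ω ∈ A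
    · rw [Set.indicator_of_mem h1, Measure.map_apply (measurable_const_smul x) hS,
        ← lintegral_indicator_one ((measurable_const_smul x) hS)]
      refine lintegral_congr fun b => ?_
      rw [hAx ω h1]
      by_cases h2 : x • b ∈ S <;> simp [h2, (hAn ω).1 h1]
    · have h2 : stopAt n ω ∉ A := fun h => h1 ((hAn ω).2 h)
      simp [h1, h2]
  simp only [e1, e2] at h
  rwa [lintegral_indicator_one (hA.inter (hΦ.measurable hS)), lintegral_indicator_const hA,
    mul_comm] at h

/-- One summand of the `n`-step stationarity of the harmonic measure. It yields absolute continuity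
of reachable translates and an upper bound for their densities. -/
theorem walkLaw_smul_map_le (n : ℕ) (x : G) :
    walkLaw μ n {x} • (harmonicMeasure μ Φ).map (x • ·) ≤ harmonicMeasure μ Φ := by
  refine Measure.le_iff.2 fun S hS => ?_
  have hA := measurableSet_apply_eq (G := G) n x
  have h := hΦ.measure_inter_preimage (n := n) (x := x) hA (fun ω => by simp [stopAt])
    (fun ω hω => hω) hS
  rw [Measure.smul_apply, smul_eq_mul, walkLaw_singleton, ← h, harmonicMeasure, Measure.map_apply hΦ.measurable hS]
  exact measure_mono Set.inter_subset_right

theorem map_smul_absolutelyContinuous {n : ℕ} {x : G} (hx : walkLaw μ n {x} ≠ 0) :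
    (harmonicMeasure μ Φ).map (x • ·) ≪ harmonicMeasure μ Φ := by
  refine Measure.AbsolutelyContinuous.mk fun S _ hS0 => ?_
  have h := hΦ.walkLaw_smul_map_le n x S
  rw [hS0, Measure.smul_apply, smul_eq_mul, nonpos_iff_eq_zero, mul_eq_zero] at h
  exact h.resolve_left hx

/-- Reachability of `x` excludes a singular part, which the Radon–Nikodym derivative would discard.
-/
theorem withDensity_boundaryDensity {n : ℕ} {x : G} (hx : walkLaw μ n {x} ≠ 0) :
    (harmonicMeasure μ Φ).withDensity (fun b => boundaryDensity (harmonicMeasure μ Φ) b x) =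
      (harmonicMeasure μ Φ).map (x • ·) := by
  have := isProbabilityMeasure_harmonicMeasure μ hΦ.measurable
  exact Measure.withDensity_rnDeriv_eq _ _ (hΦ.map_smul_absolutelyContinuous hx)

end IsBoundaryMap

theorem measurable_boundaryDensity (lam : Measure B) (x : G) :
    Measurable fun b => boundaryDensity lam b x :=
  Measure.measurable_rnDeriv _ _

theorem measurable_boundaryDensity_uncurry (lam : Measure B) :
    Measurable fun p : G × B => boundaryDensity lam p.2 p.1 :=
  measurable_uncurry_of_countable fun x => measurable_boundaryDensity lam x

theorem measurable_boundaryDensity_path {Φ : (ℕ → G) → B} (hΦ : Measurable Φ) (lam : Measure B)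
    (n : ℕ) : Measurable fun ω : ℕ → G => boundaryDensity lam (Φ ω) (ω n) :=
  (measurable_boundaryDensity_uncurry lam).comp ((measurable_pi_apply n).prodMk hΦ)

namespace IsBoundaryMap

variable {μ} (hΦ : IsBoundaryMap μ Φ)

include hΦ

/-- The product will turn out to be the conditional probability of being at `x` at time `n`; the
bound makes `condInfo` nonnegative. -/
theorem ae_walkLaw_mul_boundaryDensity_le_one (n : ℕ) (x : G) :
    ∀ᵐ b ∂harmonicMeasure μ Φ,
      walkLaw μ n {x} * boundaryDensity (harmonicMeasure μ Φ) b x ≤ 1 := by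
  have := isProbabilityMeasure_harmonicMeasure μ hΦ.measurable
  by_cases hx : walkLaw μ n {x} = 0
  · simp [hx]
  refine ae_le_of_forall_setLIntegral_le_of_sigmaFinite
    ((measurable_boundaryDensity _ x).const_mul _) fun S hS _ => ?_
  rw [lintegral_const_mul _ (measurable_boundaryDensity _ x), ← withDensity_apply _ hS,
    hΦ.withDensity_boundaryDensity hx]
  simpa using hΦ.walkLaw_smul_map_le n x S

theorem lintegral_boundaryDensity_mul {n : ℕ} {x : G} (hx : walkLaw μ n {x} ≠ 0) {f : B → ℝ≥0∞}
    (hf : Measurable f) :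
    ∫⁻ b, boundaryDensity (harmonicMeasure μ Φ) b x * f b ∂harmonicMeasure μ Φ =
      ∫⁻ b, f (x • b) ∂harmonicMeasure μ Φ := by
  have h := lintegral_withDensity_eq_lintegral_mul (harmonicMeasure μ Φ)
    (measurable_boundaryDensity (harmonicMeasure μ Φ) x) hf
  rw [hΦ.withDensity_boundaryDensity hx, lintegral_map hf (measurable_const_smul x)] at h
  exact h.symm

theorem lintegral_apply_density (n : ℕ) {F : G × B → ℝ≥0∞} (hF : Measurable F) :
    ∫⁻ ω, F (ω n, Φ ω) ∂pathMeasure μ =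
      ∫⁻ x, ∫⁻ b, boundaryDensity (harmonicMeasure μ Φ) b x * F (x, b)
        ∂harmonicMeasure μ Φ ∂walkLaw μ n := by
  rw [hΦ.lintegral_apply n hF]
  refine lintegral_congr_ae ?_
  filter_upwards [ae_singleton_ne_zero (walkLaw μ n)] with x hx
  exact (hΦ.lintegral_boundaryDensity_mul hx (f := fun b => F (x, b))
    (hF.comp (measurable_const.prodMk measurable_id))).symm

/-- The density is a multiplicative cocycle. -/
theorem ae_boundaryDensity_mul {m n : ℕ} {x y : G} (hx : walkLaw μ m {x} ≠ 0)
    (hy : walkLaw μ n {y} ≠ 0) :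
    ∀ᵐ b ∂harmonicMeasure μ Φ, boundaryDensity (harmonicMeasure μ Φ) b (x * y) =
      boundaryDensity (harmonicMeasure μ Φ) b x *
        boundaryDensity (harmonicMeasure μ Φ) (x⁻¹ • b) y := by
  have := isProbabilityMeasure_harmonicMeasure μ hΦ.measurable
  set lam := harmonicMeasure μ Φ with hlam
  have hxy : walkLaw μ (m + n) {x * y} ≠ 0 := fun h => by
    have h' := mul_walkLaw_le μ m n x y
    rw [h, nonpos_iff_eq_zero, mul_eq_zero] at h'
    tauto
  have hm1 : Measurable fun b => boundaryDensity lam (x⁻¹ • b) y :=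
    (measurable_boundaryDensity lam y).comp (measurable_const_smul _)
  -- Compare integrals over `S`: the factor at `x` is removed by the change of variables `b ↦ x •
  -- b`, and the remaining density at `y` is integrated over the preimage of `S`.
  refine ae_eq_of_forall_setLIntegral_eq_of_sigmaFinite (measurable_boundaryDensity lam (x * y))
    ((measurable_boundaryDensity lam x).mul hm1) fun S hS _ => ?_
  rw [← withDensity_apply _ hS, hΦ.withDensity_boundaryDensity hxy, ← lintegral_indicator hS]
  have e : ∀ b, S.indicator (fun b => boundaryDensity lam b x *
      boundaryDensity lam (x⁻¹ • b) y) b = boundaryDensity lam b x *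
        S.indicator (fun b => boundaryDensity lam (x⁻¹ • b) y) b := by
    intro b; by_cases h : b ∈ S <;> simp [h]
  simp only [e]
  rw [hΦ.lintegral_boundaryDensity_mul hx (hm1.indicator hS)]
  have e2 : ∀ b, S.indicator (fun b => boundaryDensity lam (x⁻¹ • b) y) (x • b) =
      ((x • ·) ⁻¹' S).indicator (fun b => boundaryDensity lam b y) b := by
    intro b; by_cases h : x • b ∈ S <;> simp [h]
  simp only [e2]
  have hS' : MeasurableSet ((x • · : B → B) ⁻¹' S) := measurable_const_smul x hS
  rw [lintegral_indicator hS', ← withDensity_apply _ hS',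
    hΦ.withDensity_boundaryDensity hy, Measure.map_apply (measurable_const_smul _) hS,
    Measure.map_apply (measurable_const_smul _) hS']
  congr 1
  ext b
  simp [mul_smul]

theorem ae_boundaryDensity_path_add (m n : ℕ) :
    ∀ᵐ ω ∂pathMeasure μ, boundaryDensity (harmonicMeasure μ Φ) (Φ ω) (ω (m + n)) =
      boundaryDensity (harmonicMeasure μ Φ) (Φ ω) (ω m) *
        boundaryDensity (harmonicMeasure μ Φ) (Φ (incrShift m ω)) (incrShift m ω n) := by
  have h : ∀ᵐ b ∂harmonicMeasure μ Φ, ∀ x y, walkLaw μ m {x} ≠ 0 → walkLaw μ n {y} ≠ 0 →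
      boundaryDensity (harmonicMeasure μ Φ) b (x * y) =
      boundaryDensity (harmonicMeasure μ Φ) b x *
        boundaryDensity (harmonicMeasure μ Φ) (x⁻¹ • b) y := by
    simp only [ae_all_iff]
    exact fun x y hx hy => hΦ.ae_boundaryDensity_mul hx hy
  filter_upwards [ae_of_ae_map hΦ.measurable.aemeasurable h, ae_walkLaw_singleton_ne_zero μ m,
    ae_incrShift_of_ae μ m (ae_walkLaw_singleton_ne_zero μ n), hΦ.ae_eq_smul m] with ω h1 h2 h3 h4
  have h5 := h1 _ _ h2 h3
  rw [mul_incrShift] at h5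
  rw [h5]
  congr 2
  rw [h4, inv_smul_smul]

/-- Relative to the product of their laws, the pair of position and boundary point has this very
density, and a density is almost surely nonzero under its own measure. -/
theorem ae_boundaryDensity_ne_zero (n : ℕ) :
    ∀ᵐ ω ∂pathMeasure μ, boundaryDensity (harmonicMeasure μ Φ) (Φ ω) (ω n) ≠ 0 := by
  classical
  set lam := harmonicMeasure μ Φ with hlam
  have hD := measurable_boundaryDensity_uncurry (G := G) lam
  have hset : MeasurableSet {p : G × B | boundaryDensity lam p.2 p.1 = 0} :=
    hD (measurableSet_singleton 0)
  have h := hΦ.lintegral_apply_density n (F := {p : G × B |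
    boundaryDensity lam p.2 p.1 = 0}.indicator 1) (measurable_one.indicator hset)
  have e : ∀ x b, boundaryDensity lam b x * {p : G × B |
    boundaryDensity lam p.2 p.1 = 0}.indicator (1 : G × B → ℝ≥0∞) (x, b) = 0 := by
    intro x b
    by_cases h0 : boundaryDensity lam b x = 0 <;> simp [h0]
  simp only [← hlam, e, lintegral_zero] at h
  have hmeas : Measurable fun ω : ℕ → G => (ω n, Φ ω) :=
    (measurable_pi_apply n).prodMk hΦ.measurable
  replace h := (lintegral_eq_zero_iff ((measurable_one.indicator hset).comp hmeas)).1 h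
  filter_upwards [h] with ω hω h0
  simp [h0] at hω

theorem ae_boundaryDensity_ne_top (n : ℕ) :
    ∀ᵐ ω ∂pathMeasure μ, boundaryDensity (harmonicMeasure μ Φ) (Φ ω) (ω n) ≠ ∞ := by
  have := isProbabilityMeasure_harmonicMeasure μ hΦ.measurable
  have h : ∀ᵐ b ∂harmonicMeasure μ Φ, ∀ x : G, boundaryDensity (harmonicMeasure μ Φ) b x ≠ ∞ := by
    refine ae_all_iff.2 fun x => ?_
    have : IsFiniteMeasure ((harmonicMeasure μ Φ).map (x • ·)) := by infer_instance
    exact Measure.rnDeriv_ne_top _ _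
  filter_upwards [ae_of_ae_map hΦ.measurable.aemeasurable h] with ω hω using hω _

theorem ae_walkLaw_mul_boundaryDensity_path_le_one (n : ℕ) :
    ∀ᵐ ω ∂pathMeasure μ, walkLaw μ n {ω n} *
      boundaryDensity (harmonicMeasure μ Φ) (Φ ω) (ω n) ≤ 1 := by
  have h := ae_all_iff.2 fun x => hΦ.ae_walkLaw_mul_boundaryDensity_le_one n x
  filter_upwards [ae_of_ae_map hΦ.measurable.aemeasurable h] with ω hω using hω _

/-- Reweighting by the inverse density makes the position and the boundary point independent. -/
theorem lintegral_div_boundaryDensity_le (n : ℕ) {F : G × B → ℝ≥0∞} (hF : Measurable F) :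
    ∫⁻ ω, F (ω n, Φ ω) / boundaryDensity (harmonicMeasure μ Φ) (Φ ω) (ω n) ∂pathMeasure μ ≤
      ∫⁻ x, ∫⁻ b, F (x, b) ∂harmonicMeasure μ Φ ∂walkLaw μ n := by
  rw [hΦ.lintegral_apply_density n
    (F := fun p => F p / boundaryDensity (harmonicMeasure μ Φ) p.2 p.1)
    (hF.div (measurable_boundaryDensity_uncurry _))]
  refine lintegral_mono fun x => lintegral_mono fun b => ?_
  -- Only an inequality is available: where the density vanishes the left side is zero, while `F`
  -- need not be.
  exact ENNReal.mul_div_le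

end IsBoundaryMap

/-! ### Conditional measures -/

variable [StandardBorelSpace B]

theorem lintegral_conditionalWalk (hΦ : Measurable Φ) {F : B × (ℕ → G) → ℝ≥0∞}
    (hF : Measurable F) :
    ∫⁻ ω, F (Φ ω, ω) ∂pathMeasure μ =
      ∫⁻ b, ∫⁻ ω, F (b, ω) ∂conditionalWalk μ Φ b ∂harmonicMeasure μ Φ := by
  have := isProbabilityMeasure_harmonicMeasure μ hΦ
  have h := compProd_map_condDistrib (μ := pathMeasure μ) (X := Φ) (Y := id)
    (mβ := inferInstance) aemeasurable_id
  have h2 : ∫⁻ p, F p ∂((pathMeasure μ).map fun ω => (Φ ω, id ω)) =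
      ∫⁻ ω, F (Φ ω, ω) ∂pathMeasure μ := lintegral_map hF (hΦ.prodMk measurable_id)
  rw [← h2, ← h, Measure.lintegral_compProd hF]
  rfl

theorem ae_ae_conditionalWalk (hΦ : Measurable Φ) {p : B → (ℕ → G) → Prop}
    (hp : MeasurableSet {q : B × (ℕ → G) | p q.1 q.2}) (h : ∀ᵐ ω ∂pathMeasure μ, p (Φ ω) ω) :
    ∀ᵐ b ∂harmonicMeasure μ Φ, ∀ᵐ ω ∂conditionalWalk μ Φ b, p b ω := by
  have := isProbabilityMeasure_harmonicMeasure μ hΦ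
  have h1 := compProd_map_condDistrib (μ := pathMeasure μ) (X := Φ) (Y := id)
    (mβ := inferInstance) aemeasurable_id
  have h2 : ∀ᵐ q ∂((pathMeasure μ).map fun ω => (Φ ω, id ω)), p q.1 q.2 :=
    (ae_map_iff (hΦ.prodMk measurable_id).aemeasurable hp).2 h
  rw [← h1] at h2
  exact Measure.ae_ae_of_ae_compProd h2

instance isProbabilityMeasure_conditionalWalk (Φ : (ℕ → G) → B) (b : B) :
    IsProbabilityMeasure (conditionalWalk μ Φ b) := by
  unfold conditionalWalk; infer_instance

theorem measurable_lintegral_conditionalWalk (Φ : (ℕ → G) → B) {f : (ℕ → G) → ℝ≥0∞}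
    (hf : Measurable f) : Measurable fun b => ∫⁻ ω, f ω ∂conditionalWalk μ Φ b := by
  unfold conditionalWalk
  exact hf.lintegral_kernel

/-- Uniqueness of conditional expectation, in the form by which conditional integrals are computed
below. -/
theorem ae_lintegral_conditionalWalk_eq (hΦ : Measurable Φ) {f : (ℕ → G) → ℝ≥0∞}
    (hf : Measurable f) {g : B → ℝ≥0∞} (hg : Measurable g)
    (h : ∀ S, MeasurableSet S →
      ∫⁻ ω in Φ ⁻¹' S, f ω ∂pathMeasure μ = ∫⁻ b in S, g b ∂harmonicMeasure μ Φ) :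
    ∀ᵐ b ∂harmonicMeasure μ Φ, ∫⁻ ω, f ω ∂conditionalWalk μ Φ b = g b := by
  have := isProbabilityMeasure_harmonicMeasure μ hΦ
  refine ae_eq_of_forall_setLIntegral_eq_of_sigmaFinite
    (measurable_lintegral_conditionalWalk μ Φ hf) hg fun S hS _ => ?_
  rw [← h S hS, ← lintegral_indicator hS, ← lintegral_indicator (hΦ hS)]
  have h1 := lintegral_conditionalWalk μ hΦ (F := fun q => S.indicator (fun _ => f q.2) q.1)
    (by
      have e : (fun q : B × (ℕ → G) => S.indicator (fun _ => f q.2) q.1) =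
          (Prod.fst ⁻¹' S).indicator (fun q => f q.2) := by
        funext q; by_cases hq : q.1 ∈ S <;> simp [hq]
      rw [e]
      exact (hf.comp measurable_snd).indicator (measurable_fst hS))
  rw [show ∫⁻ ω, (Φ ⁻¹' S).indicator (fun ω => f ω) ω ∂pathMeasure μ =
    ∫⁻ ω, S.indicator (fun _ => f ω) (Φ ω) ∂pathMeasure μ from
    lintegral_congr fun ω => by by_cases hq : Φ ω ∈ S <;> simp [hq], h1]
  refine lintegral_congr fun b => ?_
  by_cases hq : b ∈ S <;> simp [hq]

namespace IsBoundaryMap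

variable {μ} (hΦ : IsBoundaryMap μ Φ)

include hΦ

/-- Bayes' formula. The condition on the boundary point enters only through the position reached,
since the future depends on the past only through that position. -/
theorem ae_conditionalWalk_apply {n : ℕ} {x : G} {A : Set (ℕ → G)} (hA : MeasurableSet A)
    (hAn : ∀ ω, ω ∈ A ↔ stopAt n ω ∈ A) (hAx : ∀ ω ∈ A, ω n = x) :
    ∀ᵐ b ∂harmonicMeasure μ Φ, conditionalWalk μ Φ b A =
      pathMeasure μ A * boundaryDensity (harmonicMeasure μ Φ) b x := by
  have h := ae_lintegral_conditionalWalk_eq μ hΦ.measurable (f := A.indicator 1)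
    (measurable_one.indicator hA) (g := fun b => pathMeasure μ A *
      boundaryDensity (harmonicMeasure μ Φ) b x)
    ((measurable_boundaryDensity _ x).const_mul _) fun S hS => by
      rw [lintegral_indicator_one hA, Measure.restrict_apply hA,
        hΦ.measure_inter_preimage hA hAn hAx hS,
        lintegral_const_mul _ (measurable_boundaryDensity _ x)]
      by_cases h0 : pathMeasure μ A = 0
      · simp [h0]
      · have hx : walkLaw μ n {x} ≠ 0 := fun h => h0 (by
          rw [walkLaw_singleton] at h
          exact measure_mono_null (fun ω hω => hAx ω hω) h)
        rw [← withDensity_apply _ hS, hΦ.withDensity_boundaryDensity hx]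
  filter_upwards [h] with b hb
  rwa [lintegral_indicator_one hA] at hb

theorem ae_conditionalWalk_singleton :
    ∀ᵐ b ∂harmonicMeasure μ Φ, ∀ (n : ℕ) (x : G), conditionalWalk μ Φ b {ω | ω n = x} =
      walkLaw μ n {x} * boundaryDensity (harmonicMeasure μ Φ) b x := by
  refine ae_all_iff.2 fun n => ae_all_iff.2 fun x => ?_
  have hA := measurableSet_apply_eq (G := G) n x
  rw [walkLaw_singleton]
  exact hΦ.ae_conditionalWalk_apply hA (fun ω => by simp [stopAt]) (fun ω hω => hω)

end IsBoundaryMap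

end Boundary

/-! ### The Poisson boundary and its quotients as equivariant boundary maps -/

section Poisson

variable {G : Type*} [Group G] [Countable G] [MeasurableSpace G] [MeasurableSingletonClass G]
  {Γ : Type*} [MeasurableSpace Γ] [StandardBorelSpace Γ] [MulAction G Γ] [MeasurableConstSMul G Γ]
  {B : Type*} [MeasurableSpace B] [MulAction G B] [MeasurableConstSMul G B]
  {μ : Measure G} [IsProbabilityMeasure μ]

/-- Each preimage under `bnd` is an invariant set modulo null sets, both for the walk and for its
shift. Countably many sets separate the points of a standard Borel space, so the maps themselves
agree. -/
theorem IsPoissonBoundary.ae_timeShift_eq {bnd : (ℕ → G) → Γ} (h : IsPoissonBoundary μ bnd) :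
    ∀ᵐ ω ∂pathMeasure μ, bnd (timeShift ω) = bnd ω := by
  refine Filter.EventuallyEq.of_forall_separating_preimage (l := ae (pathMeasure μ))
    (f := fun ω => bnd (timeShift ω)) (g := bnd) MeasurableSet fun S hS => ?_
  obtain ⟨A, hA, hSA⟩ := h.invariant_of_preimage S hS
  have h1 : bnd ⁻¹' S =ᵐ[pathMeasure μ] A := (pathMeasure_absolutelyContinuous μ).ae_eq hSA
  have h2 : bnd ⁻¹' S =ᵐ[(pathMeasure μ).map timeShift] A :=
    (map_timeShift_absolutelyContinuous μ).ae_eq hSA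
  have h3 : timeShift ⁻¹' (bnd ⁻¹' S) =ᵐ[pathMeasure μ] timeShift ⁻¹' A :=
    ae_of_ae_map measurable_timeShift.aemeasurable h2
  rw [hA.2] at h3
  exact h3.trans h1.symm

theorem IsPoissonBoundary.isBoundaryMap {bnd : (ℕ → G) → Γ} (h : IsPoissonBoundary μ bnd) :
    IsBoundaryMap μ bnd := by
  refine ⟨h.measurable, ?_⟩
  have h1 := ae_forall_incrShift_of_ae μ (p := fun g ω => bnd (translate g ω) = g • bnd ω)
    (fun g => (pathMeasure_absolutelyContinuous μ).ae_le (h.equivariant g)) 1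
  filter_upwards [h.ae_timeShift_eq, h1] with ω h2 h3
  rw [← h2, timeShift_eq_translate, h3]

theorem IsMuBoundary.isBoundaryMap {bnd : (ℕ → G) → Γ} (h : IsPoissonBoundary μ bnd)
    {π : Γ → B} {lam : Measure B} (hπ : IsMuBoundary μ bnd π lam) :
    IsBoundaryMap μ (π ∘ bnd) := by
  refine ⟨hπ.measurable.comp h.measurable, ?_⟩
  have h1 := ae_forall_incrShift_of_ae μ (p := fun g ω => π (g • bnd ω) = g • π (bnd ω))
    (fun g => ae_of_ae_map h.measurable.aemeasurable (hπ.equivariant g)) 1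
  filter_upwards [h.isBoundaryMap.ae_eq_smul_one, h1] with ω h2 h3
  simp only [Function.comp_apply]
  rw [h2, h3]

theorem IsMuBoundary.harmonicMeasure_comp {bnd : (ℕ → G) → Γ} (h : IsPoissonBoundary μ bnd)
    {π : Γ → B} {lam : Measure B} (hπ : IsMuBoundary μ bnd π lam) :
    harmonicMeasure μ (π ∘ bnd) = lam := by
  rw [← hπ.map_eq, harmonicMeasure, harmonicMeasure, Measure.map_map hπ.measurable h.measurable]

end Poisson

/-! ### Conditional measures as Doob transforms -/

section Doob

variable {G : Type*} [Group G] [Countable G] [MeasurableSpace G] [MeasurableSingletonClass G]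
  {B : Type*} [MeasurableSpace B] [MulAction G B] [MeasurableConstSMul G B]
  {μ : Measure G} [IsProbabilityMeasure μ]

theorem measurableSet_cylinder (n : ℕ) (g : ℕ → G) :
    MeasurableSet {ω : ℕ → G | ∀ i ≤ n, ω i = g i} := by
  have : {ω : ℕ → G | ∀ i ≤ n, ω i = g i} = ⋂ i ∈ Set.Iic n, {ω | ω i = g i} := by
    ext; simp
  rw [this]
  exact MeasurableSet.biInter (Set.to_countable _) fun i _ => measurableSet_apply_eq i (g i)

theorem stopAt_mem_cylinder (n : ℕ) (g ω : ℕ → G) :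
    (∀ i ≤ n, ω i = g i) ↔ ∀ i ≤ n, stopAt n ω i = g i := by
  refine forall₂_congr fun i hi => ?_
  simp [stopAt, hi]

open Classical in
theorem pathMeasure_cylinder (n : ℕ) (g : ℕ → G) :
    pathMeasure μ {ω | ∀ i ≤ n, ω i = g i} =
      if g 0 = 1 then ∏ i ∈ Finset.range n, μ {(g i)⁻¹ * g (i + 1)} else 0 := by
  induction n with
  | zero =>
    have h : pathMeasure μ {ω | ∀ i ≤ 0, ω i = g i} = walkLaw μ 0 {g 0} := by
      rw [walkLaw_singleton]; simp
    rw [h, walkLaw_zero, Measure.dirac_apply' _ (measurableSet_singleton _)]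
    by_cases h0 : g 0 = 1
    · simp [h0]
    · have : (1 : G) ≠ g 0 := fun h => h0 h.symm
      simp [h0, this]
  | succ n ih =>
    have hA := measurableSet_cylinder n g
    have hC := measurableSet_apply_eq (G := G) 1 ((g n)⁻¹ * g (n + 1))
    have h := lintegral_stopAt_incrShift μ n
      (F := ({ω : ℕ → G | ∀ i ≤ n, ω i = g i} ×ˢ
        {ω : ℕ → G | ω 1 = (g n)⁻¹ * g (n + 1)}).indicator 1)
      (measurable_one.indicator (hA.prod hC))
    have e1 : ∀ ω : ℕ → G, ({ω : ℕ → G | ∀ i ≤ n, ω i = g i} ×ˢ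
        {ω : ℕ → G | ω 1 = (g n)⁻¹ * g (n + 1)}).indicator (1 : (ℕ → G) × (ℕ → G) → ℝ≥0∞)
          (stopAt n ω, incrShift n ω) =
        {ω : ℕ → G | ∀ i ≤ n + 1, ω i = g i}.indicator 1 ω := by
      intro ω
      have hiff : ((∀ i ≤ n, stopAt n ω i = g i) ∧ incrShift n ω 1 = (g n)⁻¹ * g (n + 1)) ↔
          ∀ i ≤ n + 1, ω i = g i := by
        rw [← stopAt_mem_cylinder]
        constructor
        · rintro ⟨h1, h2⟩ i hi
          rcases Nat.lt_or_ge n i with h | h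
          · obtain rfl : i = n + 1 := by omega
            rw [incrShift, h1 n le_rfl] at h2
            exact mul_left_cancel h2
          · exact h1 i h
        · intro h
          exact ⟨fun i hi => h i (by omega), by
            rw [incrShift, h n (by omega), h (n + 1) le_rfl]⟩
      by_cases h : ∀ i ≤ n + 1, ω i = g i
      · rw [Set.indicator_of_mem, Set.indicator_of_mem]
        · rfl
        · exact h
        · exact hiff.2 h
      · rw [Set.indicator_of_notMem, Set.indicator_of_notMem]
        · exact h
        · exact fun h' => h (hiff.1 h')
    have e2 : ∀ ω : ℕ → G, ∫⁻ ω', ({ω : ℕ → G | ∀ i ≤ n, ω i = g i} ×ˢ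
        {ω : ℕ → G | ω 1 = (g n)⁻¹ * g (n + 1)}).indicator (1 : (ℕ → G) × (ℕ → G) → ℝ≥0∞)
          (stopAt n ω, ω') ∂pathMeasure μ =
        {ω : ℕ → G | ∀ i ≤ n, ω i = g i}.indicator
          (fun _ => μ {(g n)⁻¹ * g (n + 1)}) ω := by
      intro ω
      have hiff := stopAt_mem_cylinder n g ω
      by_cases h : ∀ i ≤ n, ω i = g i
      · rw [Set.indicator_of_mem (by exact h)]
        conv_rhs => rw [← walkLaw_one μ, walkLaw_singleton, ← lintegral_indicator_one hC]
        refine lintegral_congr fun ω' => ?_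
        by_cases h' : ω' 1 = (g n)⁻¹ * g (n + 1)
        · rw [Set.indicator_of_mem, Set.indicator_of_mem]
          · rfl
          · exact h'
          · exact ⟨hiff.1 h, h'⟩
        · rw [Set.indicator_of_notMem, Set.indicator_of_notMem]
          · exact h'
          · exact fun hh => h' hh.2
      · rw [Set.indicator_of_notMem (by exact h)]
        refine (lintegral_congr fun ω' => Set.indicator_of_notMem (fun hh => ?_) _).trans
          lintegral_zero
        exact h (hiff.2 hh.1)
    simp only [e1, e2] at h
    rw [lintegral_indicator_one (measurableSet_cylinder _ _), lintegral_indicator_const hA, ih] at h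
    rw [h]
    by_cases h0 : g 0 = 1
    · simp [h0, Finset.prod_range_succ, mul_comm]
    · simp [h0]

variable [StandardBorelSpace B] {Φ : (ℕ → G) → B}

/-- The conditional measures of the walk are Doob transforms. -/
theorem IsBoundaryMap.ae_isDoobTransform (hΦ : IsBoundaryMap μ Φ) :
    ∀ᵐ b ∂harmonicMeasure μ Φ, IsDoobTransform μ (boundaryDensity (harmonicMeasure μ Φ) b)
      (conditionalWalk μ Φ b) := by
  classical
  have := isProbabilityMeasure_harmonicMeasure μ hΦ.measurable
  set lam := harmonicMeasure μ Φ with hlam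
  -- Cylinders are indexed by finite words, of which there are countably many, so a single null set
  -- of `b` serves all of them. The index `min i n` extends a word to a sequence.
  have E1 : ∀ᵐ b ∂lam, ∀ (n : ℕ) (v : Fin (n + 1) → G),
      conditionalWalk μ Φ b {ω | ∀ i ≤ n, ω i = v ⟨min i n, by omega⟩} =
      pathMeasure μ {ω | ∀ i ≤ n, ω i = v ⟨min i n, by omega⟩} *
        boundaryDensity lam b (v ⟨n, by omega⟩) := by
    refine ae_all_iff.2 fun n => ae_all_iff.2 fun v => ?_
    refine hΦ.ae_conditionalWalk_apply (n := n)
      (measurableSet_cylinder n fun i => v ⟨min i n, by omega⟩) (fun ω => ?_) fun ω hω => ?_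
    · exact stopAt_mem_cylinder n (fun i => v ⟨min i n, by omega⟩) ω
    · have := hω n le_rfl
      simpa using this
  have E2 : ∀ᵐ b ∂lam, boundaryDensity lam b (1 : G) = 1 := by
    have h : lam.map ((1 : G) • ·) = lam := by simp
    have := Measure.rnDeriv_self lam
    simp only [boundaryDensity, h]
    exact this
  have E3 : ∀ᵐ b ∂lam, ∀ x : G, boundaryDensity lam b x ≠ ∞ :=
    ae_all_iff.2 fun x => Measure.rnDeriv_ne_top _ _
  -- The telescoping product of density ratios vanishes from the first zero of the density on. The
  -- density itself must therefore stay zero along every possible step, which the cocycle identity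
  -- provides.
  have E4 : ∀ᵐ b ∂lam, ∀ (n : ℕ) (x s : G), walkLaw μ n {x} ≠ 0 → μ {s} ≠ 0 →
      boundaryDensity lam b x = 0 → boundaryDensity lam b (x * s) = 0 := by
    simp only [ae_all_iff]
    intro n x s hx hs
    have hs' : walkLaw μ 1 {s} ≠ 0 := by rwa [walkLaw_one]
    filter_upwards [hΦ.ae_boundaryDensity_mul hx hs'] with b hb h0
    rw [hb, h0, zero_mul]
  filter_upwards [E1, E2, E3, E4] with b h1 h2 h3 h4
  refine ⟨inferInstance, fun n g => ?_⟩
  have e : {ω : ℕ → G | ∀ i ≤ n, ω i = g i} =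
      {ω | ∀ i ≤ n, ω i = (fun j : Fin (n + 1) => g j) ⟨min i n, by omega⟩} := by
    ext ω
    refine forall₂_congr fun i hi => ?_
    simp [hi]
  rw [e, h1 n fun j => g j, ← e, pathMeasure_cylinder]
  by_cases h0 : g 0 = 1
  · simp only [h0, if_true]
    clear e
    induction n with
    | zero => simp [h0, h2]
    | succ n ih =>
      simp only [Finset.prod_range_succ, doobTransition] at ih ⊢
      rw [← ih]
      by_cases hs : μ {(g n)⁻¹ * g (n + 1)} = 0
      · simp [hs]
      by_cases hp : ∏ i ∈ Finset.range n, μ {(g i)⁻¹ * g (i + 1)} = 0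
      · simp [hp]
      have hreach : walkLaw μ n {g n} ≠ 0 := fun h => hp (by
        have hle : pathMeasure μ {ω | ∀ i ≤ n, ω i = g i} ≤ walkLaw μ n {g n} := by
          rw [walkLaw_singleton]
          exact measure_mono fun ω hω => hω n le_rfl
        rw [h, pathMeasure_cylinder, if_pos h0] at hle
        simpa using hle)
      by_cases hφ : boundaryDensity lam b (g n) = 0
      · have := h4 n (g n) _ hreach hs hφ
        rw [mul_inv_cancel_left] at this
        simp [hφ, this]
      · rw [mul_mul_mul_comm, ENNReal.mul_div_cancel hφ (h3 _)]
  · simp [h0]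

end Doob

/-! ### Entropy of the walk and the differential entropy of a boundary -/

section Entropy

variable {G : Type*} [Group G] [Countable G] [MeasurableSpace G] [MeasurableSingletonClass G]

/-- The Shannon entropy of a measure on a countable group. -/
def shannon (ρ : Measure G) : ℝ≥0∞ := ∫⁻ x, ENNReal.ofReal (-Real.log (ρ.real {x})) ∂ρ

theorem shannon_eq_tsum (ρ : Measure G) [IsProbabilityMeasure ρ] :
    shannon ρ = ∑' x, ENNReal.ofReal (Real.negMulLog (ρ.real {x})) := by
  rw [shannon, lintegral_countable']
  refine tsum_congr fun x => ?_
  rw [← ofReal_measureReal, ← ENNReal.ofReal_mul, Real.negMulLog, mul_comm, mul_neg, neg_mul]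
  exact neg_nonneg.2 (Real.log_nonpos measureReal_nonneg measureReal_le_one)

theorem HasFiniteEntropy.shannon_ne_top {μ : Measure G} [IsProbabilityMeasure μ]
    (h : HasFiniteEntropy μ) : shannon μ ≠ ∞ := by
  rw [shannon_eq_tsum]
  exact Summable.tsum_ofReal_ne_top h

variable (μ : Measure G) [IsProbabilityMeasure μ]

/-- The information `-log μ^{*n}(ωₙ)` of the position at time `n`. -/
def walkInfo (n : ℕ) (ω : ℕ → G) : ℝ := -Real.log ((walkLaw μ n).real {ω n})

theorem walkInfo_nonneg (n : ℕ) (ω : ℕ → G) : 0 ≤ walkInfo μ n ω :=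
  neg_nonneg.2 (Real.log_nonpos measureReal_nonneg measureReal_le_one)

theorem measurable_walkInfo (n : ℕ) : Measurable (walkInfo μ n) :=
  (measurable_of_countable fun x => -Real.log ((walkLaw μ n).real {x})).comp (measurable_pi_apply n)

theorem lintegral_walkInfo (n : ℕ) :
    ∫⁻ ω, ENNReal.ofReal (walkInfo μ n ω) ∂pathMeasure μ = shannon (walkLaw μ n) :=
  (lintegral_walkLaw μ n fun x => ENNReal.ofReal (-Real.log ((walkLaw μ n).real {x}))).symm

theorem ae_walkInfo_add_le (m n : ℕ) : ∀ᵐ ω ∂pathMeasure μ,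
    walkInfo μ (m + n) ω ≤ walkInfo μ m ω + walkInfo μ n (incrShift m ω) := by
  filter_upwards [ae_walkLaw_singleton_ne_zero μ m,
    ae_incrShift_of_ae μ m (ae_walkLaw_singleton_ne_zero μ n)] with ω h1 h2
  have h3 := mul_walkLaw_le μ m n (ω m) (incrShift m ω n)
  rw [mul_incrShift] at h3
  have p1 : 0 < (walkLaw μ m).real {ω m} := ENNReal.toReal_pos h1 (measure_ne_top _ _)
  have p2 : 0 < (walkLaw μ n).real {incrShift m ω n} := ENNReal.toReal_pos h2 (measure_ne_top _ _)
  have h4 : (walkLaw μ m).real {ω m} * (walkLaw μ n).real {incrShift m ω n} ≤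
      (walkLaw μ (m + n)).real {ω (m + n)} := by
    rw [Measure.real, Measure.real, ← ENNReal.toReal_mul]
    exact ENNReal.toReal_mono (measure_ne_top _ _) h3
  have h5 := Real.log_le_log (mul_pos p1 p2) h4
  rw [Real.log_mul p1.ne' p2.ne'] at h5
  unfold walkInfo
  linarith

theorem shannon_walkLaw_add_le (m n : ℕ) :
    shannon (walkLaw μ (m + n)) ≤ shannon (walkLaw μ m) + shannon (walkLaw μ n) := by
  have hm := fun n => (measurable_walkInfo μ n).ennreal_ofReal
  rw [← lintegral_walkInfo, ← lintegral_walkInfo, ← lintegral_walkInfo,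
    ← (measurePreserving_incrShift μ m).lintegral_comp (hm n), ← lintegral_add_left (hm m)]
  refine lintegral_mono_ae ?_
  filter_upwards [ae_walkInfo_add_le μ m n] with ω hω
  rw [← ENNReal.ofReal_add (walkInfo_nonneg _ _ _) (walkInfo_nonneg _ _ _)]
  exact ENNReal.ofReal_le_ofReal hω

theorem shannon_walkLaw_ne_top (h : shannon μ ≠ ∞) (n : ℕ) : shannon (walkLaw μ n) ≠ ∞ := by
  induction n with
  | zero =>
    rw [walkLaw_zero, shannon, lintegral_dirac]
    simp
  | succ n ih =>
    refine ne_top_of_le_ne_top ?_ (shannon_walkLaw_add_le μ n 1)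
    rw [walkLaw_one]
    exact ENNReal.add_ne_top.2 ⟨ih, h⟩

theorem integrable_walkInfo (h : shannon μ ≠ ∞) (n : ℕ) :
    Integrable (walkInfo μ n) (pathMeasure μ) := by
  refine ⟨(measurable_walkInfo μ n).aestronglyMeasurable, ?_⟩
  rw [hasFiniteIntegral_iff_ofReal (Eventually.of_forall (walkInfo_nonneg μ n)),
    lintegral_walkInfo]
  exact (shannon_walkLaw_ne_top μ h n).lt_top

theorem integral_walkInfo (n : ℕ) :
    ∫ ω, walkInfo μ n ω ∂pathMeasure μ = (shannon (walkLaw μ n)).toReal := by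
  rw [integral_eq_lintegral_of_nonneg_ae (Eventually.of_forall (walkInfo_nonneg μ n))
    (measurable_walkInfo μ n).aestronglyMeasurable, lintegral_walkInfo]

variable {B : Type*} [MeasurableSpace B] [MulAction G B] [MeasurableConstSMul G B]

/-- The logarithm of the boundary density at the position at time `n`. -/
def logDensity (Φ : (ℕ → G) → B) (n : ℕ) (ω : ℕ → G) : ℝ :=
  Real.log (boundaryDensity (harmonicMeasure μ Φ) (Φ ω) (ω n)).toReal

/-- The information of the position at time `n` with respect to the conditional measure. -/
def condInfo (Φ : (ℕ → G) → B) (n : ℕ) (ω : ℕ → G) : ℝ := walkInfo μ n ω - logDensity μ Φ n ω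

namespace IsBoundaryMap

variable {μ} {Φ : (ℕ → G) → B} (hΦ : IsBoundaryMap μ Φ)

include hΦ

theorem measurable_logDensity (n : ℕ) : Measurable (logDensity μ Φ n) :=
  (measurable_boundaryDensity_path hΦ.measurable _ n).ennreal_toReal.log

theorem measurable_condInfo (n : ℕ) : Measurable (condInfo μ Φ n) :=
  (measurable_walkInfo μ n).sub (hΦ.measurable_logDensity n)

theorem ae_condInfo_eq (n : ℕ) : ∀ᵐ ω ∂pathMeasure μ, condInfo μ Φ n ω = -Real.log
    (walkLaw μ n {ω n} * boundaryDensity (harmonicMeasure μ Φ) (Φ ω) (ω n)).toReal := by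
  filter_upwards [hΦ.ae_boundaryDensity_ne_zero n, hΦ.ae_boundaryDensity_ne_top n,
    ae_walkLaw_singleton_ne_zero μ n] with ω h1 h2 h3
  rw [ENNReal.toReal_mul, Real.log_mul]
  · simp only [condInfo, walkInfo, logDensity, Measure.real]; ring
  · exact (ENNReal.toReal_pos h3 (measure_ne_top _ _)).ne'
  · exact (ENNReal.toReal_pos h1 h2).ne'

theorem ae_condInfo_nonneg (n : ℕ) : ∀ᵐ ω ∂pathMeasure μ, 0 ≤ condInfo μ Φ n ω := by
  filter_upwards [hΦ.ae_condInfo_eq n, hΦ.ae_walkLaw_mul_boundaryDensity_path_le_one n] with ω h1 h2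
  rw [h1]
  refine neg_nonneg.2 (Real.log_nonpos ENNReal.toReal_nonneg ?_)
  exact ENNReal.toReal_le_of_le_ofReal zero_le_one (by simpa using h2)

theorem ae_logDensity_add (m n : ℕ) : ∀ᵐ ω ∂pathMeasure μ,
    logDensity μ Φ (m + n) ω = logDensity μ Φ m ω + logDensity μ Φ n (incrShift m ω) := by
  filter_upwards [hΦ.ae_boundaryDensity_path_add m n, hΦ.ae_boundaryDensity_ne_zero m,
    hΦ.ae_boundaryDensity_ne_top m, ae_incrShift_of_ae μ m (hΦ.ae_boundaryDensity_ne_zero n),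
    ae_incrShift_of_ae μ m (hΦ.ae_boundaryDensity_ne_top n)] with ω h1 h2 h3 h4 h5
  rw [logDensity, h1, ENNReal.toReal_mul, Real.log_mul]
  · rfl
  · exact (ENNReal.toReal_pos h2 h3).ne'
  · exact (ENNReal.toReal_pos h4 h5).ne'

theorem ae_condInfo_add_le (m n : ℕ) : ∀ᵐ ω ∂pathMeasure μ,
    condInfo μ Φ (m + n) ω ≤ condInfo μ Φ m ω + condInfo μ Φ n (incrShift m ω) := by
  filter_upwards [hΦ.ae_logDensity_add m n, ae_walkInfo_add_le μ m n] with ω h1 h2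
  simp only [condInfo]
  linarith

theorem integrable_inv_boundaryDensity (n : ℕ) : Integrable (fun ω =>
    (boundaryDensity (harmonicMeasure μ Φ) (Φ ω) (ω n)).toReal⁻¹) (pathMeasure μ) := by
  have := isProbabilityMeasure_harmonicMeasure μ hΦ.measurable
  have h := hΦ.lintegral_div_boundaryDensity_le n (F := fun _ => 1) measurable_const
  simp only [lintegral_const, measure_univ, mul_one, one_div] at h
  have h2 := integrable_toReal_of_lintegral_ne_top
    (f := fun ω => (boundaryDensity (harmonicMeasure μ Φ) (Φ ω) (ω n))⁻¹) (μ := pathMeasure μ)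
    (measurable_boundaryDensity_path hΦ.measurable _ n).inv.aemeasurable
    (ne_top_of_le_ne_top ENNReal.one_ne_top h)
  simpa using h2

/-- Nonnegativity of `condInfo` bounds the log-density above by `walkInfo`. From below, `log t ≤ t -
1` at the inverse density suffices, because the inverse density has mean at most 1. -/
theorem integrable_logDensity (h : shannon μ ≠ ∞) (n : ℕ) :
    Integrable (logDensity μ Φ n) (pathMeasure μ) := by
  refine Integrable.mono' ((integrable_walkInfo μ h n).add (hΦ.integrable_inv_boundaryDensity n))
    (hΦ.measurable_logDensity n).aestronglyMeasurable ?_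
  filter_upwards [hΦ.ae_condInfo_nonneg n, hΦ.ae_boundaryDensity_ne_zero n,
    hΦ.ae_boundaryDensity_ne_top n] with ω h1 h2 h3
  have p := ENNReal.toReal_pos h2 h3
  have h4 : -logDensity μ Φ n ω ≤
      (boundaryDensity (harmonicMeasure μ Φ) (Φ ω) (ω n)).toReal⁻¹ := by
    have := Real.log_le_sub_one_of_pos (inv_pos.2 p)
    rw [Real.log_inv] at this
    unfold logDensity
    linarith
  have h5 := walkInfo_nonneg μ n ω
  have h6 := (inv_pos.2 p).le
  simp only [condInfo] at h1
  rw [Real.norm_eq_abs, abs_le]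
  simp only [Pi.add_apply]
  constructor <;> linarith

theorem integrable_condInfo (h : shannon μ ≠ ∞) (n : ℕ) :
    Integrable (condInfo μ Φ n) (pathMeasure μ) :=
  (integrable_walkInfo μ h n).sub (hΦ.integrable_logDensity h n)

/-- The cocycle property and invariance under the shift of increments make the mean additive in
time; the mean at time 1 is the differential entropy. -/
theorem integral_logDensity (h : shannon μ ≠ ∞) (n : ℕ) :
    ∫ ω, logDensity μ Φ n ω ∂pathMeasure μ = n * ∫ ω, logDensity μ Φ 1 ω ∂pathMeasure μ := by
  have hadd : ∀ m n, ∫ ω, logDensity μ Φ (m + n) ω ∂pathMeasure μ =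
      ∫ ω, logDensity μ Φ m ω ∂pathMeasure μ + ∫ ω, logDensity μ Φ n ω ∂pathMeasure μ := by
    intro m n
    have hmp := measurePreserving_incrShift μ m
    have hi := hΦ.integrable_logDensity h n
    have e : ∫ ω, logDensity μ Φ n (incrShift m ω) ∂pathMeasure μ =
        ∫ ω, logDensity μ Φ n ω ∂pathMeasure μ := by
      conv_rhs => rw [← hmp.map_eq]
      rw [integral_map hmp.measurable.aemeasurable
        (hΦ.measurable_logDensity n).aestronglyMeasurable]
    have hi' : Integrable (fun ω => logDensity μ Φ n (incrShift m ω)) (pathMeasure μ) :=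
      hmp.integrable_comp_of_integrable hi
    rw [integral_congr_ae (hΦ.ae_logDensity_add m n),
      integral_add (hΦ.integrable_logDensity h m) hi', e]
  induction n with
  | zero =>
    have := hadd 0 0
    simp only [add_zero] at this
    simp only [Nat.cast_zero, zero_mul]
    linarith
  | succ n ih => rw [hadd n 1, ih]; push_cast; ring

end IsBoundaryMap

end Entropy

/-! ### The mean ergodic theorem in `L¹` and ergodicity of the increments -/

section MeanErgodic

variable {X : Type*} [MeasurableSpace X] {ρ : Measure X} [IsProbabilityMeasure ρ] {T : X → X}

theorem aestronglyMeasurable_birkhoffAverage (hT : MeasurePreserving T ρ ρ) {g : X → ℝ}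
    (hg : AEStronglyMeasurable g ρ) (n : ℕ) :
    AEStronglyMeasurable (fun x => birkhoffAverage ℝ T g n x) ρ := by
  simp only [birkhoffAverage, birkhoffSum]
  have h : AEStronglyMeasurable (fun x => ∑ k ∈ Finset.range n, g (T^[k] x)) ρ :=
    Finset.aestronglyMeasurable_fun_sum _ fun k _ => hg.comp_measurePreserving (hT.iterate k)
  exact h.const_smul (n : ℝ)⁻¹

theorem eLpNorm_birkhoffAverage_le (hT : MeasurePreserving T ρ ρ) {g : X → ℝ}
    (hg : AEStronglyMeasurable g ρ) (n : ℕ) :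
    eLpNorm (fun x => birkhoffAverage ℝ T g n x) 1 ρ ≤ eLpNorm g 1 ρ := by
  have e : (fun x => birkhoffAverage ℝ T g n x) =
      (n : ℝ)⁻¹ • ∑ k ∈ Finset.range n, fun x => g (T^[k] x) := by
    funext x; simp [birkhoffAverage, birkhoffSum]
  rw [e, eLpNorm_const_smul]
  have h1 : eLpNorm (∑ k ∈ Finset.range n, fun x => g (T^[k] x)) 1 ρ ≤ n * eLpNorm g 1 ρ := by
    refine (eLpNorm_sum_le (fun k _ => hg.comp_measurePreserving (hT.iterate k)) le_rfl).trans ?_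
    have : ∀ k ∈ Finset.range n, eLpNorm (g ∘ T^[k]) 1 ρ = eLpNorm g 1 ρ :=
      fun k _ => eLpNorm_comp_measurePreserving hg (hT.iterate k)
    rw [Finset.sum_congr rfl this]
    simp
  rcases Nat.eq_zero_or_pos n with rfl | hn
  · simp
  calc ‖(n : ℝ)⁻¹‖ₑ * eLpNorm (∑ k ∈ Finset.range n, fun x => g (T^[k] x)) 1 ρ
      ≤ ‖(n : ℝ)⁻¹‖ₑ * (n * eLpNorm g 1 ρ) := by gcongr
    _ = eLpNorm g 1 ρ := by
      have hn0 : (n : ℝ≥0∞) ≠ 0 := by exact_mod_cast hn.ne'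
      have : ‖(n : ℝ)⁻¹‖ₑ = (n : ℝ≥0∞)⁻¹ := by
        rw [Real.enorm_of_nonneg (by positivity), ENNReal.ofReal_inv_of_pos (by exact_mod_cast hn)]
        simp
      rw [this, ← mul_assoc, ENNReal.inv_mul_cancel hn0 (by simp), one_mul]

/-- Von Neumann's theorem gives `L²` convergence to the projection onto fixed vectors, which are
constants by ergodicity. On a probability space this implies `L¹` convergence, and comparing
integrals identifies the constant. -/
theorem tendsto_eLpNorm_birkhoffAverage_of_memLp_two (hT : Ergodic T ρ) {g : X → ℝ}
    (hg : MemLp g 2 ρ) :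
    Tendsto (fun n => eLpNorm (fun x => birkhoffAverage ℝ T g n x - ∫ y, g y ∂ρ) 1 ρ) atTop
      (𝓝 0) := by
  have hmp := hT.toMeasurePreserving
  let U : Lp ℝ 2 ρ →L[ℝ] Lp ℝ 2 ρ :=
    (Lp.compMeasurePreservingₗᵢ ℝ T hmp).toContinuousLinearMap
  have hU : ‖U‖ ≤ 1 := U.opNorm_le_bound zero_le_one fun x => by
    rw [one_mul]; exact ((Lp.compMeasurePreservingₗᵢ ℝ T hmp).norm_map x).le
  have hlim := U.tendsto_birkhoffAverage_orthogonalProjection hU hg.toLp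
  set y := (U.eqLocus (1 : Lp ℝ 2 ρ →L[ℝ] Lp ℝ 2 ρ)).orthogonalProjectionOnto hg.toLp
  have hy : U (y : Lp ℝ 2 ρ) = y := y.2
  have hy' : (y : Lp ℝ 2 ρ) ∘ T =ᵐ[ρ] (y : Lp ℝ 2 ρ) := by
    have h1 := Lp.coeFn_compMeasurePreserving (y : Lp ℝ 2 ρ) hmp
    have h2 : Lp.compMeasurePreserving T hmp (y : Lp ℝ 2 ρ) = y := hy
    rw [h2] at h1
    exact h1.symm
  obtain ⟨c, hc⟩ := hT.ae_eq_const_of_ae_eq_comp_ae (Lp.aestronglyMeasurable _) hy'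
  have hiter : ∀ k, ((U : Lp ℝ 2 ρ → Lp ℝ 2 ρ)^[k] hg.toLp : X → ℝ) =ᵐ[ρ]
      fun x => g (T^[k] x) := by
    intro k
    have h1 : (U : Lp ℝ 2 ρ → Lp ℝ 2 ρ)^[k] hg.toLp =
        Lp.compMeasurePreserving T^[k] (hmp.iterate k) hg.toLp :=
      congrFun (Lp.compMeasurePreserving_iterate hmp k) hg.toLp
    rw [h1]
    refine (Lp.coeFn_compMeasurePreserving _ (hmp.iterate k)).trans ?_
    exact (hmp.iterate k).quasiMeasurePreserving.ae_eq_comp hg.coeFn_toLp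
  have hsum : ∀ n, ((birkhoffSum U _root_.id n hg.toLp : Lp ℝ 2 ρ) : X → ℝ) =ᵐ[ρ]
      fun x => birkhoffSum T g n x := by
    intro n
    induction n with
    | zero =>
      simp only [birkhoffSum_zero]
      exact Lp.coeFn_zero _ _ _
    | succ n ih =>
      simp only [birkhoffSum_succ]
      refine (Lp.coeFn_add _ _).trans ?_
      filter_upwards [ih, hiter n] with x h1 h2
      simp only [Pi.add_apply, h1, _root_.id, h2]
  have hav : ∀ n, ((birkhoffAverage ℝ U _root_.id n hg.toLp : Lp ℝ 2 ρ) : X → ℝ) =ᵐ[ρ]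
      fun x => birkhoffAverage ℝ T g n x := by
    intro n
    simp only [birkhoffAverage]
    refine (Lp.coeFn_smul _ _).trans ?_
    filter_upwards [hsum n] with x h1
    simp only [Pi.smul_apply, h1]
  have hL2 : Tendsto (fun n => eLpNorm (fun x => birkhoffAverage ℝ T g n x - c) 2 ρ) atTop
      (𝓝 0) := by
    have h1 := (Lp.tendsto_Lp_iff_tendsto_eLpNorm' _ _).1 hlim
    refine h1.congr fun n => eLpNorm_congr_ae ?_
    filter_upwards [hav n, hc] with x h2 h3
    simp only [Pi.sub_apply, h2, h3, Function.const]
  have hmeas := aestronglyMeasurable_birkhoffAverage hmp hg.1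
  have hL1 : Tendsto (fun n => eLpNorm (fun x => birkhoffAverage ℝ T g n x - c) 1 ρ) atTop
      (𝓝 0) :=
    tendsto_of_tendsto_of_tendsto_of_le_of_le tendsto_const_nhds hL2 (fun _ => zero_le)
      fun n => eLpNorm_le_eLpNorm_of_exponent_le (by norm_num)
        ((hmeas n).sub aestronglyMeasurable_const)
  have hgi : Integrable g ρ := hg.integrable (by norm_num)
  have hgk : ∀ k, Integrable (fun x => g (T^[k] x)) ρ := fun k =>
    (hmp.iterate k).integrable_comp_of_integrable hgi
  have hinteg : ∀ n, Integrable (fun x => birkhoffAverage ℝ T g n x) ρ := by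
    intro n
    simp only [birkhoffAverage, birkhoffSum]
    exact (integrable_finsetSum (Finset.range n) fun k _ => hgk k).smul (n : ℝ)⁻¹
  have hval : ∀ n, 0 < n → ∫ x, birkhoffAverage ℝ T g n x ∂ρ = ∫ x, g x ∂ρ := by
    intro n hn
    simp only [birkhoffAverage, birkhoffSum]
    rw [integral_smul, integral_finsetSum _ fun k _ => hgk k]
    have : ∀ k ∈ Finset.range n, ∫ x, g (T^[k] x) ∂ρ = ∫ x, g x ∂ρ := by
      intro k _
      have hk := hmp.iterate k
      conv_rhs => rw [← hk.map_eq]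
      rw [integral_map hk.measurable.aemeasurable (by rw [hk.map_eq]; exact hg.1)]
    rw [Finset.sum_congr rfl this]
    have : (n : ℝ) ≠ 0 := by exact_mod_cast hn.ne'
    simp [this]
  have hc' : c = ∫ x, g x ∂ρ := by
    have h1 := tendsto_integral_of_L1' (fun _ => c) aestronglyMeasurable_const
      (Eventually.of_forall hinteg) hL1
    simp only [integral_const, probReal_univ, smul_eq_mul, one_mul] at h1
    refine tendsto_nhds_unique h1 (tendsto_const_nhds.congr' ?_)
    filter_upwards [eventually_gt_atTop 0] with n hn using (hval n hn).symm
  rwa [← hc']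

/-- The mean ergodic theorem in `L¹`. -/
theorem tendsto_eLpNorm_birkhoffAverage (hT : Ergodic T ρ) {g : X → ℝ} (hg : Integrable g ρ) :
    Tendsto (fun n => eLpNorm (fun x => birkhoffAverage ℝ T g n x - ∫ y, g y ∂ρ) 1 ρ) atTop
      (𝓝 0) := by
  refine ENNReal.tendsto_nhds_zero.2 fun ε hε => ?_
  have hε3 : ε / 3 ≠ 0 := by simpa using hε.ne'
  -- Approximate `g` in `L¹` by a simple function. Averaging does not increase the `L¹` norm, so the
  -- three errors are the averaged difference, the `L²` case, and the difference of the means.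
  obtain ⟨h, hlt, hh2⟩ : ∃ h : X → ℝ, eLpNorm (g - h) 1 ρ < ε / 3 ∧ MemLp h 2 ρ := by
    obtain ⟨h, hlt, -⟩ := (memLp_one_iff_integrable.2 hg).exists_simpleFunc_eLpNorm_sub_lt
      ENNReal.one_ne_top hε3
    exact ⟨h, hlt, h.memLp_of_isFiniteMeasure 2 ρ⟩
  have hhi : Integrable h ρ := hh2.integrable (by norm_num)
  have hmp := hT.toMeasurePreserving
  filter_upwards [(ENNReal.tendsto_nhds_zero.1
    (tendsto_eLpNorm_birkhoffAverage_of_memLp_two hT hh2)) (ε / 3) (pos_iff_ne_zero.2 hε3)] with n hn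
  have e : (fun x => birkhoffAverage ℝ T g n x - ∫ y, g y ∂ρ) =
      ((fun x => birkhoffAverage ℝ T (g - h) n x) +
        (fun x => birkhoffAverage ℝ T h n x - ∫ y, h y ∂ρ)) +
        (fun _ => ∫ y, h y ∂ρ - ∫ y, g y ∂ρ) := by
    funext x
    simp only [Pi.add_apply, birkhoffAverage_sub, Pi.sub_apply]
    ring
  have hd : AEStronglyMeasurable (g - h) ρ := hg.1.sub hhi.1
  have m1 := aestronglyMeasurable_birkhoffAverage hmp hd n
  have m2 := (aestronglyMeasurable_birkhoffAverage hmp hhi.1 n).sub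
    (aestronglyMeasurable_const (b := ∫ y, h y ∂ρ))
  have h3 : eLpNorm (fun _ : X => ∫ y, h y ∂ρ - ∫ y, g y ∂ρ) 1 ρ ≤ ε / 3 := by
    rw [eLpNorm_const _ one_ne_zero (IsProbabilityMeasure.ne_zero ρ), ← integral_sub hhi hg]
    simp only [measure_univ, ENNReal.toReal_one, ENNReal.one_rpow, mul_one]
    refine (enorm_integral_le_lintegral_enorm _).trans ?_
    rw [← eLpNorm_one_eq_lintegral_enorm]
    have := eLpNorm_sub_comm h g 1 ρ
    exact (this.trans_le hlt.le)
  rw [e]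
  refine (eLpNorm_add_le (m1.add m2) aestronglyMeasurable_const le_rfl).trans ?_
  calc _ ≤ (ε / 3 + ε / 3) + ε / 3 := by
        refine add_le_add ((eLpNorm_add_le m1 m2 le_rfl).trans (add_le_add ?_ hn)) h3
        exact (eLpNorm_birkhoffAverage_le hmp hd n).trans hlt.le
    _ = ε := ENNReal.add_thirds ε

end MeanErgodic

section Ergodicity

variable {G : Type*} [Group G] [Countable G] [MeasurableSpace G] [MeasurableSingletonClass G]
  (μ : Measure G) [IsProbabilityMeasure μ]

theorem consSeq_head_tail (h : ℕ → G) : consSeq (h 0) (fun n => h (n + 1)) = h := by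
  funext n; cases n <;> rfl

theorem incrShift_one_samplePath (h : ℕ → G) :
    incrShift 1 (samplePath 1 h) = samplePath 1 (fun n => h (n + 1)) := by
  conv_lhs => rw [← consSeq_head_tail h, samplePath_one_consSeq, incrShift_succ_prependStep 0]
  funext n
  simp [incrShift, samplePath]

/-- Kolmogorov's zero-one law: a shift-invariant event depends, for every `n`, only on the
coordinates from `n` on. -/
theorem infinitePi_zero_or_one {A : Set (ℕ → G)} (hA : MeasurableSet A)
    (hinv : (fun (h : ℕ → G) n => h (n + 1)) ⁻¹' A = A) :
    Measure.infinitePi (fun _ : ℕ => μ) A = 0 ∨ Measure.infinitePi (fun _ : ℕ => μ) A = 1 := by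
  let s : ℕ → MeasurableSpace (ℕ → G) := fun n =>
    MeasurableSpace.comap (fun h : ℕ → G => h n) inferInstance
  have hs : ∀ n, s n ≤ MeasurableSpace.pi := fun n => (measurable_pi_apply n).comap_le
  have hind : iIndep s (Measure.infinitePi fun _ : ℕ => μ) :=
    iIndepFun_infinitePi (P := fun _ : ℕ => μ) (X := fun _ x => x) (fun _ => measurable_id)
  refine measure_zero_or_one_of_measurableSet_limsup_atTop hs hind ?_
  rw [limsup_eq_iInf_iSup_of_nat, MeasurableSpace.measurableSet_iInf]
  intro n
  have hn : (fun (h : ℕ → G) k => h (k + n)) ⁻¹' A = A := by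
    induction n with
    | zero => rfl
    | succ n ih =>
      conv_rhs => rw [← ih, ← hinv]
      ext h
      simp only [Set.mem_preimage]
      have : (fun k => h (k + (n + 1))) = fun k => h (k + n + 1) := by
        funext k; rw [add_assoc]
      rw [this]
      have : (fun k => h (k + n + 1)) = fun k => h (k + 1 + n) := by
        funext k; congr 1; omega
      rw [this]
  rw [← hn]
  have hmeas : @Measurable _ _ (⨆ i ≥ n, s i) MeasurableSpace.pi
      (fun (h : ℕ → G) k => h (k + n)) := by
    refine @measurable_pi_iff _ _ _ (⨆ i ≥ n, s i) _ _ |>.2 fun k => ?_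
    have h1 : s (k + n) ≤ ⨆ i ≥ n, s i := le_iSup₂_of_le (k + n) (by omega) le_rfl
    exact (comap_measurable (fun h : ℕ → G => h (k + n))).mono h1 le_rfl
  exact hmeas hA

/-- The sample path map intertwines the shift of independent increments with `incrShift 1`, so the
latter is a factor of a Bernoulli shift. -/
theorem ergodic_incrShift : Ergodic (incrShift 1) (pathMeasure μ) := by
  refine ⟨measurePreserving_incrShift μ 1, ⟨fun A hA hinv => ?_⟩⟩
  have hpre : MeasurableSet ((fun h : ℕ → G => samplePath 1 h) ⁻¹' A) :=
    measurable_samplePath_one hA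
  have h := infinitePi_zero_or_one μ hpre (by
    conv_rhs => rw [← hinv]
    ext h
    simp only [Set.mem_preimage, incrShift_one_samplePath])
  rw [← Measure.map_apply measurable_samplePath_one hA, ← pathMeasure_eq_map] at h
  rw [eventuallyConst_set']
  rcases h with h | h
  · exact Or.inl (ae_eq_empty.2 h)
  · exact Or.inr (ae_eq_univ.2 ((prob_compl_eq_zero_iff hA).2 h))

theorem iterate_incrShift_one (k : ℕ) (ω : ℕ → G) (h0 : ω 0 = 1) :
    (incrShift 1)^[k] ω = incrShift k ω := by
  induction k with
  | zero => funext n; simp [incrShift, h0]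
  | succ k ih => rw [Function.iterate_succ_apply', ih, incrShift_incrShift]

end Ergodicity

/-! ### Quotients with the same differential entropy are isomorphic -/

theorem measurableSet_eventually {Y : Type*} [MeasurableSpace Y] {r : ℕ → Y → Prop}
    (hr : ∀ j, MeasurableSet {y | r j y}) : MeasurableSet {y | ∀ᶠ j in atTop, r j y} := by
  have : {y | ∀ᶠ j in atTop, r j y} = ⋃ N, ⋂ j ∈ Set.Ici N, {y | r j y} := by
    ext y; simp [eventually_atTop]
  rw [this]
  exact MeasurableSet.iUnion fun N => MeasurableSet.biInter (Set.to_countable _) fun j _ => hr j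

section Comparison

variable {G : Type*} [Group G] [Countable G] [MeasurableSpace G] [MeasurableSingletonClass G]
  {Γ : Type*} [MeasurableSpace Γ] [MulAction G Γ] [MeasurableConstSMul G Γ]
  {B : Type*} [MeasurableSpace B] [MulAction G B] [MeasurableConstSMul G B]
  {μ : Measure G} [IsProbabilityMeasure μ] {Ψ : (ℕ → G) → Γ} {π : Γ → B}

theorem harmonicMeasure_comp_eq_map (hΨ : Measurable Ψ) (hπ : Measurable π) :
    harmonicMeasure μ (π ∘ Ψ) = (harmonicMeasure μ Ψ).map π := by
  rw [harmonicMeasure, harmonicMeasure, Measure.map_map hπ hΨ]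

theorem lintegral_boundaryDensity_comp_le (hΨ : IsBoundaryMap μ Ψ) (hπ : Measurable π)
    (hΦ : IsBoundaryMap μ (π ∘ Ψ)) (x : G) :
    ∫⁻ γ, boundaryDensity (harmonicMeasure μ (π ∘ Ψ)) (π γ) x ∂harmonicMeasure μ Ψ ≤ 1 := by
  have := isProbabilityMeasure_harmonicMeasure μ hΦ.measurable
  have h : ∫⁻ b, boundaryDensity (harmonicMeasure μ (π ∘ Ψ)) b x ∂harmonicMeasure μ (π ∘ Ψ) ≤ 1 := by
    refine Measure.lintegral_rnDeriv_le.trans ?_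
    rw [Measure.map_apply (measurable_const_smul x) MeasurableSet.univ]
    simp
  rw [harmonicMeasure_comp_eq_map hΨ.measurable hπ] at h ⊢
  rwa [lintegral_map (measurable_boundaryDensity _ x) hπ] at h

/-- Equality case of Jensen's inequality. The ratio `R` of the two densities has mean at most 1,
while by hypothesis `log R` has mean at least 0; as `log R ≤ R - 1` with equality only at 1, the
ratio is 1. -/
theorem ae_boundaryDensity_comp_path_eq (hμ : shannon μ ≠ ∞) (hΨ : IsBoundaryMap μ Ψ)
    (hπ : Measurable π) (hΦ : IsBoundaryMap μ (π ∘ Ψ))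
    (hle : ∫ ω, logDensity μ Ψ 1 ω ∂pathMeasure μ ≤ ∫ ω, logDensity μ (π ∘ Ψ) 1 ω ∂pathMeasure μ)
    (n : ℕ) :
    ∀ᵐ ω ∂pathMeasure μ, boundaryDensity (harmonicMeasure μ (π ∘ Ψ)) (π (Ψ ω)) (ω n) =
      boundaryDensity (harmonicMeasure μ Ψ) (Ψ ω) (ω n) := by
  set lam := harmonicMeasure μ (π ∘ Ψ) with hlam
  set ν := harmonicMeasure μ Ψ with hν
  let R : (ℕ → G) → ℝ≥0∞ := fun ω =>
    boundaryDensity lam (π (Ψ ω)) (ω n) / boundaryDensity ν (Ψ ω) (ω n)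
  have hRm : Measurable R := (measurable_boundaryDensity_path hΦ.measurable lam n).div
    (measurable_boundaryDensity_path hΨ.measurable ν n)
  have hR1 : ∫⁻ ω, R ω ∂pathMeasure μ ≤ 1 := by
    refine (hΨ.lintegral_div_boundaryDensity_le n
      (F := fun p => boundaryDensity lam (π p.2) p.1)
      (measurable_uncurry_of_countable fun x => (measurable_boundaryDensity lam x).comp hπ)).trans ?_
    calc _ ≤ ∫⁻ _, 1 ∂walkLaw μ n :=
          lintegral_mono fun x => lintegral_boundaryDensity_comp_le hΨ hπ hΦ x
      _ = 1 := by simp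
  have hRi : Integrable (fun ω => (R ω).toReal) (pathMeasure μ) :=
    integrable_toReal_of_lintegral_ne_top hRm.aemeasurable
      (ne_top_of_le_ne_top ENNReal.one_ne_top hR1)
  have hRint : ∫ ω, (R ω).toReal ∂pathMeasure μ ≤ 1 := by
    rw [integral_toReal hRm.aemeasurable
      (ae_lt_top hRm (ne_top_of_le_ne_top ENNReal.one_ne_top hR1))]
    exact ENNReal.toReal_le_of_le_ofReal zero_le_one (by simpa using hR1)
  have hpos : ∀ᵐ ω ∂pathMeasure μ, 0 < (R ω).toReal ∧ Real.log (R ω).toReal =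
      logDensity μ (π ∘ Ψ) n ω - logDensity μ Ψ n ω := by
    filter_upwards [hΨ.ae_boundaryDensity_ne_zero n, hΨ.ae_boundaryDensity_ne_top n,
      hΦ.ae_boundaryDensity_ne_zero n, hΦ.ae_boundaryDensity_ne_top n] with ω h1 h2 h3 h4
    have p1 := ENNReal.toReal_pos h1 h2
    have p2 := ENNReal.toReal_pos h3 h4
    simp only [R, ENNReal.toReal_div]
    exact ⟨div_pos p2 p1, Real.log_div p2.ne' p1.ne'⟩
  have hi1 := hΦ.integrable_logDensity hμ n
  have hi2 := hΨ.integrable_logDensity hμ n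
  let D : (ℕ → G) → ℝ := fun ω =>
    (R ω).toReal - 1 - (logDensity μ (π ∘ Ψ) n ω - logDensity μ Ψ n ω)
  have hDi : Integrable D (pathMeasure μ) := (hRi.sub (integrable_const 1)).sub (hi1.sub hi2)
  have hD0 : 0 ≤ᵐ[pathMeasure μ] D := by
    filter_upwards [hpos] with ω h
    have := Real.log_le_sub_one_of_pos h.1
    simp only [D, Pi.zero_apply, ← h.2]
    linarith
  have hDle : ∫ ω, D ω ∂pathMeasure μ ≤ 0 := by
    have e : ∫ ω, D ω ∂pathMeasure μ = ∫ ω, (R ω).toReal ∂pathMeasure μ - 1 -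
        (∫ ω, logDensity μ (π ∘ Ψ) n ω ∂pathMeasure μ - ∫ ω, logDensity μ Ψ n ω ∂pathMeasure μ) := by
      have e1 := integral_sub (hRi.sub (integrable_const 1)) (hi1.sub hi2)
      have e2 := integral_sub hi1 hi2
      have e3 := integral_sub hRi (integrable_const (1 : ℝ))
      rw [integral_const, probReal_univ, one_smul] at e3
      rw [← e2, ← e3]
      exact e1
    rw [e, hΦ.integral_logDensity hμ, hΨ.integral_logDensity hμ]
    have := mul_le_mul_of_nonneg_left hle (Nat.cast_nonneg (α := ℝ) n)
    linarith
  have hDz : D =ᵐ[pathMeasure μ] 0 :=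
    (integral_eq_zero_iff_of_nonneg_ae hD0 hDi).1 (le_antisymm hDle (integral_nonneg_of_ae hD0))
  filter_upwards [hpos, hDz, hΨ.ae_boundaryDensity_ne_zero n, hΨ.ae_boundaryDensity_ne_top n]
    with ω h1 h2 h3 h4
  have hR : (R ω).toReal = 1 := by
    by_contra hne
    have := Real.log_lt_sub_one_of_pos h1.1 hne
    simp only [D, Pi.zero_apply, ← h1.2] at h2
    linarith
  have hR' : R ω = 1 := by simpa [ENNReal.toReal_eq_one_iff] using hR
  have := (ENNReal.div_eq_one_iff h3 h4).1 hR'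
  exact this

/-- Equality along paths is informative only where the finer density is nonzero, so at first it
yields one inequality. The finer density has integral 1 and the coarser at most 1, which forces
equality. -/
theorem ae_boundaryDensity_comp_eq (hμ : shannon μ ≠ ∞) (hΨ : IsBoundaryMap μ Ψ)
    (hπ : Measurable π) (hΦ : IsBoundaryMap μ (π ∘ Ψ))
    (hle : ∫ ω, logDensity μ Ψ 1 ω ∂pathMeasure μ ≤ ∫ ω, logDensity μ (π ∘ Ψ) 1 ω ∂pathMeasure μ)
    {n : ℕ} {x : G} (hx : walkLaw μ n {x} ≠ 0) :
    ∀ᵐ γ ∂harmonicMeasure μ Ψ, boundaryDensity (harmonicMeasure μ Ψ) γ x =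
      boundaryDensity (harmonicMeasure μ (π ∘ Ψ)) (π γ) x := by
  have hνp := isProbabilityMeasure_harmonicMeasure μ hΨ.measurable
  have h0 := ae_boundaryDensity_comp_path_eq hμ hΨ hπ hΦ hle n
  set lam := harmonicMeasure μ (π ∘ Ψ) with hlam
  set ν := harmonicMeasure μ Ψ with hν
  have hm1 := measurable_boundaryDensity_uncurry (G := G) ν
  have hm2 : Measurable fun p : G × Γ => boundaryDensity lam (π p.2) p.1 :=
    measurable_uncurry_of_countable fun x => (measurable_boundaryDensity lam x).comp hπ
  let N : Set (G × Γ) := {p | boundaryDensity lam (π p.2) p.1 = boundaryDensity ν p.2 p.1}ᶜ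
  have hN : MeasurableSet N := (measurableSet_eq_fun hm2 hm1).compl
  have hFm : Measurable (N.indicator (1 : G × Γ → ℝ≥0∞)) := measurable_one.indicator hN
  have h1 := hΨ.lintegral_apply_density n hFm
  have h2 : ∫⁻ ω, N.indicator (1 : G × Γ → ℝ≥0∞) (ω n, Ψ ω) ∂pathMeasure μ = 0 := by
    rw [lintegral_congr_ae (g := fun _ => 0), lintegral_zero]
    filter_upwards [h0] with ω hω
    refine Set.indicator_of_notMem (fun h => ?_) _
    exact (show ¬ _ from h) hω
  rw [h2] at h1
  have hmm : Measurable fun x : G => ∫⁻ γ, boundaryDensity ν γ x *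
      N.indicator (1 : G × Γ → ℝ≥0∞) (x, γ) ∂ν := measurable_of_countable _
  have h3 := (lintegral_eq_zero_iff hmm).1 h1.symm
  have h4 : ∫⁻ γ, boundaryDensity ν γ x * N.indicator (1 : G × Γ → ℝ≥0∞) (x, γ) ∂ν = 0 := by
    by_contra hne
    exact hx (measure_mono_null (Set.singleton_subset_iff.2 hne) (ae_iff.1 h3))
  have h5 := (lintegral_eq_zero_iff ((measurable_boundaryDensity ν x).mul
    (hFm.comp (measurable_const.prodMk measurable_id)))).1 h4
  have hle' : (fun γ => boundaryDensity ν γ x) ≤ᵐ[ν] fun γ => boundaryDensity lam (π γ) x := by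
    filter_upwards [h5] with γ hγ
    by_cases hN' : (x, γ) ∈ N
    · have : boundaryDensity ν γ x = 0 := by simpa [hN'] using hγ
      simp [this]
    · have : boundaryDensity lam (π γ) x = boundaryDensity ν γ x := by simpa [N] using hN'
      exact this.symm.le
  have hone : ∫⁻ γ, boundaryDensity ν γ x ∂ν = 1 := by
    have := hΨ.lintegral_boundaryDensity_mul hx (f := fun _ => 1) measurable_const
    simpa using this
  exact ae_eq_of_ae_le_of_lintegral_le hle' (by rw [hone]; simp)
    ((measurable_boundaryDensity lam x).comp hπ).aemeasurable
    (by rw [hone]; exact lintegral_boundaryDensity_comp_le hΨ hπ hΦ x)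

/-- If the densities of the quotient coincide with those of the original boundary, then every
function on the latter factors through the quotient. -/
theorem exists_ae_eq_comp_of_boundaryDensity_eq (hΨ : IsBoundaryMap μ Ψ)
    (hπ : Measurable π) (hΦ : IsBoundaryMap μ (π ∘ Ψ))
    (hden : ∀ (n : ℕ) (x : G), walkLaw μ n {x} ≠ 0 → ∀ᵐ γ ∂harmonicMeasure μ Ψ,
      boundaryDensity (harmonicMeasure μ Ψ) γ x =
        boundaryDensity (harmonicMeasure μ (π ∘ Ψ)) (π γ) x)
    {f : Γ → ℝ≥0∞} (hf : Measurable f) (hf1 : ∀ γ, f γ ≤ 1) :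
    ∃ k : B → ℝ≥0∞, Measurable k ∧ ∀ᵐ γ ∂harmonicMeasure μ Ψ, f γ = k (π γ) := by
  have hνp := isProbabilityMeasure_harmonicMeasure μ hΨ.measurable
  have hlp := isProbabilityMeasure_harmonicMeasure μ hΦ.measurable
  have hmap := harmonicMeasure_comp_eq_map (μ := μ) hΨ.measurable hπ
  set lam := harmonicMeasure μ (π ∘ Ψ) with hlam
  set ν := harmonicMeasure μ Ψ with hν
  have hfin : ∫⁻ γ, f γ ∂ν ≠ ∞ :=
    ne_top_of_le_ne_top ENNReal.one_ne_top ((lintegral_mono hf1).trans (by simp))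
  have hfinm : IsFiniteMeasure (ν.withDensity f) := isFiniteMeasure_withDensity hfin
  -- The conditional expectation of `f` given `π`, realized as a density on the quotient.
  let k := ((ν.withDensity f).map π).rnDeriv lam
  have hk : Measurable k := Measure.measurable_rnDeriv _ _
  have hac : (ν.withDensity f).map π ≪ lam := by
    rw [hmap]; exact (withDensity_absolutelyContinuous ν f).map hπ
  have hwd : lam.withDensity k = (ν.withDensity f).map π := Measure.withDensity_rnDeriv_eq _ _ hac
  refine ⟨k, hk, ?_⟩
  -- The harmonic functions of `f` and of `k` agree at reachable points. The density at `x` factors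
  -- through `π`, so integrating it against `f` is the same as integrating it against `k`.
  have hinteg : ∀ (n : ℕ) (x : G), walkLaw μ n {x} ≠ 0 →
      ∫⁻ γ, f (x • γ) ∂ν = ∫⁻ b, k (x • b) ∂lam := by
    intro n x hx
    have hd := measurable_boundaryDensity lam x
    rw [← hΨ.lintegral_boundaryDensity_mul hx hf, ← hΦ.lintegral_boundaryDensity_mul hx hk,
      ← hlam, ← hν]
    calc ∫⁻ γ, boundaryDensity ν γ x * f γ ∂ν
        = ∫⁻ γ, f γ * boundaryDensity lam (π γ) x ∂ν := by
          refine lintegral_congr_ae ?_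
          filter_upwards [hden n x hx] with γ hγ
          rw [hγ, mul_comm]
      _ = ∫⁻ b, boundaryDensity lam b x ∂((ν.withDensity f).map π) := by
          rw [lintegral_map hd hπ, lintegral_withDensity_eq_lintegral_mul _ hf
            (g := fun γ => boundaryDensity lam (π γ) x) (hd.comp hπ)]
          rfl
      _ = ∫⁻ b, boundaryDensity lam b x * k b ∂lam := by
          rw [← hwd, lintegral_withDensity_eq_lintegral_mul _ hk hd]
          exact lintegral_congr fun b => mul_comm _ _
  -- Given the first `n` steps, the conditional means of `f` and `k` at the boundary point are the
  -- values of these harmonic functions at the current position.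
  have hcyl : ∀ (n : ℕ) (A : Set (ℕ → G)), MeasurableSet A → (∀ ω, ω ∈ A ↔ stopAt n ω ∈ A) →
      ∫⁻ ω in A, f (Ψ ω) ∂pathMeasure μ = ∫⁻ ω in A, k (π (Ψ ω)) ∂pathMeasure μ := by
    intro n A hA hAn
    have hm1 : Measurable fun p : (ℕ → G) × Γ => A.indicator 1 p.1 * f p.2 :=
      ((measurable_one.indicator hA).comp measurable_fst).mul (hf.comp measurable_snd)
    have hm2 : Measurable fun p : (ℕ → G) × B => A.indicator 1 p.1 * k p.2 :=
      ((measurable_one.indicator hA).comp measurable_fst).mul (hk.comp measurable_snd)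
    have h1 := hΨ.lintegral_stopAt n hm1
    have h2 := hΦ.lintegral_stopAt n hm2
    have e : ∀ ω (c : ℝ≥0∞), A.indicator 1 (stopAt n ω) * c = A.indicator (fun _ => c) ω := by
      intro ω c
      by_cases h : ω ∈ A
      · simp [h, (hAn ω).1 h]
      · have h' : stopAt n ω ∉ A := fun h' => h ((hAn ω).2 h')
        simp [h, h']
    rw [← lintegral_indicator hA, ← lintegral_indicator hA]
    have e1 : ∀ ω, A.indicator (fun ω => f (Ψ ω)) ω = A.indicator 1 (stopAt n ω) * f (Ψ ω) := by
      intro ω; rw [e]; by_cases h : ω ∈ A <;> simp [h]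
    have e2 : ∀ ω, A.indicator (fun ω => k (π (Ψ ω))) ω =
        A.indicator 1 (stopAt n ω) * k ((π ∘ Ψ) ω) := by
      intro ω; rw [e]; by_cases h : ω ∈ A <;> simp [h]
    simp only [e1, e2]
    rw [h1, h2]
    refine lintegral_congr_ae ?_
    filter_upwards [ae_walkLaw_singleton_ne_zero μ n] with ω hω
    rw [lintegral_const_mul _ (f := fun b => f (ω n • b)) (hf.comp (measurable_const_smul _)),
      lintegral_const_mul _ (f := fun b => k (ω n • b)) (hk.comp (measurable_const_smul _)),
      hinteg n _ hω]
  have hfΨ : Measurable fun ω => f (Ψ ω) := hf.comp hΨ.measurable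
  have hkΨ : Measurable fun ω => k (π (Ψ ω)) := hk.comp (hπ.comp hΨ.measurable)
  have hfin' : ∫⁻ ω, f (Ψ ω) ∂pathMeasure μ ≠ ∞ :=
    ne_top_of_le_ne_top ENNReal.one_ne_top ((lintegral_mono fun ω => hf1 (Ψ ω)).trans (by simp))
  have hfm : IsFiniteMeasure ((pathMeasure μ).withDensity fun ω => f (Ψ ω)) :=
    isFiniteMeasure_withDensity hfin'
  -- Cylinders form a generating π-system, so two finite measures that agree on them are equal, and
  -- so are their densities.
  have heq : (pathMeasure μ).withDensity (fun ω => f (Ψ ω)) =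
      (pathMeasure μ).withDensity fun ω => k (π (Ψ ω)) := by
    refine ext_of_generate_finite (measurableCylinders fun _ : ℕ => G)
      generateFrom_measurableCylinders.symm isPiSystem_measurableCylinders (fun A hA => ?_) ?_
    · rw [measurableCylinders_nat] at hA
      simp only [Set.mem_iUnion, Set.mem_singleton_iff, exists_prop] at hA
      obtain ⟨n, S, hS, rfl⟩ := hA
      have hAm : MeasurableSet (cylinder (Finset.Iic n) S : Set (ℕ → G)) :=
        MeasurableSet.cylinder _ hS
      rw [withDensity_apply _ hAm, withDensity_apply _ hAm]
      refine hcyl n _ hAm fun ω => ?_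
      have : (Finset.Iic n).restrict (stopAt n ω) = (Finset.Iic n).restrict ω := by
        funext i
        have hi := Finset.mem_Iic.1 i.2
        simp [stopAt, hi]
      rw [mem_cylinder, mem_cylinder, this]
    · rw [withDensity_apply _ MeasurableSet.univ, withDensity_apply _ MeasurableSet.univ]
      exact hcyl 0 _ MeasurableSet.univ fun ω => by simp
  have hae := (withDensity_eq_iff hfΨ.aemeasurable hkΨ.aemeasurable hfin').1 heq
  exact (ae_map_iff (p := fun γ => f γ = k (π γ)) hΨ.measurable.aemeasurable
    (measurableSet_eq_fun hf (hk.comp hπ))).2 hae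

/-- A single injective bounded Borel function `f`, the sigmoid of an embedding into the reals,
separates the points of `Γ`. Once `f = k ∘ π`, the composition of the inverse of `f` with `k`
inverts `π`. -/
theorem isIsoModNull_of_logDensity_le [StandardBorelSpace Γ] [StandardBorelSpace B]
    (hμ : shannon μ ≠ ∞) (hΨ : IsBoundaryMap μ Ψ)
    (hπ : Measurable π) (hΦ : IsBoundaryMap μ (π ∘ Ψ))
    (hle : ∫ ω, logDensity μ Ψ 1 ω ∂pathMeasure μ ≤
      ∫ ω, logDensity μ (π ∘ Ψ) 1 ω ∂pathMeasure μ) :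
    IsIsoModNull (harmonicMeasure μ Ψ) (harmonicMeasure μ (π ∘ Ψ)) π := by
  have : Nonempty Γ := ⟨Ψ 1⟩
  let f : Γ → ℝ≥0∞ := fun γ => ENNReal.ofReal (Real.sigmoid (embeddingReal Γ γ))
  have hemb := measurableEmbedding_embeddingReal Γ
  have hf : Measurable f :=
    ((Real.sigmoid_monotone.measurable).comp hemb.measurable).ennreal_ofReal
  have hinj : Function.Injective f := by
    intro γ γ' h
    have := (ENNReal.ofReal_eq_ofReal_iff (Real.sigmoid_nonneg _) (Real.sigmoid_nonneg _)).1 h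
    exact hemb.injective (Real.sigmoid_injective this)
  have hfe : MeasurableEmbedding f := hf.measurableEmbedding hinj
  obtain ⟨k, hk, hfk⟩ := exists_ae_eq_comp_of_boundaryDensity_eq hΨ hπ hΦ
    (fun n x hx => ae_boundaryDensity_comp_eq hμ hΨ hπ hΦ hle hx) hf
    (fun γ => ENNReal.ofReal_le_one.2 (Real.sigmoid_le_one _))
  have hψ : Measurable fun b => hfe.invFun (k b) := hfe.measurable_invFun.comp hk
  have hl : ∀ᵐ γ ∂harmonicMeasure μ Ψ, hfe.invFun (k (π γ)) = γ := by
    filter_upwards [hfk] with γ hγ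
    rw [← hγ]
    exact hfe.leftInverse_invFun γ
  refine ⟨fun b => hfe.invFun (k b), hψ, hl, ?_⟩
  rw [harmonicMeasure_comp_eq_map hΨ.measurable hπ]
  refine (ae_map_iff (p := fun y => π (hfe.invFun (k y)) = y) hπ.aemeasurable
    (measurableSet_eq_fun (hπ.comp hψ) measurable_id)).2 ?_
  filter_upwards [hl] with γ hγ
  rw [hγ]

end Comparison

/-! ### Subexponential concentration -/

section Concentration

variable {G : Type*} [Group G] [Countable G] [MeasurableSpace G] [MeasurableSingletonClass G]

theorem measurable_measureReal_apply_eq (Λ : Measure (ℕ → G)) (n : ℕ) :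
    Measurable fun ω : ℕ → G => Λ.real {ω' | ω' n = ω n} :=
  (measurable_of_countable fun x : G => Λ.real {ω' | ω' n = x}).comp (measurable_pi_apply n)

/-- Atoms of mass at most `t` contribute at most `t` per element of `A`; the rest of `A` lies in the
event that the position is a heavy atom. -/
theorem measureReal_mem_finset_le (Λ : Measure (ℕ → G)) [IsProbabilityMeasure Λ] (n : ℕ)
    (A : Finset G) {t : ℝ} (ht : 0 ≤ t) :
    Λ.real {ω | ω n ∈ A} ≤ Λ.real {ω | ¬ Λ.real {ω' | ω' n = ω n} ≤ t} + A.card * t := by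
  have hsub : {ω : ℕ → G | ω n ∈ A} ⊆ {ω | ¬ Λ.real {ω' | ω' n = ω n} ≤ t} ∪
      ⋃ x ∈ A.filter (fun x => Λ.real {ω' | ω' n = x} ≤ t), {ω | ω n = x} := by
    intro ω hω
    by_cases h : Λ.real {ω' | ω' n = ω n} ≤ t
    · right
      simp only [Set.mem_iUnion]
      exact ⟨ω n, Finset.mem_filter.2 ⟨hω, h⟩, rfl⟩
    · exact Or.inl h
  refine (measureReal_mono hsub).trans ((measureReal_union_le _ _).trans ?_)
  gcongr
  refine (measureReal_biUnion_finset_le _ _).trans ?_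
  refine (Finset.sum_le_card_nsmul _ _ t fun x hx => (Finset.mem_filter.1 hx).2).trans ?_
  rw [nsmul_eq_mul]
  gcongr
  exact Finset.filter_subset _ _

/-- A measure whose one-dimensional distributions are exponentially small along a subsequence is
not concentrated on sets of subexponential size. -/
theorem not_isSubexponentiallyConcentrated (Λ : Measure (ℕ → G)) [IsProbabilityMeasure Λ]
    {c : ℝ} (hc : 0 < c) {ns : ℕ → ℕ} (hns : StrictMono ns)
    (h : ∀ᵐ ω ∂Λ, ∀ᶠ j in atTop, Λ.real {ω' | ω' (ns j) = ω (ns j)} ≤ Real.exp (-c * ns j)) :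
    ¬ IsSubexponentiallyConcentrated Λ := by
  rintro ⟨ε, hε, A, hA, hev⟩
  -- Eventual smallness of the atom almost surely makes the probability of a heavy atom at time `ns
  -- j` tend to zero.
  have hbad : Tendsto (fun j => Λ.real {ω | ¬ Λ.real {ω' | ω' (ns j) = ω (ns j)} ≤
      Real.exp (-c * ns j)}) atTop (𝓝 0) := by
    have := tendsto_measure_of_ae_tendsto_indicator_of_isFiniteMeasure (L := atTop) (μ := Λ)
      (A := ∅) (As := fun j => {ω : ℕ → G | ¬ Λ.real {ω' | ω' (ns j) = ω (ns j)} ≤ Real.exp (-c * ns j)})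
      MeasurableSet.empty
      (fun j => (measurableSet_le (measurable_measureReal_apply_eq Λ (ns j))
        measurable_const).compl) (by
        filter_upwards [h] with ω hω
        filter_upwards [hω] with j hj
        simp only [Set.mem_empty_iff_false, iff_false]
        exact fun hn => (show ¬ _ from hn) hj)
    rw [measure_empty] at this
    exact (ENNReal.tendsto_toReal ENNReal.zero_ne_top).comp this
  have hexp : Tendsto (fun j => Real.exp (-(c / 2) * ns j)) atTop (𝓝 0) := by
    refine Real.tendsto_exp_atBot.comp ?_
    exact (tendsto_natCast_atTop_atTop.comp hns.tendsto_atTop).const_mul_atTop_of_neg (by linarith)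
  -- The growth `o(n)` is used with rate `c / 2`, which leaves half of the exponential decay of the
  -- atoms.
  have hcard : ∀ᶠ j in atTop, (A (ns j)).card * Real.exp (-c * ns j) ≤
      Real.exp (-(c / 2) * ns j) := by
    have := hns.tendsto_atTop.eventually (hA.bound (half_pos hc))
    filter_upwards [this] with j hj
    rw [Real.norm_eq_abs, Real.norm_natCast] at hj
    calc (A (ns j)).card * Real.exp (-c * ns j)
        ≤ Real.exp (Real.log (A (ns j)).card) * Real.exp (-c * ns j) := by
          gcongr; exact Real.le_exp_log _
      _ ≤ Real.exp (c / 2 * ns j) * Real.exp (-c * ns j) := by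
          gcongr; exact (le_abs_self _).trans hj
      _ = _ := by rw [← Real.exp_add]; congr 1; ring
  have hsum := hbad.add hexp
  rw [add_zero] at hsum
  obtain ⟨j, h1, h2, h3⟩ := ((hsum.eventually (gt_mem_nhds hε)).and
    (hcard.and (hns.tendsto_atTop.eventually hev))).exists
  have := measureReal_mem_finset_le Λ (ns j) (A (ns j)) (Real.exp_nonneg (-c * ns j))
  linarith

theorem ae_measureReal_apply_eq_pos (Λ : Measure (ℕ → G)) [IsProbabilityMeasure Λ] (n : ℕ) :
    ∀ᵐ ω ∂Λ, 0 < Λ.real {ω' | ω' n = ω n} := by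
  have h := ae_of_ae_map (measurable_pi_apply n).aemeasurable
    (ae_singleton_ne_zero (Λ.map fun ω => ω n))
  filter_upwards [h] with ω hω
  rw [Measure.map_apply (measurable_pi_apply n) (measurableSet_singleton _)] at hω
  exact ENNReal.toReal_pos hω (measure_ne_top _ _)

theorem sum_measureReal_apply_eq_le_one (Λ : Measure (ℕ → G)) [IsProbabilityMeasure Λ] (n : ℕ)
    (F : Finset G) : ∑ x ∈ F, Λ.real {ω | ω n = x} ≤ 1 := by
  rw [← measureReal_biUnion_finset]
  · exact measureReal_le_one
  · intro x _ y _ hxy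
    exact Set.disjoint_left.2 fun ω h1 h2 => hxy (h1.symm.trans h2)
  · exact fun x _ => measurableSet_apply_eq n x

/-- The total mass is 1, so at most `exp t` atoms can have mass at least `exp (-t)`. -/
theorem exists_finset_large_atoms (Λ : Measure (ℕ → G)) [IsProbabilityMeasure Λ] (n : ℕ)
    (t : ℝ) : ∃ A : Finset G, (∀ x, Real.exp (-t) ≤ Λ.real {ω | ω n = x} → x ∈ A) ∧
      (A.card : ℝ) ≤ Real.exp t := by
  have hs : Summable fun x : G => Λ.real {ω | ω n = x} :=
    summable_of_sum_le (fun _ => measureReal_nonneg) (sum_measureReal_apply_eq_le_one Λ n)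
  have hf : {x : G | Real.exp (-t) ≤ Λ.real {ω | ω n = x}}.Finite := by
    have := hs.tendsto_cofinite_zero.eventually (gt_mem_nhds (Real.exp_pos (-t)))
    rw [eventually_cofinite] at this
    simpa only [not_lt] using this
  refine ⟨hf.toFinset, fun x hx => hf.mem_toFinset.2 hx, ?_⟩
  have h1 := sum_measureReal_apply_eq_le_one Λ n hf.toFinset
  have h2 := Finset.card_nsmul_le_sum hf.toFinset (fun x => Λ.real {ω | ω n = x}) (Real.exp (-t))
    fun x hx => hf.mem_toFinset.1 hx
  rw [nsmul_eq_mul] at h2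
  have h3 := h2.trans h1
  generalize hf.toFinset.card = N at h3 ⊢
  rwa [Real.exp_neg, ← div_eq_mul_inv, div_le_one (Real.exp_pos t)] at h3

theorem measurable_information (Λ : Measure (ℕ → G)) (n : ℕ) : Measurable (information Λ n) :=
  (measurable_measureReal_apply_eq Λ n).log.const_mul _

theorem information_nonneg (Λ : Measure (ℕ → G)) [IsProbabilityMeasure Λ] (n : ℕ) (ω : ℕ → G) :
    0 ≤ information Λ n ω := by
  rw [information, neg_mul]
  exact neg_nonneg.2 (mul_nonpos_of_nonneg_of_nonpos (by positivity)
    (Real.log_nonpos measureReal_nonneg measureReal_le_one))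

/-- Vanishing asymptotic entropy implies concentration on sets of subexponential size. -/
theorem HasAsymptoticEntropy.isSubexponentiallyConcentrated {Λ : Measure (ℕ → G)}
    [IsProbabilityMeasure Λ] (h : HasAsymptoticEntropy Λ 0) :
    IsSubexponentiallyConcentrated Λ := by
  let a : ℕ → ℝ := fun n => ∫ ω, information Λ n ω ∂Λ
  have ha0 : ∀ n, 0 ≤ a n := fun n => integral_nonneg (information_nonneg Λ n)
  have ha : Tendsto a atTop (𝓝 0) := by
    have h1 := (ENNReal.tendsto_toReal ENNReal.zero_ne_top).comp h.tendsto_L1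
    refine h1.congr fun n => ?_
    simp only [sub_zero, Function.comp, a]
    rw [eLpNorm_one_eq_lintegral_enorm,
      integral_eq_lintegral_of_nonneg_ae (Eventually.of_forall (information_nonneg Λ n))
        (measurable_information Λ n).aestronglyMeasurable]
    congr 1
    exact lintegral_congr fun ω => Real.enorm_of_nonneg (information_nonneg Λ n ω)
  -- With threshold at least the square root of the mean, Markov's inequality leaves a bad event of
  -- probability at most `√(a n)`. The summand `1 / (n + 1)` keeps the threshold positive when the
  -- mean is zero.
  let e : ℕ → ℝ := fun n => √(a n) + 1 / ((n : ℝ) + 1)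
  have hs : Tendsto (fun n => √(a n)) atTop (𝓝 0) := by
    simpa [Function.comp_def] using (Real.continuous_sqrt.tendsto 0).comp ha
  have he : Tendsto e atTop (𝓝 0) := by
    simpa [e] using hs.add tendsto_one_div_add_atTop_nhds_zero_nat
  have he0 : ∀ n, 0 < e n := fun n => by positivity
  choose A hA hcard using fun n : ℕ => exists_finset_large_atoms Λ n (n * e n)
  refine ⟨1 / 2, by norm_num, A, ?_, ?_⟩
  · refine Asymptotics.isLittleO_iff.2 fun c hc => ?_
    filter_upwards [he.eventually (gt_mem_nhds hc)] with n hn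
    have hlog : 0 ≤ Real.log (A n).card := Real.log_natCast_nonneg _
    rw [Real.norm_of_nonneg hlog, Real.norm_natCast]
    have h1 : Real.log (A n).card ≤ n * e n := by
      rcases Nat.eq_zero_or_pos (A n).card with h0 | h0
      · rw [h0]; simp only [Nat.cast_zero, Real.log_zero]; have := he0 n; positivity
      · exact (Real.log_le_iff_le_exp (by exact_mod_cast h0)).2 (hcard n)
    nlinarith [Nat.cast_nonneg (α := ℝ) n]
  · filter_upwards [hs.eventually (gt_mem_nhds (by norm_num : (0 : ℝ) < 1 / 2)),
      eventually_ge_atTop 1] with n hn hn1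
    have hmark := mul_meas_ge_le_integral_of_nonneg
      (Eventually.of_forall (information_nonneg Λ n)) (h.integrable n) (e n)
    have hm : MeasurableSet {ω | e n ≤ information Λ n ω} :=
      measurableSet_le measurable_const (measurable_information Λ n)
    have hbad : Λ.real {ω | e n ≤ information Λ n ω} ≤ √(a n) := by
      have h1 : a n ≤ e n * √(a n) := by
        have h2 : √(a n) * √(a n) = a n := Real.mul_self_sqrt (ha0 n)
        have h3 : √(a n) ≤ e n := le_add_of_nonneg_right (by positivity)
        nlinarith [Real.sqrt_nonneg (a n)]
      exact le_of_mul_le_mul_left (hmark.trans h1) (he0 n)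
    -- Off the bad event the current atom has mass at least `exp (-n * e n)`, which is the defining
    -- condition for `A n`.
    have hle : Λ.real {ω | e n ≤ information Λ n ω}ᶜ ≤ Λ.real {ω | ω n ∈ A n} := by
      refine ENNReal.toReal_mono (measure_ne_top _ _) (measure_mono_ae ?_)
      filter_upwards [ae_measureReal_apply_eq_pos Λ n] with ω hω
      intro hlt
      refine hA n _ ?_
      have hlt : information Λ n ω < e n := not_le.1 hlt
      have hn0 : (0 : ℝ) < n := by exact_mod_cast hn1
      rw [← Real.le_log_iff_exp_le hω]
      simp only [information] at hlt
      rw [neg_mul, one_div_mul_eq_div, ← neg_div, div_lt_iff₀ hn0] at hlt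
      linarith
    rw [probReal_compl_eq_one_sub hm] at hle
    linarith

end Concentration

/-! ### A gap of differential entropy excludes concentration -/

section Comparison

variable {G : Type*} [Group G] [Countable G] [MeasurableSpace G] [MeasurableSingletonClass G]
  {Γ : Type*} [MeasurableSpace Γ] [MulAction G Γ] [MeasurableConstSMul G Γ]
  {B : Type*} [MeasurableSpace B] [MulAction G B] [MeasurableConstSMul G B]
  {μ : Measure G} [IsProbabilityMeasure μ] {Ψ : (ℕ → G) → Γ} {Φ : (ℕ → G) → B}

/-- Both log-densities are additive cocycles over the shift of increments, so their difference is
governed by the ergodic theorem. -/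
theorem ae_birkhoffSum_logDensity_sub (hΨ : IsBoundaryMap μ Ψ) (hΦ : IsBoundaryMap μ Φ) (n : ℕ) :
    ∀ᵐ ω ∂pathMeasure μ,
      birkhoffSum (incrShift 1) (fun ω => logDensity μ Ψ 1 ω - logDensity μ Φ 1 ω) n ω =
        logDensity μ Ψ n ω - logDensity μ Φ n ω := by
  induction n with
  | zero =>
    filter_upwards [hΨ.ae_logDensity_add 0 0, hΦ.ae_logDensity_add 0 0, ae_zero_eq_one μ]
      with ω h1 h2 h0
    have : incrShift 0 ω = ω := iterate_incrShift_one 0 ω h0 ▸ rfl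
    rw [this] at h1 h2
    simp only [add_zero] at h1 h2
    rw [birkhoffSum_zero]
    linarith
  | succ n ih =>
    filter_upwards [ih, hΨ.ae_logDensity_add n 1, hΦ.ae_logDensity_add n 1, ae_zero_eq_one μ]
      with ω h h1 h2 h0
    rw [birkhoffSum_succ, h, iterate_incrShift_one n ω h0, h1, h2]
    ring

/-- If the differential entropy of a boundary is strictly smaller than that of another one, then
the conditional measures are not concentrated on sets of subexponential size. -/
theorem ae_not_isSubexponentiallyConcentrated [StandardBorelSpace B] (hμ : shannon μ ≠ ∞)
    (hΨ : IsBoundaryMap μ Ψ) (hΦ : IsBoundaryMap μ Φ)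
    (hlt : ∫ ω, logDensity μ Φ 1 ω ∂pathMeasure μ < ∫ ω, logDensity μ Ψ 1 ω ∂pathMeasure μ) :
    ∀ᵐ b ∂harmonicMeasure μ Φ, ¬ IsSubexponentiallyConcentrated (conditionalWalk μ Φ b) := by
  have hi1 := hΨ.integrable_logDensity hμ 1
  have hi2 := hΦ.integrable_logDensity hμ 1
  let D : (ℕ → G) → ℝ := fun ω => logDensity μ Ψ 1 ω - logDensity μ Φ 1 ω
  have hD : Integrable D (pathMeasure μ) := hi1.sub hi2
  set c := ∫ ω, D ω ∂pathMeasure μ with hcdef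
  have hc : 0 < c := by
    have : c = _ := integral_sub hi1 hi2
    rw [this]; linarith
  have hmeas : Measurable D := (hΨ.measurable_logDensity 1).sub (hΦ.measurable_logDensity 1)
  have hT : Measurable (incrShift 1 : (ℕ → G) → ℕ → G) := (measurePreserving_incrShift μ 1).measurable
  have hL1 := tendsto_eLpNorm_birkhoffAverage (ergodic_incrShift μ) hD
  have hTM := tendstoInMeasure_of_tendsto_eLpNorm (f := fun n => birkhoffAverage ℝ (incrShift 1) D n)
    (g := fun _ => c) one_ne_zero
    (fun n => aestronglyMeasurable_birkhoffAverage (measurePreserving_incrShift μ 1)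
      hD.aestronglyMeasurable n)
    aestronglyMeasurable_const hL1
  -- Almost sure convergence along a subsequence is enough, since concentration is required at all
  -- large times.
  obtain ⟨ns, hns, hae⟩ := hTM.exists_seq_tendsto_ae
  -- Nonnegativity of `condInfo` for `Ψ` shows that `condInfo` for `Φ` is at least the difference of
  -- the log-densities, hence at least `(c / 2) n` along the subsequence.
  have hsmall : ∀ᵐ ω ∂pathMeasure μ, ∀ᶠ j in atTop, walkLaw μ (ns j) {ω (ns j)} *
      boundaryDensity (harmonicMeasure μ Φ) (Φ ω) (ω (ns j)) ≤
        ENNReal.ofReal (Real.exp (-(c / 2) * ns j)) := by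
    filter_upwards [hae, ae_all_iff.2 (ae_birkhoffSum_logDensity_sub hΨ hΦ),
      ae_all_iff.2 hΨ.ae_condInfo_nonneg, ae_all_iff.2 hΦ.ae_condInfo_eq,
      ae_all_iff.2 hΦ.ae_walkLaw_mul_boundaryDensity_path_le_one] with ω h1 h2 h3 h4 h5
    filter_upwards [h1.eventually (lt_mem_nhds (half_lt_self hc)), eventually_ge_atTop 1]
      with j hj hj1
    have hn : 0 < ns j := lt_of_lt_of_le hj1 hns.le_apply
    have hn' : (0 : ℝ) < ns j := by exact_mod_cast hn
    rw [birkhoffAverage, h2, smul_eq_mul, inv_mul_eq_div, lt_div_iff₀ hn'] at hj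
    have h6 := h3 (ns j)
    have h7 := h4 (ns j)
    simp only [condInfo] at h6 h7
    have hne := ne_top_of_le_ne_top ENNReal.one_ne_top (h5 (ns j))
    rw [← ENNReal.ofReal_toReal hne]
    refine ENNReal.ofReal_le_ofReal ((Real.le_exp_log _).trans (Real.exp_le_exp.2 ?_))
    linarith
  have hm : ∀ j, MeasurableSet {q : B × (ℕ → G) | walkLaw μ (ns j) {q.2 (ns j)} *
      boundaryDensity (harmonicMeasure μ Φ) q.1 (q.2 (ns j)) ≤
        ENNReal.ofReal (Real.exp (-(c / 2) * ns j))} := by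
    intro j
    have hq : Measurable fun q : B × (ℕ → G) => ((q.2 (ns j), q.1) : G × B) := by fun_prop
    have h1 : Measurable fun p : G × B => walkLaw μ (ns j) {p.1} *
        boundaryDensity (harmonicMeasure μ Φ) p.2 p.1 :=
      ((measurable_of_countable fun x : G => walkLaw μ (ns j) {x}).comp measurable_fst).mul
        (measurable_boundaryDensity_uncurry _)
    exact measurableSet_le (h1.comp hq) measurable_const
  have := ae_ae_conditionalWalk μ hΦ.measurable (p := fun b ω => ∀ᶠ j in atTop,
    walkLaw μ (ns j) {ω (ns j)} * boundaryDensity (harmonicMeasure μ Φ) b (ω (ns j)) ≤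
        ENNReal.ofReal (Real.exp (-(c / 2) * ns j))) (measurableSet_eventually hm) hsmall
  filter_upwards [this, hΦ.ae_conditionalWalk_singleton] with b hb hs
  refine not_isSubexponentiallyConcentrated _ (half_pos hc) hns ?_
  filter_upwards [hb] with ω hω
  filter_upwards [hω] with j hj
  rw [Measure.real, hs]
  exact ENNReal.toReal_le_of_le_ofReal (Real.exp_nonneg _) hj

theorem isIsoModNull_of_isSubexponentiallyConcentrated [StandardBorelSpace Γ]
    [StandardBorelSpace B] {π : Γ → B} (hμ : shannon μ ≠ ∞) (hΨ : IsBoundaryMap μ Ψ)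
    (hπ : Measurable π) (hΦ : IsBoundaryMap μ (π ∘ Ψ))
    (h : ∀ᵐ b ∂harmonicMeasure μ (π ∘ Ψ),
      IsSubexponentiallyConcentrated (conditionalWalk μ (π ∘ Ψ) b)) :
    IsIsoModNull (harmonicMeasure μ Ψ) (harmonicMeasure μ (π ∘ Ψ)) π := by
  have := isProbabilityMeasure_harmonicMeasure μ hΦ.measurable
  refine isIsoModNull_of_logDensity_le hμ hΨ hπ hΦ (not_lt.1 fun hlt => ?_)
  obtain ⟨b, h1, h2⟩ := (h.and (ae_not_isSubexponentiallyConcentrated hμ hΨ hΦ hlt)).exists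
  exact h2 h1

end Comparison

/-! ### Binomial averages -/

section Binomial

/-- The arrays obtained from their first row by iterating the average of neighbours. -/
def IsAveragingArray (D : ℕ → ℕ → ℝ) : Prop := ∀ n j, D (n + 1) j = (D n j + D n (j + 1)) / 2

variable {D : ℕ → ℕ → ℝ}

theorem IsAveragingArray.shift (hD : IsAveragingArray D) (i : ℕ) :
    IsAveragingArray fun n j => D n (i + j) := fun n j => hD n (i + j)

theorem IsAveragingArray.eq_sum (hD : IsAveragingArray D) (n j : ℕ) :
    D n j = ∑ k ∈ Finset.range (n + 1), (n.choose k : ℝ) / 2 ^ n * D 0 (j + k) := by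
  induction n generalizing j with
  | zero => simp
  | succ n ih =>
    have h := Finset.sum_choose_succ_mul (R := ℝ) (fun k _ => D 0 (j + k) / 2 ^ (n + 1)) n
    rw [hD, ih, ih]
    have e : ∀ k, ((n + 1).choose k : ℝ) / 2 ^ (n + 1) * D 0 (j + k) =
        ((n + 1).choose k : ℝ) * (D 0 (j + k) / 2 ^ (n + 1)) := fun k => by ring
    simp only [e]
    rw [h, add_div, Finset.sum_div, Finset.sum_div]
    congr 1
    · refine Finset.sum_congr rfl fun k _ => ?_
      rw [pow_succ]
      field_simp
    · refine Finset.sum_congr rfl fun k _ => ?_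
      rw [show j + (k + 1) = j + 1 + k by ring, pow_succ]
      field_simp

/-- Four times the variance identity of the Bernstein polynomials at `1/2`. -/
theorem sum_choose_mul_sq (n : ℕ) :
    ∑ k ∈ Finset.range (n + 1), (n.choose k : ℝ) / 2 ^ n * (2 * (k : ℝ) - n) ^ 2 = (n : ℝ) := by
  have h := congrArg (Polynomial.eval (1 / 2 : ℝ)) (bernsteinPolynomial.variance ℝ n)
  simp only [Polynomial.eval_finsetSum, Polynomial.eval_mul, Polynomial.eval_pow,
    Polynomial.eval_sub, Polynomial.eval_X, Polynomial.eval_natCast,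
    Polynomial.eval_one, bernsteinPolynomial, nsmul_eq_mul] at h
  have h4 := congrArg (fun t : ℝ => 4 * t) h
  simp only [Finset.mul_sum] at h4
  calc _ = _ := Finset.sum_congr rfl fun k hk => ?_
    _ = _ := h4
    _ = n := by ring
  have hk' : k ≤ n := Nat.lt_succ_iff.1 (Finset.mem_range.1 hk)
  have e : (1 / 2 : ℝ) ^ k * (1 / 2) ^ (n - k) = 1 / 2 ^ n := by
    rw [← pow_add, Nat.add_sub_cancel' hk', one_div_pow]
  have e2 : (1 - 1 / 2 : ℝ) = 1 / 2 := by norm_num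
  rw [e2, mul_assoc (n.choose k : ℝ), e]
  ring

/-- Cauchy–Schwarz with the binomial weights, which sum to 1. -/
theorem sum_choose_mul_abs_le (n : ℕ) :
    ∑ k ∈ Finset.range (n + 1), (n.choose k : ℝ) / 2 ^ n * |2 * (k : ℝ) - n| ≤ √n := by
  have hone : ∑ k ∈ Finset.range (n + 1), (n.choose k : ℝ) / 2 ^ n = 1 := by
    rw [← Finset.sum_div]
    have := Nat.sum_range_choose n
    rw [div_eq_one_iff_eq (by positivity)]
    exact_mod_cast this
  have h := Finset.sum_mul_sq_le_sq_mul_sq (Finset.range (n + 1))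
    (fun k => √((n.choose k : ℝ) / 2 ^ n)) fun k => √((n.choose k : ℝ) / 2 ^ n) * |2 * (k : ℝ) - n|
  have hs : ∀ k, √((n.choose k : ℝ) / 2 ^ n) ^ 2 = (n.choose k : ℝ) / 2 ^ n :=
    fun k => Real.sq_sqrt (by positivity)
  simp only [mul_pow, hs, sq_abs, sum_choose_mul_sq, hone, one_mul, ← mul_assoc,
    ← pow_two] at h
  exact Real.le_sqrt_of_sq_le h

/-- Both terms are binomial averages of row zero. Writing the weights for `n` through those for `n +
1` introduces the factor `2(n+1-k)/(n+1)`, so the weights differ by the factor `(2k-(n+1))/(n+1)`,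
whose mean absolute value is at most `1/√(n+1)`. -/
theorem IsAveragingArray.abs_sub_le_zero (hD : IsAveragingArray D) {C : ℝ}
    (hC : ∀ j, |D 0 j| ≤ C) (n : ℕ) : |D (n + 1) 0 - D n 0| ≤ C / √(n + 1 : ℕ) := by
  have hC0 : 0 ≤ C := (abs_nonneg _).trans (hC 0)
  have e : D n 0 = ∑ k ∈ Finset.range (n + 1 + 1),
      ((n + 1).choose k : ℝ) / 2 ^ (n + 1) * (2 * (n + 1 - k) / (n + 1)) * D 0 k := by
    rw [hD.eq_sum, Finset.sum_range_succ _ (n + 1)]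
    have hz : (2 * ((n : ℝ) + 1 - (n + 1 : ℕ)) / (n + 1)) = 0 := by push_cast; simp
    rw [hz, mul_zero, zero_mul, add_zero]
    refine Finset.sum_congr rfl fun k hk => ?_
    have hk' : k ≤ n := Nat.lt_succ_iff.1 (Finset.mem_range.1 hk)
    have h2 : ((n + 1).choose k : ℝ) * (n + 1 - k) = (n + 1) * n.choose k := by
      have := Nat.choose_mul_succ_eq n k
      have h3 : ((n + 1 - k : ℕ) : ℝ) = n + 1 - k := by
        rw [Nat.cast_sub (by omega)]; push_cast; ring
      rw [← h3]
      have h4 : (n.choose k : ℝ) * (n + 1) = ((n + 1).choose k : ℝ) * (n + 1 - k : ℕ) := by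
        exact_mod_cast this
      rw [← h4]; ring
    rw [zero_add]
    congr 1
    rw [div_mul_div_comm, div_eq_div_iff (by positivity) (by positivity)]
    have h5 : ((n + 1).choose k : ℝ) * (2 * (n + 1 - k)) = 2 * ((n + 1) * n.choose k) := by
      rw [← h2]; ring
    rw [h5]; ring
  rw [e, hD.eq_sum, ← Finset.sum_sub_distrib]
  refine (Finset.abs_sum_le_sum_abs _ _).trans ?_
  have hterm : ∀ k ∈ Finset.range (n + 1 + 1),
      |((n + 1).choose k : ℝ) / 2 ^ (n + 1) * D 0 (0 + k) -
        ((n + 1).choose k : ℝ) / 2 ^ (n + 1) * (2 * (n + 1 - k) / (n + 1)) * D 0 k| ≤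
      ((n + 1).choose k : ℝ) / 2 ^ (n + 1) * |2 * (k : ℝ) - (n + 1 : ℕ)| * (C / (n + 1 : ℕ)) := by
    intro k _
    have hn : (0 : ℝ) < (n + 1 : ℕ) := by positivity
    have e1 : ((n + 1).choose k : ℝ) / 2 ^ (n + 1) * D 0 (0 + k) -
        ((n + 1).choose k : ℝ) / 2 ^ (n + 1) * (2 * (n + 1 - k) / (n + 1)) * D 0 k =
        ((n + 1).choose k : ℝ) / 2 ^ (n + 1) * (2 * (k : ℝ) - (n + 1 : ℕ)) *
          (D 0 k / (n + 1 : ℕ)) := by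
      rw [zero_add]; push_cast; field_simp; ring
    rw [e1, abs_mul, abs_mul, abs_div (D 0 k), abs_of_pos hn,
      abs_of_nonneg (by positivity : (0 : ℝ) ≤ ((n + 1).choose k : ℝ) / 2 ^ (n + 1))]
    gcongr
    exact hC k
  refine (Finset.sum_le_sum hterm).trans ?_
  rw [← Finset.sum_mul]
  have h6 := sum_choose_mul_abs_le (n + 1)
  have hs : (0 : ℝ) < √(n + 1 : ℕ) := Real.sqrt_pos.2 (by positivity)
  calc _ ≤ √(n + 1 : ℕ) * (C / (n + 1 : ℕ)) := by gcongr
    _ = C / √(n + 1 : ℕ) := by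
      have h7 : ((n + 1 : ℕ) : ℝ) = √(n + 1 : ℕ) * √(n + 1 : ℕ) :=
        (Real.mul_self_sqrt (by positivity)).symm
      conv_lhs => rw [h7]
      rw [Real.sqrt_mul_self hs.le]
      field_simp

theorem tendsto_div_sqrt_succ (C : ℝ) :
    Tendsto (fun n : ℕ => C / √(n + 1 : ℕ)) atTop (𝓝 0) := by
  refine Tendsto.div_atTop tendsto_const_nhds ?_
  exact Real.tendsto_sqrt_atTop.comp
    (tendsto_natCast_atTop_atTop.comp (tendsto_add_atTop_nat 1))

/-- Neighbouring columns differ by twice the time increment of the left one, which tends to zero. -/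
theorem IsAveragingArray.tendsto_sub (hD : IsAveragingArray D) {C : ℝ}
    (hC : ∀ j, |D 0 j| ≤ C) (j : ℕ) :
    Tendsto (fun n => D n j - D n 0) atTop (𝓝 0) := by
  induction j with
  | zero => simp
  | succ j ih =>
    have h1 : Tendsto (fun n => D (n + 1) j - D n j) atTop (𝓝 0) :=
      squeeze_zero_norm (fun n => (hD.shift j).abs_sub_le_zero (fun i => hC (j + i)) n)
        (tendsto_div_sqrt_succ C)
    have h2 := (h1.const_mul 2).add ih
    simp only [mul_zero, add_zero] at h2
    refine h2.congr fun n => ?_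
    rw [hD n j]; ring

theorem IsAveragingArray.abs_sub_le (hD : IsAveragingArray D) {L ε : ℝ} {J : ℕ}
    (h : ∀ j, J ≤ j → |D 0 j - L| ≤ ε) (n j : ℕ) (hj : J ≤ j) : |D n j - L| ≤ ε := by
  induction n generalizing j with
  | zero => exact h j hj
  | succ n ih =>
    have h1 := abs_le.1 (ih j hj)
    have h2 := abs_le.1 (ih (j + 1) (by omega))
    rw [hD n j, abs_le]
    constructor <;> linarith

/-- Binomial averages of a convergent sequence converge to its limit. -/
theorem IsAveragingArray.tendsto (hD : IsAveragingArray D) {L : ℝ}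
    (hL : Tendsto (fun j => D 0 j) atTop (𝓝 L)) : Tendsto (fun n => D n 0) atTop (𝓝 L) := by
  obtain ⟨C, hC⟩ := (Metric.isBounded_range_of_tendsto _ hL).exists_norm_le
  have hC' : ∀ j, |D 0 j| ≤ C := fun j => hC _ ⟨j, rfl⟩
  refine Metric.tendsto_atTop.2 fun ε hε => ?_
  -- Column `J` averages only entries already close to `L`, and column zero is asymptotic to column
  -- `J`.
  obtain ⟨J, hJ⟩ := Metric.tendsto_atTop.1 hL (ε / 3) (by linarith)
  obtain ⟨N, hN⟩ := Metric.tendsto_atTop.1 (hD.tendsto_sub hC' J) (ε / 3) (by linarith)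
  refine ⟨N, fun n hn => ?_⟩
  have h1 := abs_le.1 (hD.abs_sub_le (fun j hj => (hJ j hj).le) n J le_rfl)
  have h2 := hN n hn
  rw [Real.dist_eq, sub_zero, abs_lt] at h2
  rw [Real.dist_eq, abs_lt]
  constructor <;> linarith [h2.1, h2.2, h1.1, h1.2]

end Binomial

/-! ### The lazy walk -/

section Lazy

variable {G : Type*} [Group G] [Countable G] [MeasurableSpace G] [MeasurableSingletonClass G]
  (μ : Measure G) [IsProbabilityMeasure μ]

theorem walkLaw_add (m n : ℕ) : walkLaw μ (m + n) = walkLaw μ m ∗ₘ walkLaw μ n := by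
  refine Measure.ext_of_lintegral _ fun f hf => ?_
  rw [lintegral_walkLaw_add, Measure.lintegral_mconv hf]

/-- The step distribution of the lazy random walk. -/
def lazyStep : Measure G := (2⁻¹ : ℝ≥0∞) • Measure.dirac 1 + (2⁻¹ : ℝ≥0∞) • μ

instance isProbabilityMeasure_lazyStep : IsProbabilityMeasure (lazyStep μ) := by
  constructor
  simp [lazyStep, ENNReal.inv_two_add_inv_two]

/-- The law of the position after `n` steps of the lazy walk and `j` steps of the walk. -/
def lazyLaw (n j : ℕ) : Measure G := walkLaw (lazyStep μ) n ∗ₘ walkLaw μ j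

instance isProbabilityMeasure_lazyLaw (n j : ℕ) : IsProbabilityMeasure (lazyLaw μ n j) := by
  unfold lazyLaw; infer_instance

theorem lazyLaw_zero_left (j : ℕ) : lazyLaw μ 0 j = walkLaw μ j := by
  rw [lazyLaw, walkLaw_zero, Measure.dirac_one_mconv]

theorem lazyLaw_zero_right (n : ℕ) : lazyLaw μ n 0 = walkLaw (lazyStep μ) n := by
  rw [lazyLaw, walkLaw_zero, Measure.mconv_dirac_one]

/-- A lazy step is either no step or a step of the original walk, with equal chances. Hence
integrals against these laws form an averaging array. -/
theorem lazyLaw_succ (n j : ℕ) :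
    lazyLaw μ (n + 1) j = (2⁻¹ : ℝ≥0∞) • lazyLaw μ n j + (2⁻¹ : ℝ≥0∞) • lazyLaw μ n (j + 1) := by
  refine Measure.ext_of_lintegral _ fun f hf => ?_
  rw [lintegral_add_measure, lintegral_smul_measure, lintegral_smul_measure]
  simp only [lazyLaw, Measure.lintegral_mconv hf]
  rw [lintegral_walkLaw_add, walkLaw_one]
  have h : ∀ x : G, ∫⁻ y, ∫⁻ z, f (x * y * z) ∂walkLaw μ j ∂lazyStep μ =
      2⁻¹ * ∫⁻ z, f (x * z) ∂walkLaw μ j + 2⁻¹ * ∫⁻ z, f (x * z) ∂walkLaw μ (j + 1) := by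
    intro x
    rw [lazyStep, lintegral_add_measure, lintegral_smul_measure, lintegral_smul_measure,
      lintegral_dirac, add_comm j 1, lintegral_walkLaw_add μ 1 j, walkLaw_one]
    simp [mul_assoc]
  simp only [h]
  rw [lintegral_add_left (measurable_of_countable _), lintegral_const_mul _ (measurable_of_countable _),
    lintegral_const_mul _ (measurable_of_countable _)]
  rfl

theorem integrable_of_abs_le_of_countable {ρ : Measure G} [IsFiniteMeasure ρ] {F : G → ℝ} {C : ℝ}
    (hF : ∀ x, |F x| ≤ C) : Integrable F ρ :=
  Integrable.of_bound (measurable_of_countable F).aestronglyMeasurable C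
    (Eventually.of_forall hF)

theorem isAveragingArray_integral_lazyLaw {F : G → ℝ} {C : ℝ} (hF : ∀ x, |F x| ≤ C) :
    IsAveragingArray fun n j => ∫ x, F x ∂lazyLaw μ n j := by
  intro n j
  simp only
  have hi : ∀ k, Integrable F ((2⁻¹ : ℝ≥0∞) • lazyLaw μ n k) := fun k =>
    (integrable_of_abs_le_of_countable hF).smul_measure (by simp)
  rw [lazyLaw_succ, integral_add_measure (hi _) (hi _), integral_smul_measure,
    integral_smul_measure]
  simp
  ring

theorem abs_integral_le_of_abs_le {ρ : Measure G} [IsProbabilityMeasure ρ] {F : G → ℝ} {C : ℝ}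
    (hF : ∀ x, |F x| ≤ C) : |∫ x, F x ∂ρ| ≤ C := by
  have := norm_integral_le_of_norm_le_const (μ := ρ) (f := F) (C := C) (Eventually.of_forall hF)
  simpa using this

/-- The laws of the lazy walk at consecutive times are asymptotically equal in total variation. -/
theorem abs_integral_lazyStep_sub_le {F : G → ℝ} {C : ℝ} (hF : ∀ x, |F x| ≤ C) (n : ℕ) :
    |∫ x, F x ∂walkLaw (lazyStep μ) (n + 1) - ∫ x, F x ∂walkLaw (lazyStep μ) n| ≤
      C / √(n + 1 : ℕ) := by
  have := (isAveragingArray_integral_lazyLaw μ hF).abs_sub_le_zero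
    (fun j => abs_integral_le_of_abs_le hF) n
  simpa only [lazyLaw_zero_right] using this

theorem tendsto_integral_lazyStep {F : G → ℝ} {C L : ℝ} (hF : ∀ x, |F x| ≤ C)
    (hL : Tendsto (fun n => ∫ x, F x ∂walkLaw μ n) atTop (𝓝 L)) :
    Tendsto (fun n => ∫ x, F x ∂walkLaw (lazyStep μ) n) atTop (𝓝 L) := by
  have := (isAveragingArray_integral_lazyLaw μ hF).tendsto (L := L)
    (by simpa only [lazyLaw_zero_left] using hL)
  simpa only [lazyLaw_zero_right] using this

theorem lazyStep_real_singleton (x : G) :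
    (lazyStep μ).real {x} = ((Measure.dirac 1 : Measure G).real {x} + μ.real {x}) / 2 := by
  rw [lazyStep, Measure.real, Measure.add_apply, Measure.smul_apply, Measure.smul_apply, smul_eq_mul,
    smul_eq_mul,
    ENNReal.toReal_add (ENNReal.mul_ne_top (by simp) (measure_ne_top _ _))
      (ENNReal.mul_ne_top (by simp) (measure_ne_top _ _))]
  simp [Measure.real]
  ring

theorem negMulLog_add_le {a b : ℝ} (ha : 0 ≤ a) (hb : 0 ≤ b) :
    Real.negMulLog (a + b) ≤ Real.negMulLog a + Real.negMulLog b := by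
  rcases ha.eq_or_lt with rfl | ha
  · simp
  rcases hb.eq_or_lt with rfl | hb
  · simp
  have h1 := Real.log_le_log ha (le_add_of_nonneg_right hb.le : a ≤ a + b)
  have h2 := Real.log_le_log hb (le_add_of_nonneg_left ha.le : b ≤ a + b)
  simp only [Real.negMulLog]
  nlinarith

theorem summable_measureReal_singleton (ρ : Measure G) [IsProbabilityMeasure ρ] :
    Summable fun x : G => ρ.real {x} := by
  refine ENNReal.summable_toReal (f := fun x : G => ρ {x}) ?_
  have h := lintegral_countable' (μ := ρ) (fun _ : G => 1)
  simp only [lintegral_one, measure_univ, one_mul] at h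
  rw [← h]
  exact ENNReal.one_ne_top

/-- `negMulLog` is subadditive on nonnegative numbers, so the half atom and half of `μ` can be
treated separately. -/
theorem hasFiniteEntropy_lazyStep {μ : Measure G} [IsProbabilityMeasure μ]
    (h : HasFiniteEntropy μ) : HasFiniteEntropy (lazyStep μ) := by
  classical
  have h1 : Summable fun x : G => Real.negMulLog ((Measure.dirac 1 : Measure G).real {x} / 2) := by
    refine summable_of_ne_finset_zero (s := {1}) fun x hx => ?_
    have : (Measure.dirac 1 : Measure G).real {x} = 0 := by
      have hx' : (1 : G) ≠ x := fun e => hx (by simp [e])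
      simp [Measure.real, hx']
    rw [this]; simp
  have h2 : Summable fun x : G => Real.negMulLog (μ.real {x} / 2) := by
    have := ((summable_measureReal_singleton μ).mul_right (Real.negMulLog 2⁻¹)).add
      (h.mul_left (2⁻¹ : ℝ))
    refine this.congr fun x => ?_
    rw [div_eq_mul_inv, Real.negMulLog_mul]
    ring
  refine Summable.of_nonneg_of_le
    (fun x => Real.negMulLog_nonneg measureReal_nonneg measureReal_le_one) (fun x => ?_) (h1.add h2)
  rw [lazyStep_real_singleton, add_div]
  exact negMulLog_add_le (by positivity) (by positivity)

end Lazy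

/-! ### The conditional distribution of the first step given a later position -/

section BackwardProbability

variable {G : Type*} [Group G] [Countable G] [MeasurableSpace G] [MeasurableSingletonClass G]
  (ρ : Measure G) [IsProbabilityMeasure ρ]

/-- The probability that the first step is `g` given that the position at time `n + 1` is `y`. -/
def backProb (g : G) (n : ℕ) (y : G) : ℝ :=
  ρ.real {g} * (walkLaw ρ n).real {g⁻¹ * y} / (walkLaw ρ (n + 1)).real {y}

theorem mul_walkLaw_real_le (g : G) (n : ℕ) (y : G) :
    ρ.real {g} * (walkLaw ρ n).real {g⁻¹ * y} ≤ (walkLaw ρ (n + 1)).real {y} := by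
  have h := mul_walkLaw_le ρ 1 n g (g⁻¹ * y)
  rw [mul_inv_cancel_left, walkLaw_one, add_comm 1 n] at h
  rw [Measure.real, Measure.real, ← ENNReal.toReal_mul]
  exact ENNReal.toReal_mono (measure_ne_top _ _) h

theorem backProb_nonneg (g : G) (n : ℕ) (y : G) : 0 ≤ backProb ρ g n y := by
  unfold backProb; positivity

theorem backProb_le_one (g : G) (n : ℕ) (y : G) : backProb ρ g n y ≤ 1 :=
  div_le_one_of_le₀ (mul_walkLaw_real_le ρ g n y) measureReal_nonneg

theorem abs_backProb_le_one (g : G) (n : ℕ) (y : G) : |backProb ρ g n y| ≤ 1 := by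
  rw [abs_of_nonneg (backProb_nonneg ρ g n y)]; exact backProb_le_one ρ g n y

/-- Valid also at unreachable `y`, where the quotient is zero by convention and the right side
vanishes. -/
theorem mul_backProb (g : G) (n : ℕ) (y : G) : (walkLaw ρ (n + 1)).real {y} * backProb ρ g n y =
    ρ.real {g} * (walkLaw ρ n).real {g⁻¹ * y} := by
  rcases eq_or_ne ((walkLaw ρ (n + 1)).real {y}) 0 with h | h
  · have h1 := mul_walkLaw_real_le ρ g n y
    rw [h] at h1
    rw [h, zero_mul]
    exact (le_antisymm h1 (by positivity)).symm
  · rw [backProb, mul_div_cancel₀ _ h]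

theorem integral_walkLaw_add {F : G → ℝ} {C : ℝ} (hF : ∀ x, |F x| ≤ C) (m n : ℕ) :
    ∫ x, F x ∂walkLaw ρ (m + n) = ∫ x, ∫ y, F (x * y) ∂walkLaw ρ n ∂walkLaw ρ m := by
  rw [walkLaw_add, Measure.mconv, integral_map (measurable_of_countable _).aemeasurable
    (measurable_of_countable _).aestronglyMeasurable, integral_prod]
  exact Integrable.of_bound (measurable_of_countable _).aestronglyMeasurable C
    (Eventually.of_forall fun p => hF _)

/-- Both sides are the expectation of `F` at the position at time `n + 1` on the event that the
first step is `g`. -/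
theorem integral_backProb_mul (g : G) (n : ℕ) {F : G → ℝ} {C : ℝ} (hF : ∀ x, |F x| ≤ C) :
    ∫ y, backProb ρ g n y * F y ∂walkLaw ρ (n + 1) =
      ρ.real {g} * ∫ z, F (g * z) ∂walkLaw ρ n := by
  have hb : ∀ y, |backProb ρ g n y * F y| ≤ C := fun y => by
    rw [abs_mul]
    calc _ ≤ 1 * |F y| := by gcongr; exact abs_backProb_le_one ρ g n y
      _ ≤ C := by rw [one_mul]; exact hF y
  rw [integral_countable (integrable_of_abs_le_of_countable hb),
    integral_countable (integrable_of_abs_le_of_countable fun z => hF (g * z)), ← tsum_mul_left,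
    ← (Equiv.mulLeft g).tsum_eq]
  refine tsum_congr fun z => ?_
  simp only [Equiv.coe_mulLeft, smul_eq_mul]
  rw [← mul_assoc, mul_backProb, inv_mul_cancel_left, mul_assoc]

/-- Reverse martingale property. Given the position at time `n + 1`, later positions carry no
further information on the first step. -/
theorem integral_backProb_mul_integral (g : G) (n k : ℕ) {F : G → ℝ} {C : ℝ}
    (hF : ∀ x, |F x| ≤ C) :
    ∫ y, backProb ρ g n y * ∫ z, F (y * z) ∂walkLaw ρ k ∂walkLaw ρ (n + 1) =
      ∫ y, backProb ρ g (n + k) y * F y ∂walkLaw ρ (n + k + 1) := by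
  rw [integral_backProb_mul ρ g (n + k) hF,
    integral_backProb_mul ρ g n (fun y => abs_integral_le_of_abs_le fun z => hF (y * z)),
    integral_walkLaw_add ρ (fun x => hF (g * x))]
  simp only [mul_assoc]

theorem sq_integral_le {F : G → ℝ} {C : ℝ} (hF : ∀ x, |F x| ≤ C) :
    (∫ x, F x ∂ρ) ^ 2 ≤ ∫ x, F x ^ 2 ∂ρ := by
  have hsq : ∀ x, |F x ^ 2| ≤ C ^ 2 := fun x => by
    rw [abs_pow]; exact pow_le_pow_left₀ (abs_nonneg _) (hF x) 2
  have h1 := integrable_of_abs_le_of_countable (ρ := ρ) hF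
  have h2 := integrable_of_abs_le_of_countable (ρ := ρ) hsq
  set a := ∫ x, F x ∂ρ
  have h3 : 0 ≤ ∫ x, (F x - a) ^ 2 ∂ρ := integral_nonneg fun x => sq_nonneg _
  have h4 : ∫ x, (F x - a) ^ 2 ∂ρ = ∫ x, F x ^ 2 ∂ρ - 2 * a * a + a ^ 2 := by
    have e : ∀ x, (F x - a) ^ 2 = F x ^ 2 - 2 * a * F x + a ^ 2 := fun x => by ring
    simp only [e]
    rw [integral_add (f := fun x => F x ^ 2 - 2 * a * F x) (h2.sub (h1.const_mul _))
      (integrable_const _), integral_sub h2 (h1.const_mul _), integral_const_mul]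
    simp [a]
  nlinarith

/-- The second moment of `backProb`. -/
def backEnergy (g : G) (n : ℕ) : ℝ := ∫ y, backProb ρ g n y ^ 2 ∂walkLaw ρ (n + 1)

/-- Expand the square: the cross term equals the later energy by the reverse martingale property,
and Jensen's inequality bounds the square of the averaged term by the same energy. -/
theorem integral_sq_sub_le (g : G) (n k : ℕ) :
    ∫ y, (backProb ρ g n y - ∫ z, backProb ρ g (n + k) (y * z) ∂walkLaw ρ k) ^ 2
      ∂walkLaw ρ (n + 1) ≤ backEnergy ρ g n - backEnergy ρ g (n + k) := by
  let V : G → ℝ := fun y => ∫ z, backProb ρ g (n + k) (y * z) ∂walkLaw ρ k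
  have hV : ∀ y, |V y| ≤ 1 := fun y =>
    abs_integral_le_of_abs_le fun z => abs_backProb_le_one ρ g (n + k) _
  have hb2 : ∀ m y, |backProb ρ g m y ^ 2| ≤ 1 := fun m y => by
    rw [abs_pow]; exact pow_le_one₀ (abs_nonneg _) (abs_backProb_le_one ρ g m y)
  have hV2 : ∀ y, |V y ^ 2| ≤ 1 := fun y => by
    rw [abs_pow]; exact pow_le_one₀ (abs_nonneg _) (hV y)
  have hbV : ∀ y, |backProb ρ g n y * V y| ≤ 1 := fun y => by
    rw [abs_mul]; exact mul_le_one₀ (abs_backProb_le_one ρ g n y) (abs_nonneg _) (hV y)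
  have i1 := integrable_of_abs_le_of_countable (ρ := walkLaw ρ (n + 1)) (hb2 n)
  have i2 := integrable_of_abs_le_of_countable (ρ := walkLaw ρ (n + 1)) hV2
  have i3 := integrable_of_abs_le_of_countable (ρ := walkLaw ρ (n + 1)) hbV
  have e : ∀ y, (backProb ρ g n y - V y) ^ 2 =
      backProb ρ g n y ^ 2 - 2 * (backProb ρ g n y * V y) + V y ^ 2 := fun y => by ring
  have h1 : ∫ y, backProb ρ g n y * V y ∂walkLaw ρ (n + 1) = backEnergy ρ g (n + k) := by
    have := integral_backProb_mul_integral ρ g n k (abs_backProb_le_one ρ g (n + k))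
    simp only [← pow_two] at this
    exact this
  have h2 : ∫ y, V y ^ 2 ∂walkLaw ρ (n + 1) ≤ backEnergy ρ g (n + k) := by
    have h3 := integral_walkLaw_add ρ (hb2 (n + k)) (n + 1) k
    rw [backEnergy, show n + k + 1 = n + 1 + k by ring, h3]
    refine integral_mono i2 (integrable_of_abs_le_of_countable (C := 1) fun y =>
      abs_integral_le_of_abs_le fun z => hb2 (n + k) _) fun y => ?_
    exact sq_integral_le _ fun z => abs_backProb_le_one ρ g (n + k) _
  change ∫ y, (backProb ρ g n y - V y) ^ 2 ∂walkLaw ρ (n + 1) ≤ _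
  simp only [e]
  rw [integral_add (f := fun y => backProb ρ g n y ^ 2 - 2 * (backProb ρ g n y * V y))
    (i1.sub (i3.const_mul 2)) i2, integral_sub i1 (i3.const_mul 2), integral_const_mul, h1]
  have : backEnergy ρ g n = ∫ y, backProb ρ g n y ^ 2 ∂walkLaw ρ (n + 1) := rfl
  linarith

theorem backEnergy_antitone (g : G) : Antitone (backEnergy ρ g) :=
  antitone_nat_of_succ_le fun n => by
    have h := integral_sq_sub_le ρ g n 1
    have h2 : 0 ≤ ∫ y, (backProb ρ g n y - ∫ z, backProb ρ g (n + 1) (y * z) ∂walkLaw ρ 1) ^ 2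
      ∂walkLaw ρ (n + 1) := integral_nonneg fun y => sq_nonneg _
    linarith

theorem backEnergy_nonneg (g : G) (n : ℕ) : 0 ≤ backEnergy ρ g n :=
  integral_nonneg fun _ => sq_nonneg _

/-- The laws at consecutive times are asymptotically equal in total variation. -/
def IsAsymptoticallyInvariant : Prop :=
  ∃ δ : ℕ → ℝ, Tendsto δ atTop (𝓝 0) ∧ ∀ (n : ℕ) (F : G → ℝ), (∀ x, |F x| ≤ 1) →
    |∫ x, F x ∂walkLaw ρ (n + 1) - ∫ x, F x ∂walkLaw ρ n| ≤ δ n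

theorem isAsymptoticallyInvariant_lazyStep : IsAsymptoticallyInvariant (lazyStep ρ) :=
  ⟨fun n => 1 / √(n + 1 : ℕ), tendsto_div_sqrt_succ 1,
    fun n _ hF => abs_integral_lazyStep_sub_le ρ hF n⟩

variable {ρ}

theorem IsAsymptoticallyInvariant.exists_bound (h : IsAsymptoticallyInvariant ρ) (n : ℕ) :
    ∃ δ : ℕ → ℝ, Tendsto δ atTop (𝓝 0) ∧ ∀ (k : ℕ) (F : G → ℝ), (∀ x, |F x| ≤ 1) →
      |∫ x, F x ∂walkLaw ρ (n + k) - ∫ x, F x ∂walkLaw ρ k| ≤ δ k := by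
  obtain ⟨δ, hδ, hb⟩ := h
  induction n with
  | zero => exact ⟨0, tendsto_const_nhds, fun k F _ => by simp⟩
  | succ n ih =>
    obtain ⟨e, he, hb'⟩ := ih
    refine ⟨fun k => δ (n + k) + e k, ?_, fun k F hF => ?_⟩
    · have : Tendsto (fun k => δ (n + k)) atTop (𝓝 0) :=
        hδ.comp (tendsto_atTop_mono (fun k => Nat.le_add_left k n) tendsto_id)
      simpa using this.add he
    · rw [show n + 1 + k = n + k + 1 by ring]
      exact (abs_sub_le _ (∫ x, F x ∂walkLaw ρ (n + k)) _).trans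
        (add_le_add (hb (n + k) F hF) (hb' k F hF))

/-- The conditional probabilities `backProb` converge to a bounded harmonic function. -/
theorem IsAsymptoticallyInvariant.exists_harmonic (h : IsAsymptoticallyInvariant ρ) (g : G) :
    ∃ u : G → ℝ, (∀ y, 0 ≤ u y) ∧ (∀ y, u y ≤ 1) ∧ (∀ y, ∫ x, u (y * x) ∂ρ = u y) ∧
      Tendsto (fun n => ∫ y, (backProb ρ g n y - u y) ^ 2 ∂walkLaw ρ (n + 1)) atTop (𝓝 0) := by
  -- Averaging over `m` further steps from `y` makes the function almost harmonic. A pointwise limit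
  -- along a subsequence exists by compactness of a product of intervals.
  let W : ℕ → G → ℝ := fun m y => ∫ z, backProb ρ g m (y * z) ∂walkLaw ρ m
  have hW0 : ∀ m y, 0 ≤ W m y := fun m y => integral_nonneg fun z => backProb_nonneg ρ g m _
  have hWa : ∀ m y, |W m y| ≤ 1 := fun m y =>
    abs_integral_le_of_abs_le fun z => abs_backProb_le_one ρ g m _
  have hWmem : ∀ m, W m ∈ Set.pi Set.univ fun _ : G => Set.Icc (0 : ℝ) 1 := fun m y _ =>
    ⟨hW0 m y, (le_abs_self _).trans (hWa m y)⟩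
  obtain ⟨u, hu, φ, hφ, hlim⟩ :=
    (isCompact_univ_pi fun _ : G => isCompact_Icc (a := (0 : ℝ)) (b := 1)).tendsto_subseq hWmem
  rw [tendsto_pi_nhds] at hlim
  have hu0 : ∀ y, 0 ≤ u y := fun y => (hu y trivial).1
  have hu1 : ∀ y, u y ≤ 1 := fun y => (hu y trivial).2
  refine ⟨u, hu0, hu1, fun y => ?_, ?_⟩
  · obtain ⟨δ, hδ, hb⟩ := h
    have h1 : Tendsto (fun j => ∫ x, W (φ j) (y * x) ∂ρ) atTop (𝓝 (∫ x, u (y * x) ∂ρ)) :=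
      tendsto_integral_of_dominated_convergence (fun _ => 1)
        (fun j => (measurable_of_countable _).aestronglyMeasurable) (integrable_const _)
        (fun j => Eventually.of_forall fun x => hWa _ _)
        (Eventually.of_forall fun x => hlim (y * x))
    have h2 : ∀ m, ∫ x, W m (y * x) ∂ρ = ∫ w, backProb ρ g m (y * w) ∂walkLaw ρ (m + 1) := by
      intro m
      rw [add_comm m 1, integral_walkLaw_add ρ (fun w => abs_backProb_le_one ρ g m (y * w)),
        walkLaw_one]
      simp only [W, mul_assoc]
    -- One more averaging step only replaces the law at time `m` by the law at time `m + 1`, which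
    -- is asymptotically the same in total variation.
    have h3 : Tendsto (fun j => ∫ x, W (φ j) (y * x) ∂ρ - W (φ j) y) atTop (𝓝 0) := by
      refine squeeze_zero_norm (fun j => ?_) (hδ.comp hφ.tendsto_atTop)
      rw [h2]
      exact hb (φ j) _ fun x => abs_backProb_le_one ρ g _ _
    have h4 := h3.add (hlim y)
    simp only [Function.comp, sub_add_cancel, zero_add] at h4
    exact tendsto_nhds_unique h1 h4
  · have hbdd : BddBelow (Set.range (backEnergy ρ g)) :=
      ⟨0, by rintro _ ⟨n, rfl⟩; exact backEnergy_nonneg ρ g n⟩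
    have hs := tendsto_atTop_ciInf (backEnergy_antitone ρ g) hbdd
    set s := ⨅ n, backEnergy ρ g n
    have hs' : Tendsto (fun n => backEnergy ρ g n - s) atTop (𝓝 0) := by
      simpa using hs.sub_const s
    refine squeeze_zero (fun n => integral_nonneg fun y => sq_nonneg _) (fun n => ?_) hs'
    obtain ⟨δ, hδ, hb⟩ := h.exists_bound n
    -- For `k = φ j - n` this differs from `W (φ j)` only in averaging over `k` instead of `n + k`
    -- steps, so it has the same limit `u`; it is the term compared with `backProb` in
    -- `integral_sq_sub_le`.
    let V : ℕ → G → ℝ := fun k y => ∫ z, backProb ρ g (n + k) (y * z) ∂walkLaw ρ k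
    have hVa : ∀ k y, |V k y| ≤ 1 := fun k y =>
      abs_integral_le_of_abs_le fun z => abs_backProb_le_one ρ g (n + k) _
    have hφn : Tendsto (fun j => φ j - n) atTop atTop :=
      (tendsto_sub_atTop_nat n).comp hφ.tendsto_atTop
    have hV : ∀ y, Tendsto (fun j => V (φ j - n) y) atTop (𝓝 (u y)) := by
      intro y
      have h1 : Tendsto (fun j => W (n + (φ j - n)) y - V (φ j - n) y) atTop (𝓝 0) :=
        squeeze_zero_norm (fun j => hb (φ j - n) (fun z => backProb ρ g (n + (φ j - n)) (y * z))
          fun z => abs_backProb_le_one ρ g _ _) (hδ.comp hφn)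
      have h2 : Tendsto (fun j => W (n + (φ j - n)) y) atTop (𝓝 (u y)) := by
        refine (hlim y).congr' ?_
        filter_upwards [hφ.tendsto_atTop.eventually (eventually_ge_atTop n)] with j hj
        simp only [Function.comp]
        rw [Nat.add_sub_cancel' hj]
      simpa using h2.sub h1
    have hle : ∀ j, ∫ y, (backProb ρ g n y - V (φ j - n) y) ^ 2 ∂walkLaw ρ (n + 1) ≤
        backEnergy ρ g n - s := fun j =>
      (integral_sq_sub_le ρ g n (φ j - n)).trans (sub_le_sub_left (ciInf_le hbdd _) _)
    refine le_of_tendsto (tendsto_integral_of_dominated_convergence (fun _ => (4 : ℝ))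
      (F := fun j y => (backProb ρ g n y - V (φ j - n) y) ^ 2)
      (fun j => (measurable_of_countable _).aestronglyMeasurable) (integrable_const _)
      (fun j => Eventually.of_forall fun y => ?_)
      (Eventually.of_forall fun y => ((hV y).const_sub _).pow 2)) (Eventually.of_forall hle)
    rw [norm_pow, show (4 : ℝ) = 2 ^ 2 by norm_num]
    refine pow_le_pow_left₀ (norm_nonneg _) ?_ 2
    exact (norm_sub_le _ _).trans (by
      have := abs_backProb_le_one ρ g n y
      have := hVa (φ j - n) y
      simp only [Real.norm_eq_abs]; linarith)

/-- Nearby points are handled by uniform continuity, distant ones by boundedness. It turns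
mean-square closeness into closeness after applying a continuous function. -/
theorem exists_abs_sub_le_add_mul_sq {ψ : ℝ → ℝ} (hψ : ContinuousOn ψ (Set.Icc 0 1)) {ε : ℝ}
    (hε : 0 < ε) : ∃ C, ∀ a ∈ Set.Icc (0 : ℝ) 1, ∀ b ∈ Set.Icc (0 : ℝ) 1,
      |ψ a - ψ b| ≤ ε + C * (a - b) ^ 2 := by
  obtain ⟨M, hM⟩ := isCompact_Icc.exists_bound_of_continuousOn hψ
  have hM0 : 0 ≤ M := (norm_nonneg _).trans (hM 0 (by simp))
  obtain ⟨δ, hδ, hu⟩ := Metric.uniformContinuousOn_iff.1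
    (isCompact_Icc.uniformContinuousOn_of_continuous hψ) ε hε
  refine ⟨2 * M / δ ^ 2, fun a ha b hb => ?_⟩
  rcases lt_or_ge (dist a b) δ with h | h
  · have := hu a ha b hb h
    rw [Real.dist_eq] at this
    have : 0 ≤ 2 * M / δ ^ 2 * (a - b) ^ 2 := by positivity
    linarith
  · rw [Real.dist_eq] at h
    have h1 : |ψ a - ψ b| ≤ 2 * M := by
      have h2 := hM a ha
      have h3 := hM b hb
      simp only [Real.norm_eq_abs] at h2 h3
      exact (abs_sub _ _).trans (by linarith)
    have h4 : δ ^ 2 ≤ (a - b) ^ 2 := by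
      rw [← sq_abs (a - b)]; exact pow_le_pow_left₀ hδ.le h 2
    have h5 : 2 * M ≤ 2 * M / δ ^ 2 * (a - b) ^ 2 := by
      rw [div_mul_eq_mul_div, le_div_iff₀ (by positivity)]
      gcongr
    linarith

theorem tendsto_integral_mul_comp_sub {v : ℕ → G → ℝ} {u : G → ℝ}
    (hv : ∀ n y, v n y ∈ Set.Icc (0 : ℝ) 1) (hu : ∀ y, u y ∈ Set.Icc (0 : ℝ) 1)
    {κ : ℕ → Measure G} [∀ n, IsProbabilityMeasure (κ n)]
    (h : Tendsto (fun n => ∫ y, (v n y - u y) ^ 2 ∂κ n) atTop (𝓝 0))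
    {F : G → ℝ} (hF : ∀ y, |F y| ≤ 1) {ψ : ℝ → ℝ} (hψ : ContinuousOn ψ (Set.Icc 0 1)) :
    Tendsto (fun n => ∫ y, F y * ψ (v n y) ∂κ n - ∫ y, F y * ψ (u y) ∂κ n) atTop (𝓝 0) := by
  obtain ⟨M, hM⟩ := isCompact_Icc.exists_bound_of_continuousOn hψ
  have hi : ∀ (w : G → ℝ), (∀ y, w y ∈ Set.Icc (0 : ℝ) 1) → ∀ n,
      Integrable (fun y => F y * ψ (w y)) (κ n) := fun w hw n =>
    integrable_of_abs_le_of_countable (C := 1 * M) fun y => by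
      rw [abs_mul]
      exact mul_le_mul (hF y) (hM _ (hw y)) (abs_nonneg _) zero_le_one
  refine Metric.tendsto_atTop.2 fun ε hε => ?_
  obtain ⟨C, hC⟩ := exists_abs_sub_le_add_mul_sq hψ (half_pos hε)
  have hlim : Tendsto (fun n => ε / 2 + C * ∫ y, (v n y - u y) ^ 2 ∂κ n) atTop (𝓝 (ε / 2)) := by
    simpa using (h.const_mul C).const_add (ε / 2)
  obtain ⟨N, hN⟩ := eventually_atTop.1 (hlim.eventually (gt_mem_nhds (half_lt_self hε)))
  refine ⟨N, fun n hn => ?_⟩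
  rw [Real.dist_eq, sub_zero, ← integral_sub (hi _ (hv n) n) (hi _ hu n)]
  refine lt_of_le_of_lt ?_ (hN n hn)
  have hsq : Integrable (fun y => (v n y - u y) ^ 2) (κ n) :=
    integrable_of_abs_le_of_countable (C := 1) fun y => by
      rw [abs_pow]
      refine pow_le_one₀ (abs_nonneg _) (abs_le.2 ⟨?_, ?_⟩) <;>
        linarith [(hv n y).1, (hv n y).2, (hu y).1, (hu y).2]
  calc |∫ y, (F y * ψ (v n y) - F y * ψ (u y)) ∂κ n|
      ≤ ∫ y, (ε / 2 + C * (v n y - u y) ^ 2) ∂κ n := by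
        refine norm_integral_le_of_norm_le (f := fun y => F y * ψ (v n y) - F y * ψ (u y))
          (g := fun y => ε / 2 + C * (v n y - u y) ^ 2) ((integrable_const _).add (hsq.const_mul C))
          (Eventually.of_forall fun y => ?_)
        rw [← mul_sub, norm_mul]
        calc ‖F y‖ * ‖ψ (v n y) - ψ (u y)‖ ≤ 1 * ‖ψ (v n y) - ψ (u y)‖ := by
              gcongr; exact hF y
          _ ≤ _ := by rw [one_mul]; exact hC _ (hv n y) _ (hu y)
    _ = _ := by
        rw [integral_add (integrable_const _) (hsq.const_mul C), integral_const_mul]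
        simp

end BackwardProbability

/-! ### Bounded harmonic functions along sample paths -/

section Harmonic

variable {G : Type*} [Group G] [Countable G] [MeasurableSpace G] [MeasurableSingletonClass G]
  (μ : Measure G) [IsProbabilityMeasure μ]

theorem integral_stopAt_incrShift (m : ℕ) {F : (ℕ → G) × (ℕ → G) → ℝ} (hF : Measurable F) {C : ℝ}
    (hC : ∀ p, |F p| ≤ C) :
    ∫ ω, F (stopAt m ω, incrShift m ω) ∂pathMeasure μ =
      ∫ ω, ∫ ω', F (stopAt m ω, ω') ∂pathMeasure μ ∂pathMeasure μ := by
  have hm : Measurable fun ω : ℕ → G => (stopAt m ω, incrShift m ω) := by fun_prop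
  have : IsProbabilityMeasure ((pathMeasure μ).map (stopAt m)) :=
    Measure.isProbabilityMeasure_map (by fun_prop)
  rw [← integral_map (f := F) hm.aemeasurable hF.aestronglyMeasurable,
    map_stopAt_prodMk_incrShift, integral_prod _ (Integrable.of_bound hF.aestronglyMeasurable C
      (Eventually.of_forall hC)), integral_map (by fun_prop)]
  exact (StronglyMeasurable.integral_prod_right (f := fun x y => F (x, y))
    hF.stronglyMeasurable).aestronglyMeasurable

theorem integral_walkLaw (n : ℕ) (F : G → ℝ) :
    ∫ x, F x ∂walkLaw μ n = ∫ ω, F (ω n) ∂pathMeasure μ :=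
  integral_map (measurable_pi_apply n).aemeasurable
    (measurable_of_countable F).aestronglyMeasurable

/-- The filtration of the path space generated by the initial segments of paths. -/
def pathFiltration (G : Type*) [Group G] [Countable G] [MeasurableSpace G]
    [MeasurableSingletonClass G] : Filtration ℕ (inferInstance : MeasurableSpace (ℕ → G)) where
  seq n := MeasurableSpace.comap (stopAt n) inferInstance
  mono' m n hmn := by
    have h : (stopAt m : (ℕ → G) → ℕ → G) = stopAt m ∘ stopAt n := by
      funext ω k; simp only [stopAt, Function.comp]; congr 1; omega
    change MeasurableSpace.comap (stopAt m) _ ≤ MeasurableSpace.comap (stopAt n) _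
    rw [h, ← MeasurableSpace.comap_comp]
    exact MeasurableSpace.comap_mono (Measurable.comap_le (by fun_prop))
  le' n := Measurable.comap_le (by fun_prop)

variable {u : G → ℝ} (hu0 : ∀ y, 0 ≤ u y) (hu1 : ∀ y, u y ≤ 1)
  (hu : ∀ y, ∫ x, u (y * x) ∂μ = u y)

theorem measurable_comp_apply (u : G → ℝ) (k : ℕ) : Measurable fun ω : ℕ → G => u (ω k) :=
  (measurable_of_countable u).comp (measurable_pi_apply k)

include hu0 hu1 hu

theorem martingale_harmonic :
    Martingale (fun k (ω : ℕ → G) => u (ω k)) (pathFiltration G) (pathMeasure μ) := by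
  have hua : ∀ y, |u y| ≤ 1 := fun y => by rw [abs_of_nonneg (hu0 y)]; exact hu1 y
  refine martingale_of_setIntegral_eq_succ (fun k => ?_) (fun k => ?_) fun k s hs => ?_
  · refine Measurable.stronglyMeasurable ?_
    have : (fun ω : ℕ → G => u (ω k)) = (fun ω => u (ω k)) ∘ stopAt k := by
      funext ω; simp [stopAt]
    rw [this]
    exact (measurable_comp_apply u k).comp (comap_measurable _)
  · exact Integrable.of_bound (measurable_comp_apply u k).aestronglyMeasurable 1
      (Eventually.of_forall fun ω => hua _)
  · obtain ⟨A, hA, rfl⟩ := hs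
    have hs : MeasurableSet (stopAt k ⁻¹' A : Set (ℕ → G)) := measurable_stopAt k hA
    rw [← integral_indicator hs, ← integral_indicator hs]
    let F : (ℕ → G) × (ℕ → G) → ℝ := fun p => A.indicator (fun _ => u (p.1 k * p.2 1)) p.1
    have hF : Measurable F := by
      have h1 : Measurable fun p : (ℕ → G) × (ℕ → G) => u (p.1 k * p.2 1) :=
        (measurable_of_countable fun q : G × G => u (q.1 * q.2)).comp
          (g := fun q : G × G => u (q.1 * q.2))
          (f := fun p : (ℕ → G) × (ℕ → G) => (p.1 k, p.2 1)) (by fun_prop)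
      exact h1.indicator (measurable_fst hA)
    have hFa : ∀ p, |F p| ≤ 1 := fun p => by
      by_cases h : p.1 ∈ A <;> simp [F, h, hua]
    have h := integral_stopAt_incrShift μ k hF hFa
    have e1 : ∀ ω : ℕ → G, F (stopAt k ω, incrShift k ω) =
        (stopAt k ⁻¹' A).indicator (fun ω => u (ω (k + 1))) ω := by
      intro ω
      by_cases hω : stopAt k ω ∈ A
      · simp only [F, hω, Set.indicator_of_mem, Set.mem_preimage]
        congr 1
        rw [← mul_incrShift k 1 ω]; simp [stopAt]
      · simp [F, hω]
    have e2 : ∀ ω : ℕ → G, ∫ ω', F (stopAt k ω, ω') ∂pathMeasure μ =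
        (stopAt k ⁻¹' A).indicator (fun ω => u (ω k)) ω := by
      intro ω
      by_cases hω : stopAt k ω ∈ A
      · simp only [F, hω, Set.indicator_of_mem, Set.mem_preimage]
        rw [← integral_walkLaw μ 1 (fun x => u (stopAt k ω k * x)), walkLaw_one, hu]
        simp [stopAt]
      · simp [F, hω]
    simp only [e1, e2] at h
    exact h.symm

/-- Martingale convergence. The limit is written as a `limsup`, which is defined for every path and
is exactly shift-invariant. -/
theorem ae_tendsto_harmonic : ∀ᵐ ω ∂pathMeasure μ,
    Tendsto (fun k => u (ω k)) atTop (𝓝 (limsup (fun k => u (ω k)) atTop)) := by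
  have hM := martingale_harmonic μ hu0 hu1 hu
  have hbdd : ∀ n, eLpNorm (fun ω : ℕ → G => u (ω n)) 1 (pathMeasure μ) ≤ (1 : NNReal) := by
    intro n
    rw [eLpNorm_one_eq_lintegral_enorm]
    calc _ ≤ ∫⁻ _, 1 ∂pathMeasure μ := by
          refine lintegral_mono fun ω => ?_
          rw [Real.enorm_of_nonneg (hu0 _)]
          exact ENNReal.ofReal_le_one.2 (hu1 _)
      _ = _ := by simp
  filter_upwards [hM.submartingale.ae_tendsto_limitProcess hbdd] with ω hω
  rwa [hω.limsup_eq]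

end Harmonic

/-! ### Maximal boundary maps and limits of backward probabilities -/

section Boundary

variable {G : Type*} [Group G] [Countable G] [MeasurableSpace G] [MeasurableSingletonClass G]
  {B : Type*} [MeasurableSpace B] [MulAction G B] [MeasurableConstSMul G B]
  {μ : Measure G} [IsProbabilityMeasure μ] {Φ : (ℕ → G) → B}

/-- Every shift-invariant set is a preimage under `Φ` modulo null sets. -/
def IsMaximalMap (μ : Measure G) (Φ : (ℕ → G) → B) : Prop :=
  ∀ A : Set (ℕ → G), MeasurableSet[invariantAlgebra G] A →
    ∃ S : Set B, MeasurableSet S ∧ Φ ⁻¹' S =ᵐ[pathMeasure μ] A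

theorem IsBoundaryMap.integral_apply (hΦ : IsBoundaryMap μ Φ) (n : ℕ) {F : G × B → ℝ}
    (hF : Measurable F) {C : ℝ} (hC : ∀ p, |F p| ≤ C) :
    ∫ ω, F (ω n, Φ ω) ∂pathMeasure μ =
      ∫ x, ∫ b, F (x, x • b) ∂harmonicMeasure μ Φ ∂walkLaw μ n := by
  have := isProbabilityMeasure_harmonicMeasure μ hΦ.measurable
  have hm : Measurable fun ω : ℕ → G => (ω n, Φ ω) := (measurable_pi_apply n).prodMk hΦ.measurable
  have hs : Measurable fun p : G × B => (p.1, p.1 • p.2) :=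
    measurable_fst.prodMk measurable_smul_of_countable
  have h : (pathMeasure μ).map (fun ω => (ω n, Φ ω)) =
      ((walkLaw μ n).prod (harmonicMeasure μ Φ)).map fun p => (p.1, p.1 • p.2) := by
    refine Measure.ext_of_lintegral _ fun f hf => ?_
    rw [lintegral_map hf hm, hΦ.lintegral_apply n hf, lintegral_map hf hs,
      lintegral_prod (fun p : G × B => f (p.1, p.1 • p.2)) (hf.comp hs).aemeasurable]
  rw [← integral_map (f := F) hm.aemeasurable hF.aestronglyMeasurable, h,
    integral_map hs.aemeasurable hF.aestronglyMeasurable,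
    integral_prod (fun p : G × B => F (p.1, p.1 • p.2))
      (Integrable.of_bound (hF.comp hs).aestronglyMeasurable C (Eventually.of_forall fun p => hC _))]

/-- A function is determined by its integrals over the preimages of a maximal map, provided that
it is shift-invariant. -/
theorem ae_eq_comp_of_setIntegral_eq (hΦ : Measurable Φ) (hmax : IsMaximalMap μ Φ)
    {v : (ℕ → G) → ℝ} (hv : Measurable v) (hinv : ∀ ω, v (timeShift ω) = v ω)
    (hvi : Integrable v (pathMeasure μ)) {w : B → ℝ} (hw : Measurable w)
    (hwi : Integrable (fun ω => w (Φ ω)) (pathMeasure μ))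
    (h : ∀ S, MeasurableSet S →
      ∫ ω in Φ ⁻¹' S, v ω ∂pathMeasure μ = ∫ ω in Φ ⁻¹' S, w (Φ ω) ∂pathMeasure μ) :
    ∀ᵐ ω ∂pathMeasure μ, v ω = w (Φ ω) := by
  -- A difference of strict sign on a preimage, with zero integral there, forces the preimage to be
  -- null.
  have key : ∀ S : Set B, MeasurableSet S → ∀ ε : ℝ,
      (∀ᵐ ω ∂pathMeasure μ, Φ ω ∈ S → 0 < ε * (v ω - w (Φ ω))) →
      ∀ᵐ ω ∂pathMeasure μ, Φ ω ∉ S := by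
    intro S hS ε hpos
    have hA : MeasurableSet (Φ ⁻¹' S) := hΦ hS
    have hi : Integrable (fun ω => ε * (v ω - w (Φ ω))) ((pathMeasure μ).restrict (Φ ⁻¹' S)) :=
      ((hvi.sub hwi).const_mul ε).restrict
    have hpos' : ∀ᵐ ω ∂(pathMeasure μ).restrict (Φ ⁻¹' S), 0 < ε * (v ω - w (Φ ω)) := by
      rw [ae_restrict_iff' hA]; exact hpos
    have h0 : ∫ ω in Φ ⁻¹' S, ε * (v ω - w (Φ ω)) ∂pathMeasure μ = 0 := by
      rw [integral_const_mul, integral_sub hvi.restrict hwi.restrict, h S hS, sub_self, mul_zero]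
    have hz := (integral_eq_zero_iff_of_nonneg_ae (hpos'.mono fun ω h => h.le) hi).1 h0
    have hf : ∀ᵐ ω ∂(pathMeasure μ).restrict (Φ ⁻¹' S), False := by
      filter_upwards [hz, hpos'] with ω h1 h2
      rw [h1] at h2
      exact lt_irrefl _ h2
    rw [ae_restrict_iff' hA] at hf
    exact hf
  -- The level sets of the invariant function `v` are preimages by maximality, so `key` shows that
  -- no rational separates `v` from `w ∘ Φ`.
  have hq : ∀ q : ℚ, ∀ᵐ ω ∂pathMeasure μ, ¬ ((q : ℝ) < v ω ∧ w (Φ ω) < q) ∧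
      ¬ (v ω ≤ q ∧ (q : ℝ) < w (Φ ω)) := by
    intro q
    have hA : MeasurableSet[invariantAlgebra G] {ω | (q : ℝ) < v ω} :=
      ⟨measurableSet_lt measurable_const hv, by ext ω; simp [hinv]⟩
    obtain ⟨S, hS, hSA⟩ := hmax _ hA
    have hmem : ∀ᵐ ω ∂pathMeasure μ, Φ ω ∈ S ↔ (q : ℝ) < v ω := hSA.mem_iff
    have h1 := key (S ∩ {b | w b < q}) (hS.inter (measurableSet_lt hw measurable_const)) 1 (by
      filter_upwards [hmem] with ω hω
      rintro ⟨h1, h2⟩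
      have h3 := hω.1 h1
      have h2 : w (Φ ω) < q := h2
      linarith)
    have h2 := key (Sᶜ ∩ {b | (q : ℝ) < w b}) (hS.compl.inter
        (measurableSet_lt measurable_const hw)) (-1) (by
      filter_upwards [hmem] with ω hω
      rintro ⟨h1, h2⟩
      have h3 := not_lt.1 (mt hω.2 h1)
      have h2 : (q : ℝ) < w (Φ ω) := h2
      linarith)
    filter_upwards [hmem, h1, h2] with ω hω h1 h2
    refine ⟨fun h => h1 ⟨hω.2 h.1, h.2⟩, fun h => h2 ⟨fun h' => ?_, h.2⟩⟩
    exact absurd (hω.1 h') (not_lt.2 h.1)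
  filter_upwards [ae_all_iff.2 hq] with ω hω
  rcases lt_trichotomy (v ω) (w (Φ ω)) with hlt | heq | hlt
  · obtain ⟨q, h1, h2⟩ := exists_rat_btwn hlt
    exact absurd ⟨h1.le, h2⟩ (hω q).2
  · exact heq
  · obtain ⟨q, h1, h2⟩ := exists_rat_btwn hlt
    exact absurd ⟨h2, h1⟩ (hω q).1

theorem integral_walkLaw_of_harmonic {ρ : Measure G} [IsProbabilityMeasure ρ] {f : G → ℝ} {C : ℝ}
    (hC : ∀ y, |f y| ≤ C) (hf : ∀ y, ∫ x, f (y * x) ∂ρ = f y) (n : ℕ) (y : G) :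
    ∫ x, f (y * x) ∂walkLaw ρ n = f y := by
  induction n generalizing y with
  | zero => rw [walkLaw_zero, integral_dirac, mul_one]
  | succ n ih =>
    rw [integral_walkLaw_add ρ (fun x => hC (y * x)), walkLaw_one]
    simp only [← mul_assoc, hf, ih]

/-- It follows that a bounded function is harmonic for the lazy step exactly when it is harmonic for
`μ`. -/
theorem integral_lazyStep {F : G → ℝ} {C : ℝ} (hF : ∀ y, |F y| ≤ C) :
    ∫ x, F x ∂lazyStep μ = (F 1 + ∫ x, F x ∂μ) / 2 := by
  have h := isAveragingArray_integral_lazyLaw μ hF 0 0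
  simp only [lazyLaw_zero_right, lazyLaw_zero_left, zero_add, walkLaw_one, walkLaw_zero,
    integral_dirac] at h
  exact h

/-- The measure of the translates of a set is a harmonic function. -/
theorem IsBoundaryMap.integral_harmonicMeasure (hΦ : IsBoundaryMap μ Φ) {S : Set B}
    (hS : MeasurableSet S) (y : G) :
    ∫ x, ((harmonicMeasure μ Φ).map ((y * x) • ·)).real S ∂μ =
      ((harmonicMeasure μ Φ).map (y • ·)).real S := by
  have := isProbabilityMeasure_harmonicMeasure μ hΦ.measurable
  have hm : MeasurableSet ((y • · : B → B) ⁻¹' S) := measurable_const_smul y hS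
  have h := hΦ.integral_apply 1 (F := fun p => ((y • · : B → B) ⁻¹' S).indicator 1 p.2) (C := 1)
    ((measurable_one.indicator hm).comp measurable_snd) (fun p => by
      by_cases h : y • p.2 ∈ S <;> simp [h])
  rw [walkLaw_one] at h
  have e1 : ∫ ω, ((y • · : B → B) ⁻¹' S).indicator (1 : B → ℝ) (Φ ω) ∂pathMeasure μ =
      ((harmonicMeasure μ Φ).map (y • ·)).real S := by
    rw [map_measureReal_apply (measurable_const_smul y) hS, ← integral_indicator_one hm,
      harmonicMeasure, integral_map hΦ.measurable.aemeasurable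
        (measurable_one.indicator hm).aestronglyMeasurable]
  have e2 : ∀ x : G, ∫ b, ((y • · : B → B) ⁻¹' S).indicator (1 : B → ℝ) (x • b)
      ∂harmonicMeasure μ Φ = ((harmonicMeasure μ Φ).map ((y * x) • ·)).real S := by
    intro x
    have hm' : MeasurableSet (((y * x) • · : B → B) ⁻¹' S) := measurable_const_smul _ hS
    rw [map_measureReal_apply (measurable_const_smul _) hS, ← integral_indicator_one hm']
    congr 1
    funext b
    by_cases h : (y * x) • b ∈ S
    · have h' : y • x • b ∈ S := by rwa [← mul_smul]
      simp [h, h']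
    · have h' : y • x • b ∉ S := by rwa [← mul_smul]
      simp [h, h']
  simp only [e1, e2] at h
  exact h.symm

theorem IsBoundaryMap.setIntegral_boundaryDensity (hΦ : IsBoundaryMap μ Φ) {n : ℕ} {x : G}
    (hx : walkLaw μ n {x} ≠ 0) (S : Set B) :
    ∫ b in S, (boundaryDensity (harmonicMeasure μ Φ) b x).toReal ∂harmonicMeasure μ Φ =
      ((harmonicMeasure μ Φ).map (x • ·)).real S := by
  have := isProbabilityMeasure_harmonicMeasure μ hΦ.measurable
  exact Measure.setIntegral_toReal_rnDeriv (hΦ.map_smul_absolutelyContinuous hx) S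

theorem lazyStep_reachable {g : G} (hg : (lazyStep μ).real {g} ≠ 0) :
    ∃ n, walkLaw μ n {g} ≠ 0 := by
  by_contra! h
  have h0 := h 0
  have h1 := h 1
  rw [walkLaw_zero] at h0
  rw [walkLaw_one] at h1
  exact hg (by rw [lazyStep_real_singleton, Measure.real, Measure.real, h0, h1]; simp)

theorem IsBoundaryMap.integrable_boundaryDensity (hΦ : IsBoundaryMap μ Φ) (x : G) :
    Integrable (fun b => (boundaryDensity (harmonicMeasure μ Φ) b x).toReal)
      (harmonicMeasure μ Φ) := by
  have := isProbabilityMeasure_harmonicMeasure μ hΦ.measurable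
  exact Measure.integrable_toReal_rnDeriv

/-- For a maximal boundary the conditional probabilities of the first step of the lazy walk
converge in distribution to the conditional probabilities with respect to the boundary. -/
theorem IsBoundaryMap.tendsto_integral_backProb (hΦ : IsBoundaryMap μ Φ)
    (hmax : IsMaximalMap μ Φ) {ψ : ℝ → ℝ} (hψ : Continuous ψ) (g : G) :
    Tendsto (fun n => ∫ y, ψ (backProb (lazyStep μ) g n y) ∂walkLaw (lazyStep μ) (n + 1)) atTop
      (𝓝 (∫ b, ψ ((lazyStep μ).real {g} * (boundaryDensity (harmonicMeasure μ Φ) b g).toReal)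
        ∂harmonicMeasure μ Φ)) := by
  have := isProbabilityMeasure_harmonicMeasure μ hΦ.measurable
  set lam := harmonicMeasure μ Φ with hlam
  obtain ⟨u, hu0, hu1, hu, hlim⟩ := (isAsymptoticallyInvariant_lazyStep μ).exists_harmonic g
  have hua : ∀ y, |u y| ≤ 1 := fun y => by rw [abs_of_nonneg (hu0 y)]; exact hu1 y
  have huμ : ∀ y, ∫ x, u (y * x) ∂μ = u y := fun y => by
    have h := hu y
    rw [integral_lazyStep (fun x => hua (y * x)), mul_one] at h
    linarith
  have hconv := ae_tendsto_harmonic μ hu0 hu1 huμ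
  let v : (ℕ → G) → ℝ := fun ω => limsup (fun k => u (ω k)) atTop
  have hvm : Measurable v := Measurable.limsup fun k => measurable_comp_apply u k
  have hvinv : ∀ ω, v (timeShift ω) = v ω := fun ω => limsup_nat_add (fun k => u (ω k)) 1
  have hv01 : ∀ᵐ ω ∂pathMeasure μ, v ω ∈ Set.Icc (0 : ℝ) 1 := by
    filter_upwards [hconv] with ω hω
    exact ⟨ge_of_tendsto' hω fun k => hu0 _, le_of_tendsto' hω fun k => hu1 _⟩
  have hvi : Integrable v (pathMeasure μ) := by
    refine Integrable.of_bound hvm.aestronglyMeasurable 1 ?_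
    filter_upwards [hv01] with ω hω
    rw [Real.norm_eq_abs, abs_of_nonneg hω.1]; exact hω.2
  let w : B → ℝ := fun b => (lazyStep μ).real {g} * (boundaryDensity lam b g).toReal
  have hwm : Measurable w := (measurable_boundaryDensity lam g).ennreal_toReal.const_mul _
  have hwi : Integrable w lam := (hΦ.integrable_boundaryDensity g).const_mul _
  have hmp : MeasurePreserving Φ (pathMeasure μ) lam := ⟨hΦ.measurable, rfl⟩
  have hbp : ∀ n y, backProb (lazyStep μ) g n y ∈ Set.Icc (0 : ℝ) 1 := fun n y =>
    ⟨backProb_nonneg _ g n y, backProb_le_one _ g n y⟩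
  -- Identify the boundary values of `u`. Let `f y` be the probability of `S` given the current
  -- position `y`; it is harmonic. The integral of `v` is the limit of the means of `f * u`, along
  -- the walk and hence along the lazy walk. There `u` may be replaced by `backProb`, and the mean
  -- becomes constant in time.
  have hset : ∀ S, MeasurableSet S →
      ∫ ω in Φ ⁻¹' S, v ω ∂pathMeasure μ = ∫ ω in Φ ⁻¹' S, w (Φ ω) ∂pathMeasure μ := by
    intro S hS
    let f : G → ℝ := fun y => (lam.map (y • ·)).real S
    have hfp : ∀ y : G, IsProbabilityMeasure (lam.map (y • ·)) := fun y =>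
      Measure.isProbabilityMeasure_map (measurable_const_smul y).aemeasurable
    have hfa : ∀ y, |f y| ≤ 1 := fun y => by
      have := hfp y
      rw [abs_of_nonneg measureReal_nonneg]
      exact measureReal_le_one
    have hfu : ∀ y, |f y * u y| ≤ 1 := fun y => by
      rw [abs_mul]; exact mul_le_one₀ (hfa y) (abs_nonneg _) (hua y)
    have hfh : ∀ y, ∫ x, f (y * x) ∂lazyStep μ = f y := fun y => by
      have h1 := hΦ.integral_harmonicMeasure hS y
      rw [integral_lazyStep (fun x => hfa (y * x)), mul_one]
      change (f y + ∫ x, ((harmonicMeasure μ Φ).map ((y * x) • ·)).real S ∂μ) / 2 = f y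
      rw [h1]
      change (f y + f y) / 2 = f y
      ring
    have hA : MeasurableSet (Φ ⁻¹' S) := hΦ.measurable hS
    have h1 : ∀ k, ∫ y, f y * u y ∂walkLaw μ k =
        ∫ ω, (Φ ⁻¹' S).indicator (fun ω => u (ω k)) ω ∂pathMeasure μ := by
      intro k
      have h2 := hΦ.integral_apply k (F := fun p => S.indicator (fun _ => u p.1) p.2) (C := 1)
        (measurable_uncurry_of_countable fun x => measurable_const.indicator hS) (fun p => by
          by_cases h : p.2 ∈ S <;> simp [h, hua])
      have e : ∀ x : G, ∫ b, S.indicator (fun _ => u x) (x • b) ∂harmonicMeasure μ Φ =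
          f x * u x := by
        intro x
        have hm : MeasurableSet ((x • · : B → B) ⁻¹' S) := measurable_const_smul x hS
        have e' : ∀ b : B, S.indicator (fun _ => u x) (x • b) =
            ((x • · : B → B) ⁻¹' S).indicator (fun _ => u x) b := by
          intro b; by_cases h : x • b ∈ S <;> simp [h]
        simp only [e']
        rw [integral_indicator_const _ hm, smul_eq_mul]
        simp only [f]
        rw [map_measureReal_apply (measurable_const_smul x) hS]
      simp only [e] at h2
      rw [← h2]
      congr 1
    have h3 : Tendsto (fun k => ∫ y, f y * u y ∂walkLaw μ k) atTop
        (𝓝 (∫ ω in Φ ⁻¹' S, v ω ∂pathMeasure μ)) := by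
      simp only [h1]
      rw [← integral_indicator hA]
      refine tendsto_integral_of_dominated_convergence (fun _ => 1)
        (fun k => ((measurable_comp_apply u k).indicator hA).aestronglyMeasurable)
        (integrable_const _) (fun k => Eventually.of_forall fun ω => ?_) ?_
      · by_cases h : ω ∈ Φ ⁻¹' S
        · simp [Set.indicator_of_mem h, hua]
        · simp [Set.indicator_of_notMem h]
      · filter_upwards [hconv] with ω hω
        by_cases h : ω ∈ Φ ⁻¹' S
        · simpa only [Set.indicator_of_mem h] using hω
        · simp only [Set.indicator_of_notMem h]; exact tendsto_const_nhds
    have h4 := (tendsto_integral_lazyStep μ hfu h3).comp (tendsto_add_atTop_nat 1)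
    have h5 := tendsto_integral_mul_comp_sub (κ := fun n => walkLaw (lazyStep μ) (n + 1)) hbp
      (fun y => ⟨hu0 y, hu1 y⟩) hlim hfa continuousOn_id
    have h6 : ∀ n, ∫ y, f y * backProb (lazyStep μ) g n y ∂walkLaw (lazyStep μ) (n + 1) =
        (lazyStep μ).real {g} * f g := by
      intro n
      simp only [mul_comm (f _)]
      rw [integral_backProb_mul _ g n hfa, integral_walkLaw_of_harmonic hfa hfh]
    simp only [id, h6] at h5
    have h7 := h5.add h4
    simp only [Function.comp, sub_add_cancel, zero_add] at h7
    have h8 := tendsto_nhds_unique h7 tendsto_const_nhds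
    rw [h8]
    have h9 : ∫ ω in Φ ⁻¹' S, w (Φ ω) ∂pathMeasure μ = ∫ b in S, w b ∂lam := by
      rw [hlam, harmonicMeasure, setIntegral_map hS hwm.aestronglyMeasurable
        hΦ.measurable.aemeasurable]
    rw [h9]
    simp only [w]
    rw [integral_const_mul]
    rcases eq_or_ne ((lazyStep μ).real {g}) 0 with h0 | h0
    · rw [h0]; simp
    · obtain ⟨n, hn⟩ := lazyStep_reachable h0
      rw [hlam, hΦ.setIntegral_boundaryDensity hn S]
  have hvw : ∀ᵐ ω ∂pathMeasure μ, v ω = w (Φ ω) :=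
    ae_eq_comp_of_setIntegral_eq hΦ.measurable hmax hvm hvinv hvi hwm
      (hmp.integrable_comp_of_integrable hwi) hset
  obtain ⟨M, hM⟩ := isCompact_Icc.exists_bound_of_continuousOn (hψ.continuousOn (s := Set.Icc 0 1))
  -- Now that the boundary values of `u` are known, the same passage from the walk to the lazy walk
  -- and then to `backProb` is applied with `ψ`.
  have h1 : Tendsto (fun k => ∫ y, ψ (u y) ∂walkLaw μ k) atTop (𝓝 (∫ b, ψ (w b) ∂lam)) := by
    have e : ∫ b, ψ (w b) ∂lam = ∫ ω, ψ (v ω) ∂pathMeasure μ := by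
      rw [hlam, harmonicMeasure, integral_map (f := fun b => ψ (w b))
        hΦ.measurable.aemeasurable (hψ.measurable.comp hwm).aestronglyMeasurable]
      refine integral_congr_ae ?_
      filter_upwards [hvw] with ω hω
      rw [hω]
    rw [e]
    simp only [integral_walkLaw μ _ fun y => ψ (u y)]
    refine tendsto_integral_of_dominated_convergence (fun _ => M)
      (fun k => (measurable_comp_apply (fun y => ψ (u y)) k).aestronglyMeasurable)
      (integrable_const _) (fun k => Eventually.of_forall fun ω => hM _ ⟨hu0 _, hu1 _⟩) ?_
    filter_upwards [hconv] with ω hω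
    exact (hψ.tendsto _).comp hω
  have h2 := (tendsto_integral_lazyStep μ (fun y => hM _ ⟨hu0 y, hu1 y⟩) h1).comp
    (tendsto_add_atTop_nat 1)
  have h3 := tendsto_integral_mul_comp_sub (κ := fun n => walkLaw (lazyStep μ) (n + 1)) hbp
      (fun y => ⟨hu0 y, hu1 y⟩) hlim (F := fun _ => 1) (by simp) (hψ.continuousOn (s := Set.Icc 0 1))
  simp only [one_mul] at h3
  have h4 := h3.add h2
  simp only [Function.comp, sub_add_cancel, zero_add] at h4
  exact h4

end Boundary

/-! ### The entropy of a maximal boundary -/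

section ChainRule

variable {G : Type*} [Group G] [Countable G] [MeasurableSpace G] [MeasurableSingletonClass G]
  (ρ : Measure G) [IsProbabilityMeasure ρ]

theorem tsum_measure_singleton_eq_one : ∑' x : G, ρ {x} = 1 := by
  have h := lintegral_countable' (μ := ρ) (fun _ : G => 1)
  simpa only [lintegral_one, measure_univ, one_mul] using h.symm

theorem tsum_ofReal_measureReal_singleton : ∑' x : G, ENNReal.ofReal (ρ.real {x}) = 1 :=
  (tsum_congr fun _ => ofReal_measureReal).trans (tsum_measure_singleton_eq_one ρ)

theorem tsum_mul_walkLaw_singleton (n : ℕ) (y : G) :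
    ∑' g : G, ρ {g} * walkLaw ρ n {g⁻¹ * y} = walkLaw ρ (n + 1) {y} := by
  have h := lintegral_walkLaw_add ρ 1 n (({y} : Set G).indicator 1)
  rw [lintegral_indicator_one (measurableSet_singleton _), add_comm 1 n, walkLaw_one,
    lintegral_countable'] at h
  rw [h]
  refine tsum_congr fun g => ?_
  have e : ∀ z : G, ({y} : Set G).indicator (1 : G → ℝ≥0∞) (g * z) =
      ({g⁻¹ * y} : Set G).indicator 1 z := by
    intro z
    by_cases hz : g * z = y
    · have : z = g⁻¹ * y := by rw [← hz]; group
      simp [this]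
    · have : z ≠ g⁻¹ * y := fun h => hz (by rw [h]; group)
      simp [hz, this]
  simp only [e]
  rw [lintegral_indicator_one (measurableSet_singleton _), mul_comm]

theorem tsum_ofReal_backProb (n : ℕ) {y : G} (hy : (walkLaw ρ (n + 1)).real {y} ≠ 0) :
    ∑' g : G, ENNReal.ofReal (backProb ρ g n y) = 1 := by
  have hy' : walkLaw ρ (n + 1) {y} ≠ 0 := fun h => hy (by simp [Measure.real, h])
  have e : ∀ g : G, ENNReal.ofReal (backProb ρ g n y) =
      ρ {g} * walkLaw ρ n {g⁻¹ * y} / walkLaw ρ (n + 1) {y} := by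
    intro g
    rw [backProb, ENNReal.ofReal_div_of_pos (lt_of_le_of_ne measureReal_nonneg hy.symm),
      ENNReal.ofReal_mul measureReal_nonneg, ofReal_measureReal, ofReal_measureReal,
      ofReal_measureReal]
  simp only [e, div_eq_mul_inv]
  rw [ENNReal.tsum_mul_right, tsum_mul_walkLaw_singleton,
    ENNReal.mul_inv_cancel hy' (measure_ne_top _ _)]

theorem ofReal_negMulLog_mul {a b : ℝ} (ha0 : 0 ≤ a) (ha1 : a ≤ 1) (hb0 : 0 ≤ b) (hb1 : b ≤ 1) :
    ENNReal.ofReal (Real.negMulLog (a * b)) =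
      ENNReal.ofReal b * ENNReal.ofReal (Real.negMulLog a) +
        ENNReal.ofReal a * ENNReal.ofReal (Real.negMulLog b) := by
  have h1 := Real.negMulLog_nonneg ha0 ha1
  have h2 := Real.negMulLog_nonneg hb0 hb1
  rw [Real.negMulLog_mul, ENNReal.ofReal_add (by positivity) (by positivity),
    ENNReal.ofReal_mul hb0, ENNReal.ofReal_mul ha0]

/-- The chain rule for the joint entropy of the first step and the position at time `n + 1`. -/
theorem shannon_walkLaw_succ_add (n : ℕ) :
    shannon (walkLaw ρ (n + 1)) +
      ∑' g : G, ∫⁻ y, ENNReal.ofReal (Real.negMulLog (backProb ρ g n y)) ∂walkLaw ρ (n + 1) =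
        shannon ρ + shannon (walkLaw ρ n) := by
  -- The first step and the remaining increment are independent, so this joint entropy is a sum of
  -- two entropies.
  have h1 : ∑' g : G, ∑' y : G, ENNReal.ofReal (Real.negMulLog
      (ρ.real {g} * (walkLaw ρ n).real {g⁻¹ * y})) = shannon ρ + shannon (walkLaw ρ n) := by
    have e : ∀ g : G, ∑' y : G, ENNReal.ofReal (Real.negMulLog
        (ρ.real {g} * (walkLaw ρ n).real {g⁻¹ * y})) =
        ENNReal.ofReal (Real.negMulLog (ρ.real {g})) +
          ENNReal.ofReal (ρ.real {g}) * shannon (walkLaw ρ n) := by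
      intro g
      rw [← (Equiv.mulLeft g).tsum_eq]
      simp only [Equiv.coe_mulLeft, inv_mul_cancel_left]
      simp only [ofReal_negMulLog_mul measureReal_nonneg measureReal_le_one measureReal_nonneg
        measureReal_le_one]
      rw [ENNReal.tsum_add, ENNReal.tsum_mul_right, ENNReal.tsum_mul_left,
        tsum_ofReal_measureReal_singleton, one_mul, shannon_eq_tsum (walkLaw ρ n)]
    simp only [e]
    rw [ENNReal.tsum_add, ENNReal.tsum_mul_right, tsum_ofReal_measureReal_singleton, one_mul,
      ← shannon_eq_tsum]
  rw [← h1, ENNReal.tsum_comm, shannon_eq_tsum]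
  -- The same double sum fibred over the position `y`, factoring each joint mass as the mass of `y`
  -- times `backProb`.
  have e2 : ∀ y : G, ∑' g : G, ENNReal.ofReal (Real.negMulLog
      (ρ.real {g} * (walkLaw ρ n).real {g⁻¹ * y})) =
      ENNReal.ofReal (Real.negMulLog ((walkLaw ρ (n + 1)).real {y})) +
        ∑' g : G, ENNReal.ofReal ((walkLaw ρ (n + 1)).real {y}) *
          ENNReal.ofReal (Real.negMulLog (backProb ρ g n y)) := by
    intro y
    simp only [← mul_backProb ρ _ n y]
    simp only [ofReal_negMulLog_mul measureReal_nonneg measureReal_le_one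
      (backProb_nonneg ρ _ n y) (backProb_le_one ρ _ n y)]
    rw [ENNReal.tsum_add, ENNReal.tsum_mul_right]
    congr 1
    rcases eq_or_ne ((walkLaw ρ (n + 1)).real {y}) 0 with h | h
    · rw [h]; simp
    · rw [tsum_ofReal_backProb ρ n h, one_mul]
  simp only [e2]
  rw [ENNReal.tsum_add]
  congr 1
  rw [ENNReal.tsum_comm]
  refine tsum_congr fun g => ?_
  rw [lintegral_countable']
  refine tsum_congr fun y => ?_
  rw [ofReal_measureReal, mul_comm]

theorem shannon_average_le {α β γ : Measure G} [IsProbabilityMeasure α] [IsProbabilityMeasure β]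
    [IsProbabilityMeasure γ] (h : γ = (2⁻¹ : ℝ≥0∞) • α + (2⁻¹ : ℝ≥0∞) • β) :
    (shannon α + shannon β) / 2 ≤ shannon γ := by
  rw [shannon_eq_tsum, shannon_eq_tsum, shannon_eq_tsum, ← ENNReal.tsum_add, div_eq_mul_inv,
    ← ENNReal.tsum_mul_right]
  refine ENNReal.tsum_le_tsum fun x => ?_
  have hα := Real.negMulLog_nonneg (measureReal_nonneg (μ := α) (s := {x})) measureReal_le_one
  have hβ := Real.negMulLog_nonneg (measureReal_nonneg (μ := β) (s := {x})) measureReal_le_one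
  have e : γ.real {x} = (1 / 2 : ℝ) * α.real {x} + (1 / 2 : ℝ) * β.real {x} := by
    rw [h, Measure.real, Measure.add_apply, Measure.smul_apply, Measure.smul_apply, smul_eq_mul,
      smul_eq_mul, ENNReal.toReal_add (ENNReal.mul_ne_top (by simp) (measure_ne_top _ _))
      (ENNReal.mul_ne_top (by simp) (measure_ne_top _ _))]
    simp [Measure.real]
  have hc := Real.concaveOn_negMulLog.2 (measureReal_nonneg (μ := α) (s := {x}))
    (measureReal_nonneg (μ := β) (s := {x})) (by norm_num : (0 : ℝ) ≤ 1 / 2)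
    (by norm_num : (0 : ℝ) ≤ 1 / 2) (by norm_num)
  simp only [smul_eq_mul] at hc
  rw [← ENNReal.ofReal_add hα hβ, ← div_eq_mul_inv,
    show (2 : ℝ≥0∞) = ENNReal.ofReal 2 by simp, ← ENNReal.ofReal_div_of_pos two_pos, e]
  exact ENNReal.ofReal_le_ofReal (by linarith)

/-- Concavity of entropy passes the linear lower bound through each average of two laws; a lazy step
is worth half a step. -/
theorem le_shannon_lazyLaw (μ : Measure G) [IsProbabilityMeasure μ] {h : ℝ} (h0 : 0 ≤ h)
    (hh : ∀ j : ℕ, ENNReal.ofReal (h * j) ≤ shannon (walkLaw μ j)) (n j : ℕ) :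
    ENNReal.ofReal (h * (j + n / 2)) ≤ shannon (lazyLaw μ n j) := by
  induction n generalizing j with
  | zero => rw [lazyLaw_zero_left]; simpa using hh j
  | succ n ih =>
    refine le_trans ?_ (shannon_average_le (lazyLaw_succ μ n j))
    refine le_trans ?_ (ENNReal.div_le_div_right (add_le_add (ih j) (ih (j + 1))) 2)
    rw [← ENNReal.ofReal_add (by positivity) (by positivity),
      show (2 : ℝ≥0∞) = ENNReal.ofReal 2 by simp, ← ENNReal.ofReal_div_of_pos two_pos]
    refine ENNReal.ofReal_le_ofReal (le_of_eq ?_)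
    push_cast
    ring

end ChainRule

/-! ### Equality of entropy and differential entropy for maximal boundaries -/

section MaximalEntropy

variable {G : Type*} [Group G] [Countable G] [MeasurableSpace G] [MeasurableSingletonClass G]
  {B : Type*} [MeasurableSpace B] [MulAction G B] [MeasurableConstSMul G B]
  {μ : Measure G} [IsProbabilityMeasure μ] {Φ : (ℕ → G) → B}

theorem IsBoundaryMap.map_restrict_apply_eq (hΦ : IsBoundaryMap μ Φ) (g : G) :
    ((pathMeasure μ).restrict {ω | ω 1 = g}).map Φ = (harmonicMeasure μ Φ).withDensity
      fun b => μ {g} * boundaryDensity (harmonicMeasure μ Φ) b g := by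
  have hA := measurableSet_apply_eq (G := G) 1 g
  refine Measure.ext fun S hS => ?_
  have h := hΦ.measure_inter_preimage (n := 1) (x := g) hA (fun ω => by simp [stopAt])
    (fun ω hω => hω) hS
  rw [Measure.map_apply hΦ.measurable hS, Measure.restrict_apply (hΦ.measurable hS),
    Set.inter_comm, h, withDensity_apply _ hS,
    lintegral_const_mul _ (measurable_boundaryDensity _ g), ← walkLaw_singleton μ 1 g, walkLaw_one]
  rcases eq_or_ne (μ {g}) 0 with h0 | h0
  · simp [h0]
  · rw [← withDensity_apply _ hS, hΦ.withDensity_boundaryDensity (n := 1) (x := g)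
      (by rwa [walkLaw_one])]

/-- On the event that the first step is `g`, the boundary point has density proportional to the
boundary density at `g`; this extra factor turns the logarithm into `negMulLog`. -/
theorem IsBoundaryMap.setIntegral_logDensity (hΦ : IsBoundaryMap μ Φ) (g : G) :
    ∫ ω in {ω | ω 1 = g}, logDensity μ Φ 1 ω ∂pathMeasure μ =
      -(μ.real {g} * ∫ b, Real.negMulLog (boundaryDensity (harmonicMeasure μ Φ) b g).toReal
        ∂harmonicMeasure μ Φ) := by
  have := isProbabilityMeasure_harmonicMeasure μ hΦ.measurable
  have hA := measurableSet_apply_eq (G := G) 1 g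
  have hm := measurable_boundaryDensity (harmonicMeasure μ Φ) g
  have h1 : ∫ ω in {ω | ω 1 = g}, logDensity μ Φ 1 ω ∂pathMeasure μ =
      ∫ ω in {ω | ω 1 = g}, Real.log (boundaryDensity (harmonicMeasure μ Φ) (Φ ω) g).toReal
        ∂pathMeasure μ :=
    setIntegral_congr_fun hA fun ω hω => by
      have hω : ω 1 = g := hω
      simp only [logDensity, hω]
  have hfin : ∀ᵐ b ∂harmonicMeasure μ Φ,
      μ {g} * boundaryDensity (harmonicMeasure μ Φ) b g < ∞ := by
    have h := hΦ.ae_walkLaw_mul_boundaryDensity_le_one 1 g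
    rw [walkLaw_one] at h
    filter_upwards [h] with b hb using lt_of_le_of_lt hb ENNReal.one_lt_top
  rw [h1, ← integral_map (f := fun b => Real.log
    (boundaryDensity (harmonicMeasure μ Φ) b g).toReal) hΦ.measurable.aemeasurable
    hm.ennreal_toReal.log.aestronglyMeasurable, hΦ.map_restrict_apply_eq,
    integral_withDensity_eq_integral_toReal_smul (hm.const_mul _) hfin, ← integral_const_mul,
    ← integral_neg]
  refine integral_congr_ae (Eventually.of_forall fun b => ?_)
  simp only [ENNReal.toReal_mul, smul_eq_mul, Real.negMulLog, Measure.real]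
  ring

theorem boundaryDensity_one_ae_eq {lam : Measure B} [IsProbabilityMeasure lam] :
    ∀ᵐ b ∂lam, boundaryDensity lam b (1 : G) = 1 := by
  have h : lam.map ((1 : G) • ·) = lam := by simp
  have h2 := Measure.rnDeriv_self lam
  filter_upwards [h2] with b hb
  rw [boundaryDensity, h, hb]

theorem IsBoundaryMap.integrable_negMulLog_boundaryDensity (hΦ : IsBoundaryMap μ Φ) {n : ℕ}
    {g : G} (hg : walkLaw μ n {g} ≠ 0) :
    Integrable (fun b => Real.negMulLog (boundaryDensity (harmonicMeasure μ Φ) b g).toReal)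
      (harmonicMeasure μ Φ) := by
  have := isProbabilityMeasure_harmonicMeasure μ hΦ.measurable
  obtain ⟨M, hM⟩ := (isCompact_Icc (a := 0) (b := ((walkLaw μ n {g})⁻¹).toReal)).exists_bound_of_continuousOn
    Real.continuous_negMulLog.continuousOn
  refine Integrable.of_bound (Real.continuous_negMulLog.measurable.comp
    (measurable_boundaryDensity _ g).ennreal_toReal).aestronglyMeasurable M ?_
  filter_upwards [hΦ.ae_walkLaw_mul_boundaryDensity_le_one n g] with b hb
  refine hM _ ⟨ENNReal.toReal_nonneg, ENNReal.toReal_mono (ENNReal.inv_ne_top.2 hg) ?_⟩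
  rw [← one_div, ENNReal.le_div_iff_mul_le (Or.inl hg) (Or.inl (measure_ne_top _ _)), mul_comm]
  exact hb

/-- `negMulLog` splits over the product and the density integrates to 1. The factor one half comes
from the lazy mass of `g ≠ 1`; for `g = 1` the density is 1 and its term vanishes. -/
theorem IsBoundaryMap.integral_negMulLog_lazyStep (hΦ : IsBoundaryMap μ Φ) (g : G) :
    ∫ b, Real.negMulLog ((lazyStep μ).real {g} *
      (boundaryDensity (harmonicMeasure μ Φ) b g).toReal) ∂harmonicMeasure μ Φ =
      Real.negMulLog ((lazyStep μ).real {g}) -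
        (∫ ω in {ω | ω 1 = g}, logDensity μ Φ 1 ω ∂pathMeasure μ) / 2 := by
  have := isProbabilityMeasure_harmonicMeasure μ hΦ.measurable
  rw [hΦ.setIntegral_logDensity]
  rcases eq_or_ne ((lazyStep μ).real {g}) 0 with h0 | h0
  · have h1 : μ.real {g} = 0 := by
      have h2 := lazyStep_real_singleton μ g
      rw [h0] at h2
      have h3 : 0 ≤ (Measure.dirac 1 : Measure G).real {g} := measureReal_nonneg
      have h4 : 0 ≤ μ.real {g} := measureReal_nonneg
      linarith
    rw [h0, h1]; simp
  obtain ⟨n, hn⟩ := lazyStep_reachable h0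
  have hi := hΦ.integrable_negMulLog_boundaryDensity hn
  have h1 : ∫ b, (boundaryDensity (harmonicMeasure μ Φ) b g).toReal ∂harmonicMeasure μ Φ = 1 := by
    have := hΦ.setIntegral_boundaryDensity hn Set.univ
    rw [setIntegral_univ] at this
    rw [this]
    have hp : IsProbabilityMeasure ((harmonicMeasure μ Φ).map (g • ·)) :=
      Measure.isProbabilityMeasure_map (measurable_const_smul g).aemeasurable
    exact probReal_univ
  simp only [Real.negMulLog_mul]
  rw [integral_add ((hΦ.integrable_boundaryDensity g).mul_const _) (hi.const_mul _),
    integral_mul_const, integral_const_mul, h1, one_mul]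
  have h2 : (lazyStep μ).real {g} * ∫ b, Real.negMulLog
      (boundaryDensity (harmonicMeasure μ Φ) b g).toReal ∂harmonicMeasure μ Φ =
      (μ.real {g} * ∫ b, Real.negMulLog
      (boundaryDensity (harmonicMeasure μ Φ) b g).toReal ∂harmonicMeasure μ Φ) / 2 := by
    rcases eq_or_ne g 1 with rfl | hg
    · have : ∫ b, Real.negMulLog (boundaryDensity (harmonicMeasure μ Φ) b (1 : G)).toReal
          ∂harmonicMeasure μ Φ = 0 := by
        rw [integral_congr_ae (g := fun _ => 0)]
        · simp
        · filter_upwards [boundaryDensity_one_ae_eq (G := G) (lam := harmonicMeasure μ Φ)] with b hb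
          rw [hb]; simp
      rw [this]; simp
    · rw [lazyStep_real_singleton]
      have : (Measure.dirac 1 : Measure G).real {g} = 0 := by
        simp [Measure.real, hg.symm]
      rw [this]; ring
  rw [h2]; ring

theorem shannon_zero_walkLaw (ρ : Measure G) [IsProbabilityMeasure ρ] :
    shannon (walkLaw ρ 0) = 0 := by
  rw [walkLaw_zero, shannon, lintegral_dirac]
  simp [Measure.real]

/-- The chain rule with all but finitely many nonnegative terms dropped, so that limits in `n` can
be taken term by term. -/
theorem shannon_toReal_succ_le {ρ : Measure G} [IsProbabilityMeasure ρ] (hρ : shannon ρ ≠ ∞)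
    (F : Finset G) (n : ℕ) :
    (shannon (walkLaw ρ (n + 1))).toReal ≤ (shannon (walkLaw ρ n)).toReal + ((shannon ρ).toReal -
      ∑ g ∈ F, ∫ y, Real.negMulLog (backProb ρ g n y) ∂walkLaw ρ (n + 1)) := by
  have hη : ∀ g y, 0 ≤ Real.negMulLog (backProb ρ g n y) := fun g y =>
    Real.negMulLog_nonneg (backProb_nonneg ρ g n y) (backProb_le_one ρ g n y)
  have e : ∀ g, ∫ y, Real.negMulLog (backProb ρ g n y) ∂walkLaw ρ (n + 1) =
      (∫⁻ y, ENNReal.ofReal (Real.negMulLog (backProb ρ g n y)) ∂walkLaw ρ (n + 1)).toReal :=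
    fun g => integral_eq_lintegral_of_nonneg_ae (Eventually.of_forall (hη g))
      (measurable_of_countable _).aestronglyMeasurable
  have h1 := shannon_walkLaw_succ_add ρ n
  have hfin : shannon ρ + shannon (walkLaw ρ n) ≠ ∞ :=
    ENNReal.add_ne_top.2 ⟨hρ, shannon_walkLaw_ne_top ρ hρ n⟩
  have h2 : shannon (walkLaw ρ (n + 1)) + ∑ g ∈ F, ∫⁻ y, ENNReal.ofReal
      (Real.negMulLog (backProb ρ g n y)) ∂walkLaw ρ (n + 1) ≤
        shannon ρ + shannon (walkLaw ρ n) := by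
    rw [← h1]; gcongr; exact ENNReal.sum_le_tsum F
  have hfin2 := ne_top_of_le_ne_top hfin h2
  have h3 := ENNReal.toReal_mono hfin h2
  rw [ENNReal.toReal_add (ENNReal.add_ne_top.1 hfin2).1 (ENNReal.add_ne_top.1 hfin2).2,
    ENNReal.toReal_add hρ (shannon_walkLaw_ne_top ρ hρ n),
    ENNReal.toReal_sum (ENNReal.sum_ne_top.1 (ENNReal.add_ne_top.1 hfin2).2)] at h3
  simp only [e]
  linarith

theorem subadditive_shannon_walkLaw (hμ : shannon μ ≠ ∞) :
    Subadditive fun n => (shannon (walkLaw μ n)).toReal := fun m n => by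
  rw [← ENNReal.toReal_add (shannon_walkLaw_ne_top μ hμ m) (shannon_walkLaw_ne_top μ hμ n)]
  exact ENNReal.toReal_mono (ENNReal.add_ne_top.2
    ⟨shannon_walkLaw_ne_top μ hμ m, shannon_walkLaw_ne_top μ hμ n⟩) (shannon_walkLaw_add_le μ m n)

/-- For a maximal boundary the entropy of the walk does not exceed the differential entropy. -/
theorem IsBoundaryMap.entropy_le (hΦ : IsBoundaryMap μ Φ) (hμ : HasFiniteEntropy μ)
    (hmax : IsMaximalMap μ Φ) {h : ℝ} (h0 : 0 ≤ h)
    (hh : ∀ j : ℕ, h * j ≤ (shannon (walkLaw μ j)).toReal) :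
    h ≤ ∫ ω, logDensity μ Φ 1 ω ∂pathMeasure μ := by
  have := isProbabilityMeasure_harmonicMeasure μ hΦ.measurable
  have hμ' := hμ.shannon_ne_top
  have hρ := hasFiniteEntropy_lazyStep hμ
  have hρ' := hρ.shannon_ne_top
  have hlow : ∀ n : ℕ, h / 2 * n ≤ (shannon (walkLaw (lazyStep μ) n)).toReal := by
    intro n
    have h1 := le_shannon_lazyLaw μ h0 (fun j => by
      rw [← ENNReal.ofReal_toReal (shannon_walkLaw_ne_top μ hμ' j)]
      exact ENNReal.ofReal_le_ofReal (hh j)) n 0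
    rw [lazyLaw_zero_right] at h1
    rw [← ENNReal.ofReal_le_iff_le_toReal (shannon_walkLaw_ne_top _ hρ' n)]
    refine le_trans (ENNReal.ofReal_le_ofReal (le_of_eq ?_)) h1
    push_cast; ring
  let t : G → ℝ := fun g => ∫ b, Real.negMulLog ((lazyStep μ).real {g} *
      (boundaryDensity (harmonicMeasure μ Φ) b g).toReal) ∂harmonicMeasure μ Φ
  -- The increments of entropy of the lazy walk are bounded by the convergent sequence `a`; its
  -- Cesàro means dominate the entropy per unit of time, which is at least `h / 2`.
  have hF : ∀ F : Finset G, h / 2 ≤ (shannon (lazyStep μ)).toReal - ∑ g ∈ F, t g := by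
    intro F
    let a : ℕ → ℝ := fun n => (shannon (lazyStep μ)).toReal - ∑ g ∈ F,
      ∫ y, Real.negMulLog (backProb (lazyStep μ) g n y) ∂walkLaw (lazyStep μ) (n + 1)
    have ha : Tendsto a atTop (𝓝 ((shannon (lazyStep μ)).toReal - ∑ g ∈ F, t g)) :=
      (tendsto_finsetSum F fun g _ =>
        hΦ.tendsto_integral_backProb hmax Real.continuous_negMulLog g).const_sub _
    have hup : ∀ n, (shannon (walkLaw (lazyStep μ) n)).toReal ≤ ∑ i ∈ Finset.range n, a i := by
      intro n
      induction n with
      | zero => rw [shannon_zero_walkLaw]; simp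
      | succ n ih =>
        rw [Finset.sum_range_succ]
        exact (shannon_toReal_succ_le hρ' F n).trans (add_le_add_left ih _)
    refine ge_of_tendsto ha.cesaro ?_
    filter_upwards [eventually_ge_atTop 1] with n hn
    have hn' : (0 : ℝ) < n := by exact_mod_cast hn
    rw [inv_mul_eq_div, le_div_iff₀ hn']
    exact (hlow n).trans (hup n)
  have hsum1 : HasSum (fun g : G => Real.negMulLog ((lazyStep μ).real {g}))
      (shannon (lazyStep μ)).toReal := by
    have h1 : (shannon (lazyStep μ)).toReal = ∑' g : G, Real.negMulLog ((lazyStep μ).real {g}) := by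
      rw [shannon_eq_tsum, ENNReal.tsum_toReal_eq (fun _ => ENNReal.ofReal_ne_top)]
      exact tsum_congr fun g => ENNReal.toReal_ofReal
        (Real.negMulLog_nonneg measureReal_nonneg measureReal_le_one)
    rw [h1]
    exact hρ.hasSum
  have hsum2 : HasSum (fun g : G => ∫ ω in {ω | ω 1 = g}, logDensity μ Φ 1 ω ∂pathMeasure μ)
      (∫ ω, logDensity μ Φ 1 ω ∂pathMeasure μ) := by
    have h1 := hasSum_integral_iUnion (μ := pathMeasure μ) (f := logDensity μ Φ 1)
      (s := fun g : G => {ω : ℕ → G | ω 1 = g}) (fun g => measurableSet_apply_eq 1 g)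
      (fun g g' hgg => Set.disjoint_left.2 fun ω h1 h2 => hgg (h1.symm.trans h2))
      (hΦ.integrable_logDensity hμ' 1).integrableOn
    have hU : (⋃ g : G, {ω : ℕ → G | ω 1 = g}) = Set.univ := by
      ext ω; simp
    rwa [hU, setIntegral_univ] at h1
  have hsum : HasSum t ((shannon (lazyStep μ)).toReal -
      (∫ ω, logDensity μ Φ 1 ω ∂pathMeasure μ) / 2) := by
    have h1 := hsum1.sub (hsum2.div_const 2)
    have e : t = _ := funext fun g => hΦ.integral_negMulLog_lazyStep g
    rw [e]
    exact h1
  -- Let `F` exhaust the group: the terms sum to the entropy of the lazy step minus half the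
  -- differential entropy.
  have hfin := ge_of_tendsto (Tendsto.const_sub (shannon (lazyStep μ)).toReal hsum)
    (Eventually.of_forall hF)
  linarith

/-- The mean is the entropy at time `n` minus `n E`. The asymptotic entropy is at most `E` by
maximality and at least `E` because `condInfo` is nonnegative. -/
theorem IsBoundaryMap.tendsto_integral_condInfo (hΦ : IsBoundaryMap μ Φ)
    (hμ : HasFiniteEntropy μ) (hmax : IsMaximalMap μ Φ) :
    Tendsto (fun n : ℕ => (∫ ω, condInfo μ Φ n ω ∂pathMeasure μ) / n) atTop (𝓝 0) := by
  have hμ' := hμ.shannon_ne_top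
  set E := ∫ ω, logDensity μ Φ 1 ω ∂pathMeasure μ with hE
  have hsub := subadditive_shannon_walkLaw hμ'
  have hbdd : BddBelow (Set.range fun n : ℕ => (shannon (walkLaw μ n)).toReal / n) :=
    ⟨0, by rintro _ ⟨n, rfl⟩; positivity⟩
  have hlim := hsub.tendsto_lim hbdd
  have hc : ∀ n : ℕ, ∫ ω, condInfo μ Φ n ω ∂pathMeasure μ =
      (shannon (walkLaw μ n)).toReal - n * E := by
    intro n
    have := integral_sub (integrable_walkInfo μ hμ' n) (hΦ.integrable_logDensity hμ' n)
    rw [integral_walkInfo, hΦ.integral_logDensity hμ' n] at this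
    exact this
  have hle : hsub.lim ≤ E := by
    have h0 : 0 ≤ hsub.lim := ge_of_tendsto' hlim fun n => by positivity
    refine hΦ.entropy_le hμ hmax h0 fun j => ?_
    rcases Nat.eq_zero_or_pos j with rfl | hj
    · simp
    · have h1 := hsub.lim_le_div hbdd hj.ne'
      rwa [le_div_iff₀ (by exact_mod_cast hj)] at h1
  have hge : E ≤ hsub.lim := by
    refine ge_of_tendsto hlim ?_
    filter_upwards [eventually_ge_atTop 1] with n hn
    rw [le_div_iff₀ (by exact_mod_cast hn)]
    have h1 : 0 ≤ ∫ ω, condInfo μ Φ n ω ∂pathMeasure μ :=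
      integral_nonneg_of_ae (hΦ.ae_condInfo_nonneg n)
    rw [hc] at h1
    linarith
  have h2 := hlim.sub_const E
  rw [le_antisymm hle hge, sub_self] at h2
  refine h2.congr' ?_
  filter_upwards [eventually_ge_atTop 1] with n hn
  have hn' : (n : ℝ) ≠ 0 := by positivity
  rw [hc, sub_div, mul_div_cancel_left₀ _ hn']

end MaximalEntropy

/-! ### Vanishing of the asymptotic entropy of the conditional measures -/

section AsymptoticEntropy

variable {G : Type*} [Group G] [Countable G] [MeasurableSpace G] [MeasurableSingletonClass G]
  {B : Type*} [MeasurableSpace B] [MulAction G B] [MeasurableConstSMul G B]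
  {μ : Measure G} [IsProbabilityMeasure μ] {Φ : (ℕ → G) → B}

namespace IsBoundaryMap

variable (hΦ : IsBoundaryMap μ Φ)

include hΦ

theorem lintegral_condInfo_ne_top (hμ : shannon μ ≠ ∞) (n : ℕ) :
    ∫⁻ ω, ENNReal.ofReal (condInfo μ Φ n ω) ∂pathMeasure μ ≠ ∞ :=
  (hΦ.integrable_condInfo hμ n).lintegral_lt_top.ne

theorem tendsto_lintegral_condInfo (hμ : shannon μ ≠ ∞)
    (h : Tendsto (fun n : ℕ => (∫ ω, condInfo μ Φ n ω ∂pathMeasure μ) / n) atTop (𝓝 0)) :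
    Tendsto (fun n : ℕ => (∫⁻ ω, ENNReal.ofReal (condInfo μ Φ n ω) ∂pathMeasure μ) / n) atTop
      (𝓝 0) := by
  have h1 := ENNReal.tendsto_ofReal h
  rw [ENNReal.ofReal_zero] at h1
  refine h1.congr' ?_
  filter_upwards [eventually_ge_atTop 1] with n hn
  rw [ENNReal.ofReal_div_of_pos (by exact_mod_cast hn), ENNReal.ofReal_natCast,
    ofReal_integral_eq_lintegral_ofReal (hΦ.integrable_condInfo hμ n) (hΦ.ae_condInfo_nonneg n)]

theorem ae_ofReal_condInfo_add_le (m n : ℕ) : ∀ᵐ ω ∂pathMeasure μ,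
    ENNReal.ofReal (condInfo μ Φ (m + n) ω) ≤
      ENNReal.ofReal (condInfo μ Φ m ω) + ENNReal.ofReal (condInfo μ Φ n (incrShift m ω)) := by
  filter_upwards [hΦ.ae_condInfo_add_le m n] with ω h
  exact (ENNReal.ofReal_le_ofReal h).trans ENNReal.ofReal_add_le

theorem ae_tendsto_condInfo_div (hμ : shannon μ ≠ ∞)
    (h : Tendsto (fun n : ℕ => (∫ ω, condInfo μ Φ n ω ∂pathMeasure μ) / n) atTop (𝓝 0)) :
    ∀ᵐ ω ∂pathMeasure μ, Tendsto (fun n : ℕ => condInfo μ Φ n ω / n) atTop (𝓝 0) := by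
  have hS : ∀ m, Measurable (incrShift m : (ℕ → G) → ℕ → G) := fun m =>
    (measurePreserving_incrShift μ m).measurable
  have hc := fun n => (hΦ.measurable_condInfo n).ennreal_ofReal
  have h1 := ae_tendsto_div_of_subadditive (ρ := pathMeasure μ)
    (fun m => Kernel.deterministic (incrShift m) (hS m))
    (fun m => (Measure.deterministic_comp_eq_map (hS m)).trans
      (measurePreserving_incrShift μ m).map_eq)
    (c := fun n ω => ENNReal.ofReal (condInfo μ Φ n ω)) hc (hΦ.lintegral_condInfo_ne_top hμ)
    (fun m n => by
      filter_upwards [hΦ.ae_ofReal_condInfo_add_le m n] with ω hω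
      rwa [Kernel.lintegral_deterministic' _ (hc n)])
    (hΦ.tendsto_lintegral_condInfo hμ h)
  filter_upwards [h1, ae_all_iff.2 hΦ.ae_condInfo_nonneg] with ω h2 h3
  have h4 := (ENNReal.tendsto_toReal ENNReal.zero_ne_top).comp h2
  refine h4.congr fun n => ?_
  simp [ENNReal.toReal_div, ENNReal.toReal_ofReal (h3 n)]

variable [StandardBorelSpace B]

/-- The conditional expectation of a function of the shifted path, given the boundary point, is
obtained by first conditioning on the boundary point of the shifted path. -/
theorem ae_lintegral_comp_incrShift [Nonempty B] (m : ℕ) {f : (ℕ → G) → ℝ≥0∞} (hf : Measurable f) :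
    ∀ᵐ b ∂harmonicMeasure μ Φ, ∫⁻ ω, f (incrShift m ω) ∂conditionalWalk μ Φ b =
      ∫⁻ b', (∫⁻ ω, f ω ∂conditionalWalk μ Φ b')
        ∂condDistrib (fun ω => Φ (incrShift m ω)) Φ (pathMeasure μ) b := by
  classical
  have := isProbabilityMeasure_harmonicMeasure μ hΦ.measurable
  have hS : Measurable (incrShift m : (ℕ → G) → ℕ → G) :=
    (measurePreserving_incrShift μ m).measurable
  have hC := measurable_lintegral_conditionalWalk μ Φ hf
  set C : B → ℝ≥0∞ := fun b => ∫⁻ ω, f ω ∂conditionalWalk μ Φ b with hCdef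
  refine ae_lintegral_conditionalWalk_eq μ hΦ.measurable (f := fun ω => f (incrShift m ω))
    (hf.comp hS)
    (g := fun b => ∫⁻ b', C b' ∂condDistrib (fun ω => Φ (incrShift m ω)) Φ (pathMeasure μ) b)
    hC.lintegral_kernel fun S hS' => ?_
  have hA : MeasurableSet (Φ ⁻¹' S) := hΦ.measurable hS'
  -- Split the path at time `m`. At a fixed position `x` the event only concerns the boundary point
  -- of the remaining path, so a function of that path may be replaced by its conditional mean given
  -- that point.
  have e : ∀ F : (ℕ → G) → ℝ≥0∞, Measurable F →
      ∫⁻ ω in Φ ⁻¹' S, F (incrShift m ω) ∂pathMeasure μ =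
        ∫⁻ x, ∫⁻ ω, S.indicator 1 (x • Φ ω) * F ω ∂pathMeasure μ ∂walkLaw μ m := by
    intro F hF
    have hmeas : Measurable fun p : G × (ℕ → G) =>
        S.indicator (1 : B → ℝ≥0∞) (p.1 • Φ p.2) * F p.2 :=
      ((measurable_one.indicator hS').comp (measurable_smul_of_countable.comp
        (measurable_fst.prodMk (hΦ.measurable.comp measurable_snd)))).mul (hF.comp measurable_snd)
    rw [← lintegral_apply_incrShift μ m hmeas, ← lintegral_indicator hA]
    refine lintegral_congr_ae ?_
    filter_upwards [hΦ.ae_eq_smul m] with ω hω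
    rw [← hω]
    by_cases h : Φ ω ∈ S <;> simp [h]
  have h1 : ∫⁻ ω in Φ ⁻¹' S, f (incrShift m ω) ∂pathMeasure μ =
      ∫⁻ ω in Φ ⁻¹' S, C (Φ (incrShift m ω)) ∂pathMeasure μ := by
    rw [e f hf, e (fun ω => C (Φ ω)) (hC.comp hΦ.measurable)]
    refine lintegral_congr fun x => ?_
    have hx : Measurable fun b : B => S.indicator (1 : B → ℝ≥0∞) (x • b) :=
      (measurable_one.indicator hS').comp (measurable_const_smul x)
    rw [lintegral_conditionalWalk μ hΦ.measurable
      (F := fun p : B × (ℕ → G) => S.indicator 1 (x • p.1) * f p.2)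
      ((hx.comp measurable_fst).mul (hf.comp measurable_snd))]
    have h2 : ∫⁻ ω, S.indicator 1 (x • Φ ω) * C (Φ ω) ∂pathMeasure μ =
        ∫⁻ b, S.indicator 1 (x • b) * C b ∂harmonicMeasure μ Φ := by
      rw [harmonicMeasure, lintegral_map (f := fun b => S.indicator 1 (x • b) * C b)
        (hx.mul hC) hΦ.measurable]
    rw [h2]
    exact lintegral_congr fun b => lintegral_const_mul (S.indicator 1 (x • b)) hf
  have h3 := compProd_map_condDistrib (μ := pathMeasure μ) (X := Φ)
    (Y := fun ω => Φ (incrShift m ω)) (mβ := inferInstance) (hΦ.measurable.comp hS).aemeasurable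
  have hm3 : Measurable fun p : B × B => S.indicator (1 : B → ℝ≥0∞) p.1 * C p.2 :=
    ((measurable_one.indicator hS').comp measurable_fst).mul (hC.comp measurable_snd)
  have hpm : Measurable fun ω => (Φ ω, Φ (incrShift m ω)) :=
    hΦ.measurable.prodMk (hΦ.measurable.comp hS)
  have h4 := congrArg (fun ρ : Measure (B × B) => ∫⁻ p, S.indicator (1 : B → ℝ≥0∞) p.1 * C p.2 ∂ρ) h3
  rw [Measure.lintegral_compProd hm3, lintegral_map hm3 hpm] at h4
  simp only at h4
  rw [h1, ← lintegral_indicator hA, ← lintegral_indicator hS']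
  have e1 : ∀ ω, (Φ ⁻¹' S).indicator (fun ω => C (Φ (incrShift m ω))) ω =
      S.indicator 1 (Φ ω) * C (Φ (incrShift m ω)) := fun ω => by
    by_cases h : Φ ω ∈ S <;> simp [h]
  simp only [e1]
  rw [← h4]
  refine lintegral_congr fun b => ?_
  rw [lintegral_const_mul _ hC]
  by_cases h : b ∈ S <;> simp [h]

/-- The conditional means are subadditive over the kernels giving the law of the boundary point of
the shifted path from that of the path. These preserve the harmonic measure because `incrShift`
preserves the law of the walk. The result is the `L¹` half of the asymptotic entropy for individual
conditional measures. -/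
theorem ae_tendsto_lintegral_condInfo_div [Nonempty B] (hμ : shannon μ ≠ ∞)
    (h : Tendsto (fun n : ℕ => (∫ ω, condInfo μ Φ n ω ∂pathMeasure μ) / n) atTop (𝓝 0)) :
    ∀ᵐ b ∂harmonicMeasure μ Φ, Tendsto (fun n : ℕ =>
      (∫⁻ ω, ENNReal.ofReal (condInfo μ Φ n ω) ∂conditionalWalk μ Φ b) / n) atTop (𝓝 0) := by
  have := isProbabilityMeasure_harmonicMeasure μ hΦ.measurable
  have hS : ∀ m, Measurable (incrShift m : (ℕ → G) → ℕ → G) := fun m =>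
    (measurePreserving_incrShift μ m).measurable
  have hc := fun n => (hΦ.measurable_condInfo n).ennreal_ofReal
  have hinteg : ∀ n, ∫⁻ b, (∫⁻ ω, ENNReal.ofReal (condInfo μ Φ n ω) ∂conditionalWalk μ Φ b)
      ∂harmonicMeasure μ Φ = ∫⁻ ω, ENNReal.ofReal (condInfo μ Φ n ω) ∂pathMeasure μ := fun n =>
    (lintegral_conditionalWalk μ hΦ.measurable
      (F := fun p => ENNReal.ofReal (condInfo μ Φ n p.2)) ((hc n).comp measurable_snd)).symm
  refine ae_tendsto_div_of_subadditive (ρ := harmonicMeasure μ Φ)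
    (fun m => condDistrib (fun ω => Φ (incrShift m ω)) Φ (pathMeasure μ)) (fun m => ?_)
    (c := fun n b => ∫⁻ ω, ENNReal.ofReal (condInfo μ Φ n ω) ∂conditionalWalk μ Φ b)
    (fun n => measurable_lintegral_conditionalWalk μ Φ (hc n))
    (fun n => by rw [hinteg]; exact hΦ.lintegral_condInfo_ne_top hμ n) (fun m n => ?_) ?_
  · have h1 := condDistrib_comp_map (μ := pathMeasure μ) (X := Φ)
      (Y := fun ω => Φ (incrShift m ω)) (mβ := inferInstance) hΦ.measurable.aemeasurable
      (hΦ.measurable.comp (hS m)).aemeasurable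
    refine h1.trans ?_
    have h2 := Measure.map_map (μ := pathMeasure μ) hΦ.measurable (hS m)
    rw [(measurePreserving_incrShift μ m).map_eq] at h2
    exact h2.symm
  · have hle := ae_ae_conditionalWalk μ hΦ.measurable (p := fun _ ω =>
      ENNReal.ofReal (condInfo μ Φ (m + n) ω) ≤
        ENNReal.ofReal (condInfo μ Φ m ω) + ENNReal.ofReal (condInfo μ Φ n (incrShift m ω)))
      (measurableSet_le ((hc (m + n)).comp measurable_snd)
        (((hc m).comp measurable_snd).add (((hc n).comp (hS m)).comp measurable_snd)))
      (hΦ.ae_ofReal_condInfo_add_le m n)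
    filter_upwards [hle, hΦ.ae_lintegral_comp_incrShift m (hc n)] with b h1 h2
    rw [← h2, ← lintegral_add_left (hc m)]
    exact lintegral_mono_ae h1
  · simp only [hinteg]
    exact hΦ.tendsto_lintegral_condInfo hμ h

theorem ae_ae_information_eq : ∀ᵐ b ∂harmonicMeasure μ Φ, ∀ᵐ ω ∂conditionalWalk μ Φ b, ∀ n : ℕ,
    information (conditionalWalk μ Φ b) n ω = condInfo μ Φ n ω / n := by
  have hm : ∀ n, MeasurableSet {q : B × (ℕ → G) | condInfo μ Φ n q.2 = -Real.log
      (walkLaw μ n {q.2 n} * boundaryDensity (harmonicMeasure μ Φ) q.1 (q.2 n)).toReal} := by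
    intro n
    have h1 : Measurable fun p : G × B => walkLaw μ n {p.1} *
        boundaryDensity (harmonicMeasure μ Φ) p.2 p.1 :=
      ((measurable_of_countable fun x : G => walkLaw μ n {x}).comp measurable_fst).mul
        (measurable_boundaryDensity_uncurry _)
    have hq : Measurable fun q : B × (ℕ → G) => ((q.2 n, q.1) : G × B) := by fun_prop
    exact measurableSet_eq_fun ((hΦ.measurable_condInfo n).comp measurable_snd)
      (h1.comp hq).ennreal_toReal.log.neg
  have h := ae_all_iff.2 fun n => ae_ae_conditionalWalk μ hΦ.measurable
    (p := fun b ω => condInfo μ Φ n ω = -Real.log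
      (walkLaw μ n {ω n} * boundaryDensity (harmonicMeasure μ Φ) b (ω n)).toReal) (hm n)
    (hΦ.ae_condInfo_eq n)
  filter_upwards [h, hΦ.ae_conditionalWalk_singleton] with b h1 h2
  filter_upwards [ae_all_iff.2 h1] with ω h3 n
  rw [information, Measure.real, h2, h3]
  ring

/-- If the mean conditional information grows sublinearly, then almost all conditional measures
have vanishing asymptotic entropy. -/
theorem ae_hasAsymptoticEntropy_zero (hμ : shannon μ ≠ ∞)
    (h : Tendsto (fun n : ℕ => (∫ ω, condInfo μ Φ n ω ∂pathMeasure μ) / n) atTop (𝓝 0)) :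
    ∀ᵐ b ∂harmonicMeasure μ Φ, HasAsymptoticEntropy (conditionalWalk μ Φ b) 0 := by
  have : Nonempty B := ⟨Φ 1⟩
  have := isProbabilityMeasure_harmonicMeasure μ hΦ.measurable
  have hcond := hΦ.measurable_condInfo
  have hc := fun n => (hcond n).ennreal_ofReal
  have h1 := ae_ae_conditionalWalk μ hΦ.measurable
    (p := fun _ ω => Tendsto (fun n : ℕ => condInfo μ Φ n ω / n) atTop (𝓝 0))
    (measurable_snd (measurableSet_tendsto (𝓝 (0 : ℝ)) fun n => (hcond n).div_const _))
    (hΦ.ae_tendsto_condInfo_div hμ h)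
  have h2 := ae_all_iff.2 fun n => ae_lt_top (measurable_lintegral_conditionalWalk μ Φ (hc n))
    (by
      rw [← lintegral_conditionalWalk μ hΦ.measurable
        (F := fun p => ENNReal.ofReal (condInfo μ Φ n p.2)) ((hc n).comp measurable_snd)]
      exact hΦ.lintegral_condInfo_ne_top hμ n)
  filter_upwards [h1, h2, hΦ.ae_ae_information_eq, hΦ.ae_tendsto_lintegral_condInfo_div hμ h]
    with b hb1 hb2 hb3 hb4
  have hL : ∀ n : ℕ, ∫⁻ ω, ‖information (conditionalWalk μ Φ b) n ω‖ₑ ∂conditionalWalk μ Φ b =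
      ENNReal.ofReal (n : ℝ)⁻¹ *
        ∫⁻ ω, ENNReal.ofReal (condInfo μ Φ n ω) ∂conditionalWalk μ Φ b := by
    intro n
    rw [← lintegral_const_mul _ (hc n)]
    refine lintegral_congr_ae ?_
    filter_upwards [hb3] with ω hω
    rw [Real.enorm_of_nonneg (information_nonneg _ _ _), hω n, div_eq_inv_mul,
      ENNReal.ofReal_mul (by positivity)]
  refine ⟨?_, fun n => ?_, ?_⟩
  · filter_upwards [hb1, hb3] with ω h5 h6
    exact h5.congr fun n => (h6 n).symm
  · refine ⟨(measurable_information _ n).aestronglyMeasurable, ?_⟩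
    rw [HasFiniteIntegral, hL]
    exact ENNReal.mul_lt_top ENNReal.ofReal_lt_top (hb2 n)
  · refine hb4.congr' ?_
    filter_upwards [eventually_ge_atTop 1] with n hn
    simp only [sub_zero]
    rw [eLpNorm_one_eq_lintegral_enorm, hL, ENNReal.ofReal_inv_of_pos (by exact_mod_cast hn),
      ENNReal.ofReal_natCast, mul_comm, div_eq_mul_inv]

end IsBoundaryMap

theorem IsPoissonBoundary.isMaximalMap_comp {Γ : Type*} [MeasurableSpace Γ] [MulAction G Γ]
    {bnd : (ℕ → G) → Γ} (hbnd : IsPoissonBoundary μ bnd) {π : Γ → B} {lam : Measure B}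
    (h : IsIsoModNull (harmonicMeasure μ bnd) lam π) : IsMaximalMap μ (π ∘ bnd) := by
  obtain ⟨ψ, hψ, h1, -⟩ := h
  intro A hA
  obtain ⟨S, hS, hSA⟩ := hbnd.preimage_of_invariant A hA
  refine ⟨ψ ⁻¹' S, hψ hS, EventuallyEq.trans ?_ ((pathMeasure_absolutelyContinuous μ).ae_le hSA)⟩
  refine eventuallyEq_set.2 ?_
  filter_upwards [ae_of_ae_map hbnd.measurable.aemeasurable h1] with ω hω
  simp only [Set.mem_preimage, Function.comp, hω]

end AsymptoticEntropy

end RandomWalk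

end

/-! ### The entropy criterion, as a cycle of three implications -/

theorem theorem4p6 {G : Type*} [Group G] [Countable G] [MeasurableSpace G]
    [MeasurableSingletonClass G] (μ : Measure G) [IsProbabilityMeasure μ]
    (hμ : HasFiniteEntropy μ)
    {Γ : Type*} [MeasurableSpace Γ] [StandardBorelSpace Γ] [MulAction G Γ]
    [MeasurableConstSMul G Γ] (bnd : (ℕ → G) → Γ) (hbnd : IsPoissonBoundary μ bnd)
    {B : Type*} [MeasurableSpace B] [StandardBorelSpace B] [MulAction G B]
    [MeasurableConstSMul G B] (lam : Measure B) (π : Γ → B)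
    (hπ : IsMuBoundary μ bnd π lam) :
    (∀ᵐ b ∂lam, IsDoobTransform μ (boundaryDensity lam b) (conditionalWalk μ (π ∘ bnd) b)) ∧
    (IsIsoModNull (harmonicMeasure μ bnd) lam π ↔
      ∀ᵐ b ∂lam, HasAsymptoticEntropy (conditionalWalk μ (π ∘ bnd) b) 0) ∧
    (IsIsoModNull (harmonicMeasure μ bnd) lam π ↔
      ∀ᵐ b ∂lam, IsSubexponentiallyConcentrated (conditionalWalk μ (π ∘ bnd) b)) := by
  have hΨ := hbnd.isBoundaryMap
  have hΦ := IsMuBoundary.isBoundaryMap hbnd hπ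
  have hlam := IsMuBoundary.harmonicMeasure_comp hbnd hπ
  have hent := hμ.shannon_ne_top
  have h01 : IsIsoModNull (harmonicMeasure μ bnd) lam π →
      ∀ᵐ b ∂lam, HasAsymptoticEntropy (conditionalWalk μ (π ∘ bnd) b) 0 := fun h => by
    have := hΦ.ae_hasAsymptoticEntropy_zero hent
      (hΦ.tendsto_integral_condInfo hμ (hbnd.isMaximalMap_comp h))
    rwa [hlam] at this
  have h12 : (∀ᵐ b ∂lam, HasAsymptoticEntropy (conditionalWalk μ (π ∘ bnd) b) 0) →
      ∀ᵐ b ∂lam, IsSubexponentiallyConcentrated (conditionalWalk μ (π ∘ bnd) b) := fun h =>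
    h.mono fun b hb => hb.isSubexponentiallyConcentrated
  have h20 : (∀ᵐ b ∂lam, IsSubexponentiallyConcentrated (conditionalWalk μ (π ∘ bnd) b)) →
      IsIsoModNull (harmonicMeasure μ bnd) lam π := fun h => by
    have := isIsoModNull_of_isSubexponentiallyConcentrated hent hΨ hπ.measurable hΦ
      (by rwa [hlam])
    rwa [hlam] at this
  refine ⟨?_, ⟨h01, fun h => h20 (h12 h)⟩, ⟨fun h => h12 (h01 h), h20⟩⟩
  have := hΦ.ae_isDoobTransform
  rwa [hlam] at this
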